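/- Let $\mathcal R$ be the hyperfinite II$_1$ factor with trace $\tau$ and 2-norm $\|a\|_2=\tau(a^*a)^{1/2}$. Let $\mathcal R_1$ be its operator-norm unit ball. Connectives. Fix a countable system $(u_m)_{m\in\mathbb N}$ of continuous functions $u_m:\mathbb R^{k_m}\to\mathbb R$ with the following properties. (a) For each $k\ge 1$, the compactly supported $u_m$ of arity $k$ are uniformly dense in $C_c(\mathbb R^k)$. (b) There is an algorithm which, given (a program for) a computable $f\in C_c(\mathbb R^k)$ and a rational $\delta>0$, returns $m$ with $k_m=k$ and $|f-u_m|<\delta$ everywhere. (c) The system contains $x+y$, $x\cdot y$, $\max(x-y,0)$, $x\mapsto\lambda x$ for every $\lambda\in\mathbb Q$, and the unary constants $0$ and $1$. (d) The $u_m$ are computable uniformly in $m$: the arity $k_m$, rational approximations to the values at rational points, and moduli of uniform continuity on the boxes $[-N,N]^{k_m}$ can all be computed from $m$. Universal theory. A restricted universal sentence is an expression $\sigma=\sup_{x_1}\cdots\sup_{x_n}\varphi(x_1,\dots,x_n)$, where $x_i$ ranges over the operators of norm at most $r_i\in\mathbb N$. Here $\varphi$ is built with the connectives $u_m$ from the atomic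 formulas $\operatorname{Re}\tau(s)$, $\operatorname{Im}\tau(s)$ and $\|s-t\|_2$, with $s,t$ $*$-polynomials in $x_1,\dots,x_n$ over $\mathbb Q(i)$. Write $\sigma^{\mathcal R}$ for its value in $\mathcal R$. We say that $\operatorname{Th}_\forall(\mathcal R)$ is computable if there is an algorithm which, given a restricted universal sentence $\sigma$ and a rational $\delta>0$, returns rationals $a<b$ with $b-a<\delta$ and $\sigma^{\mathcal R}\in(a,b)$. Moments. For positive integers $n,d$ let $m_1,\dots,m_L$ be the $*$-monomials in $x_1,\dots,x_n$ of total degree at most $d$. Define $$X(n,d)=\{(\tau(m_i(\vec a)))_{i\le L}:\vec a\in\mathcal R_1^n\}\subseteq\mathbb C^L.$$ For $p\ge 1$ let $X(n,d,p)\subseteq\mathbb C^L$ be the set of vectors $(\operatorname{tr}_p(m_i(\vec a)))_{i\le L}$, where $\vec a$ ranges over $n$-tuples from the operator-norm unit ball of $M_p(\mathbb C)$ and $\operatorname{tr}_p$ is the normalized trace. Theorem. The following are equivalent: (1) $\operatorname{Th}_\forall(\mathcal R)$ is computable. (2) There is a computable function $F:\mathbb N^3\to\mathbb N$ such that, for all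 positive integers $n,d,k$, $F(n,d,k)\ge 1$ and $X(n,d,F(n,d,k))$ is $\frac1k$-dense in $X(n,d)$; that is, for every $t\in X(n,d)$ there is $s\in X(n,d,F(n,d,k))$ with Euclidean distance $|t-s|<\frac1k$. -/

import Mathlib

open scoped symmDiff ENNReal

noncomputable section

/-! ### The hyperfinite II₁ factor

`M₂(ℂ)`, with the inner product given by its normalized trace, has the orthonormal basis
`1, X, Z, XZ`, where `X, Z` are self-adjoint unitaries with `ZX = -XZ`.  Consequently the algebraic
tensor product of countably many copies of `(M₂(ℂ), tr)` has an orthonormal basis of finite words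
`X_S Z_T`, for `S, T` finite sets of positions, which multiply by
`X_S Z_T * X_A Z_B = (-1) ^ |T ∩ A| * X_{S ∆ A} Z_{T ∆ B}`.
Its trace representation therefore lives on `ℓ²` of the set of pairs `(S, T)`, and the hyperfinite
II₁ factor is the double commutant of the algebra in that representation, with the vector state of
the empty word as its trace. -/

/-- Indices `(S, T)` of the words `X_S Z_T`. -/
abbrev PauliIndex : Type := Finset ℕ × Finset ℕ

/-- The `L²`-space of the infinite tensor product of copies of `(M₂(ℂ), tr)`. -/
abbrev TraceSpace : Type := lp (fun _ : PauliIndex => ℂ) 2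

/-- The index of the product of two words; an involution in the second argument. -/
def PauliIndex.shift (g : PauliIndex) : PauliIndex ≃ PauliIndex where
  toFun h := (g.1 ∆ h.1, g.2 ∆ h.2)
  invFun h := (g.1 ∆ h.1, g.2 ∆ h.2)
  left_inv h := by simp
  right_inv h := by simp

/-- The sign in `X_S Z_T * X_A Z_B = ± X_{S ∆ A} Z_{T ∆ B}`. -/
def PauliIndex.sign (g h : PauliIndex) : ℂ := (-1) ^ (g.2 ∩ h.1).card

theorem PauliIndex.norm_sign (g h : PauliIndex) : ‖g.sign h‖ = 1 := by
  simp [PauliIndex.sign]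

theorem pauli_memℓp (g : PauliIndex) (f : TraceSpace) :
    Memℓp (fun h : PauliIndex => g.sign (g.shift h) * f (g.shift h)) 2 := by
  have hp : 0 < (2 : ℝ≥0∞).toReal := by norm_num
  have hf := (memℓp_gen_iff hp).1 (lp.memℓp f)
  refine (memℓp_gen_iff hp).2 ?_
  simpa [PauliIndex.norm_sign, Function.comp_def] using hf.comp_injective g.shift.injective

/-- Left multiplication by the word `X_S Z_T` on `TraceSpace`: it sends the basis vector with
index `h` to `g.sign h` times the basis vector with index `g.shift h`. -/
def pauliIsometry (g : PauliIndex) : TraceSpace →ₗᵢ[ℂ] TraceSpace where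
  toFun f := ⟨fun h => g.sign (g.shift h) * f (g.shift h), pauli_memℓp g f⟩
  map_add' f₁ f₂ := by
    ext h
    change _ * (f₁ + f₂) _ = _ * f₁ _ + _ * f₂ _
    simp [mul_add]
  map_smul' c f := by
    ext h
    change _ * (c • f) _ = c • (_ * f _)
    simp [mul_left_comm]
  norm_map' f := by
    have hp : 0 < (2 : ℝ≥0∞).toReal := by norm_num
    rw [lp.norm_eq_tsum_rpow hp, lp.norm_eq_tsum_rpow hp]
    congr 1
    change ∑' h, ‖g.sign (g.shift h) * f (g.shift h)‖ ^ (2 : ℝ≥0∞).toReal = _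
    simp only [norm_mul, PauliIndex.norm_sign, one_mul]
    exact g.shift.tsum_eq (fun h => ‖f h‖ ^ (2 : ℝ≥0∞).toReal)

/-- The operators of left multiplication by the words `X_S Z_T`. -/
def pauliOperator (g : PauliIndex) : TraceSpace →L[ℂ] TraceSpace :=
  (pauliIsometry g).toContinuousLinearMap

/-- The hyperfinite II₁ factor: the von Neumann algebra generated by the infinite tensor product
of copies of `M₂(ℂ)` in its trace representation. -/
def hyperfiniteFactor : VonNeumannAlgebra TraceSpace where
  toStarSubalgebra := StarSubalgebra.centralizer ℂ
    (StarSubalgebra.centralizer ℂ (Set.range pauliOperator) : Set (TraceSpace →L[ℂ] TraceSpace))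
  centralizer_centralizer' := by
    change Set.centralizer (Set.centralizer (Set.centralizer _)) = Set.centralizer _
    exact Set.centralizer_centralizer_centralizer _

/-- The hyperfinite II₁ factor, as an algebra. -/
abbrev HyperfiniteR : Type := hyperfiniteFactor.toStarSubalgebra

/-- The basis vector of the empty word, that is, the image of `1` in `TraceSpace`. -/
def vacuum : TraceSpace := lp.single 2 ((∅, ∅) : PauliIndex) (1 : ℂ)

/-- The trace of the hyperfinite II₁ factor. -/
def traceR (a : HyperfiniteR) : ℂ := inner ℂ vacuum ((a : TraceSpace →L[ℂ] TraceSpace) vacuum)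

/-! ### Noncommutative moments -/

/-- The *-monomials in `n` variables of total degree at most `d`: words of length at most `d` in
the letters `(i, false)`, standing for `x i`, and `(i, true)`, standing for `star (x i)`. -/
abbrev StarMonomial (n d : ℕ) : Type := (l : Fin (d + 1)) × (Fin l → Fin n × Bool)

/-- The value of a *-monomial at a tuple. -/
def StarMonomial.eval {n d : ℕ} {A : Type*} [Monoid A] [Star A] (m : StarMonomial n d)
    (x : Fin n → A) : A :=
  (List.ofFn fun j => if (m.2 j).2 then star (x (m.2 j).1) else x (m.2 j).1).prod

/-- The vector of moments of degree at most `d` of a tuple, with respect to a trace `tr`. -/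
def momentVector {n : ℕ} (d : ℕ) {A : Type*} [Monoid A] [Star A] (tr : A → ℂ) (x : Fin n → A) :
    EuclideanSpace ℂ (StarMonomial n d) :=
  WithLp.toLp 2 fun m => tr (m.eval x)

/-- The set `X(n, d)` of moment vectors of `n`-tuples from the unit ball of the hyperfinite
II₁ factor. -/
def momentSet (n d : ℕ) : Set (EuclideanSpace ℂ (StarMonomial n d)) :=
  {s | ∃ x : Fin n → HyperfiniteR, (∀ i, ‖x i‖ ≤ 1) ∧ momentVector d traceR x = s}

/-- The normalized trace on `p × p` matrices. -/
def normalizedTrace {p : ℕ} (a : Matrix (Fin p) (Fin p) ℂ) : ℂ := a.trace / p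

/-- The set `X(n, d, p)` of moment vectors of `n`-tuples from the (operator norm) unit ball of
`M_p(ℂ)`. -/
def matrixMomentSet (n d p : ℕ) : Set (EuclideanSpace ℂ (StarMonomial n d)) :=
  {s | ∃ x : Fin n → Matrix (Fin p) (Fin p) ℂ,
    (∀ i, ‖Matrix.toEuclideanCLM (n := Fin p) (𝕜 := ℂ) (x i)‖ ≤ 1) ∧
      momentVector d normalizedTrace x = s}

/-- `S` is `ε`-dense in `T`. -/
def IsEpsDenseIn {E : Type*} [PseudoMetricSpace E] (ε : ℝ) (S T : Set E) : Prop :=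
  ∀ t ∈ T, ∃ s ∈ S, dist t s < ε

/-! ### Computability over the rationals and the reals -/

/-- Codes of rational numbers: `(a, b, c)` stands for `(a - b) / (c + 1)`. -/
abbrev RatCode : Type := ℕ × ℕ × ℕ

/-- The rational number with a given code. -/
def RatCode.val (q : RatCode) : ℚ := ((q.1 : ℚ) - (q.2.1 : ℚ)) / ((q.2.2 : ℚ) + 1)

/-- The point of `ℝ^k` with given rational coordinates. -/
def ratPoint {k : ℕ} (q : Fin k → RatCode) : Fin k → ℝ := fun i => ((q i).val : ℝ)

/-- `(e, m, N)` is a finite description of the compactly supported function `f : ℝ^k → ℝ` as a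
computable function: the program `e` approximates the values of `f` at rational points to any
precision, the program `m` computes a modulus of uniform continuity of `f`, and `f` vanishes
outside `[-N, N]^k`. -/
def IsNameOf {k : ℕ} (c : Nat.Partrec.Code × Nat.Partrec.Code × ℕ) (f : (Fin k → ℝ) → ℝ) : Prop :=
  (∀ (q : Fin k → RatCode) (j : ℕ), ∃ r : RatCode,
    Encodable.encode r ∈ c.1.eval (Encodable.encode (List.ofFn q, j)) ∧
      |f (ratPoint q) - (r.val : ℝ)| < 1 / ((j : ℝ) + 1)) ∧
  (∀ j : ℕ, ∃ l ∈ c.2.1.eval j, ∀ x y : Fin k → ℝ,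
    dist x y < 1 / ((l : ℝ) + 1) → |f x - f y| < 1 / ((j : ℝ) + 1)) ∧
  (∀ x : Fin k → ℝ, (c.2.2 : ℝ) < ‖x‖ → f x = 0)

/-- A countable system of restricted connectives `(fn m)` for continuous logic. -/
structure ConnectiveSystem where
  /-- The `m`-th connective takes `arity m` arguments. -/
  arity : ℕ → ℕ
  /-- The `m`-th connective. -/
  fn : (m : ℕ) → (Fin (arity m) → ℝ) → ℝ
  continuous_fn : ∀ m, Continuous (fn m)
  /-- The compactly supported members of the system of each arity are uniformly dense in the
  compactly supported continuous functions. -/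
  dense : ∀ k, 0 < k → ∀ f : (Fin k → ℝ) → ℝ, Continuous f → HasCompactSupport f →
    ∀ ε : ℝ, 0 < ε → ∃ (m : ℕ) (h : arity m = k), HasCompactSupport (fn m) ∧
      ∀ x : Fin k → ℝ, |f x - fn m (fun i => x (Fin.cast h i))| < ε
  /-- There is an algorithm which, from a description of a compactly supported computable function
  and a rational `δ > 0`, finds a member of the system at distance less than `δ`. -/
  effective_dense : ∃ alg : ℕ × (Nat.Partrec.Code × Nat.Partrec.Code × ℕ) × RatCode →. ℕ,
    Partrec alg ∧ ∀ k, 0 < k → ∀ (c : Nat.Partrec.Code × Nat.Partrec.Code × ℕ)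
      (f : (Fin k → ℝ) → ℝ), Continuous f → IsNameOf c f → ∀ δ : RatCode, 0 < δ.val →
        ∃ m ∈ alg (k, c, δ), ∃ h : arity m = k,
          ∀ x : Fin k → ℝ, |f x - fn m (fun i => x (Fin.cast h i))| < (δ.val : ℝ)
  /-- The arity is computable. -/
  computable_arity : Computable arity
  /-- The connectives are uniformly computable at rational points ... -/
  computable_fn : ∃ approx : ℕ × List RatCode × ℕ → RatCode, Computable approx ∧
    ∀ (m : ℕ) (q : Fin (arity m) → RatCode) (j : ℕ),
      |fn m (ratPoint q) - ((approx (m, List.ofFn q, j)).val : ℝ)| < 1 / ((j : ℝ) + 1)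
  /-- ... and have, uniformly, computable moduli of continuity on each box `[-N, N]^k`. -/
  computable_modulus : ∃ modulus : ℕ × ℕ × ℕ → ℕ, Computable modulus ∧
    ∀ (m N j : ℕ) (x y : Fin (arity m) → ℝ), ‖x‖ ≤ N → ‖y‖ ≤ N →
      dist x y < 1 / ((modulus (m, N, j) : ℝ) + 1) → |fn m x - fn m y| < 1 / ((j : ℝ) + 1)
  /-- The system contains addition, ... -/
  exists_add : ∃ (m : ℕ) (h : arity m = 2), ∀ x, fn m x = x (Fin.cast h.symm 0) + x (Fin.cast h.symm 1)
  /-- multiplication, -/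
  exists_mul : ∃ (m : ℕ) (h : arity m = 2), ∀ x, fn m x = x (Fin.cast h.symm 0) * x (Fin.cast h.symm 1)
  /-- multiplication by any rational number, in particular by `1 / 2`, -/
  exists_smul : ∀ r : ℚ, ∃ (m : ℕ) (h : arity m = 1), ∀ x, fn m x = r * x (Fin.cast h.symm 0)
  /-- truncated subtraction, -/
  exists_tsub : ∃ (m : ℕ) (h : arity m = 2), ∀ x,
    fn m x = max (x (Fin.cast h.symm 0) - x (Fin.cast h.symm 1)) 0
  /-- and the unary constant functions `0` -/
  exists_zero : ∃ m, arity m = 1 ∧ ∀ x, fn m x = 0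
  /-- and `1`. -/
  exists_one : ∃ m, arity m = 1 ∧ ∀ x, fn m x = 1

/-! ### The language of tracial von Neumann algebras -/

/-- Terms of the language of tracial von Neumann algebras in `n` variables: *-polynomials with
coefficients in `ℚ(i)`.  The term `smul a b t` is `(a + b i) t`. -/
inductive VNTerm (n : ℕ) : Type
  | var (i : Fin n) : VNTerm n
  | zero : VNTerm n
  | one : VNTerm n
  | add (s t : VNTerm n) : VNTerm n
  | mul (s t : VNTerm n) : VNTerm n
  | star (t : VNTerm n) : VNTerm n
  | smul (a b : RatCode) (t : VNTerm n) : VNTerm n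

/-- Restricted quantifier-free formulas in `n` variables.  The atomic formulas are the real and
imaginary parts of the trace of a term and the distance `‖s - t‖₂` of two terms. -/
inductive QFFormula (u : ConnectiveSystem) (n : ℕ) : Type
  | traceRe (t : VNTerm n) : QFFormula u n
  | traceIm (t : VNTerm n) : QFFormula u n
  | dist (s t : VNTerm n) : QFFormula u n
  | conn (m : ℕ) (args : Fin (u.arity m) → QFFormula u n) : QFFormula u n

/-- Restricted universal sentences: `sup_{x₁} ⋯ sup_{xₙ} φ(x₁, …, xₙ)` with `φ` quantifier-free,
where `xᵢ` ranges over the sort of operators of norm at most `radius i`. -/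
structure UniversalSentence (u : ConnectiveSystem) : Type where
  /-- The number of quantified variables. -/
  n : ℕ
  /-- The sorts of the quantified variables. -/
  radius : Fin n → ℕ
  /-- The quantifier-free part. -/
  body : QFFormula u n

/-- Gödel numbers of terms. -/
def VNTerm.code {n : ℕ} : VNTerm n → ℕ
  | var i => Nat.pair 0 i
  | zero => Nat.pair 1 0
  | one => Nat.pair 2 0
  | add s t => Nat.pair 3 (Nat.pair s.code t.code)
  | mul s t => Nat.pair 4 (Nat.pair s.code t.code)
  | star t => Nat.pair 5 t.code
  | smul a b t => Nat.pair 6 (Nat.pair (Encodable.encode (a, b)) t.code)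

/-- Gödel numbers of quantifier-free formulas. -/
def QFFormula.code {u : ConnectiveSystem} {n : ℕ} : QFFormula u n → ℕ
  | traceRe t => Nat.pair 0 t.code
  | traceIm t => Nat.pair 1 t.code
  | dist s t => Nat.pair 2 (Nat.pair s.code t.code)
  | conn m args => Nat.pair 3 (Nat.pair m (Encodable.encode (List.ofFn fun i => (args i).code)))

/-- Gödel numbers of universal sentences. -/
def UniversalSentence.code {u : ConnectiveSystem} (σ : UniversalSentence u) : ℕ :=
  Nat.pair (Encodable.encode (List.ofFn σ.radius)) σ.body.code

/-- The value of a term in the hyperfinite II₁ factor. -/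
def VNTerm.eval {n : ℕ} (x : Fin n → HyperfiniteR) : VNTerm n → HyperfiniteR
  | var i => x i
  | zero => 0
  | one => 1
  | add s t => s.eval x + t.eval x
  | mul s t => s.eval x * t.eval x
  | star t => Star.star (t.eval x)
  | smul a b t => ((a.val : ℂ) + (b.val : ℂ) * Complex.I) • t.eval x

/-- The 2-norm `‖a‖₂ = τ(a* a) ^ (1 / 2)` on the hyperfinite II₁ factor. -/
def twoNorm (a : HyperfiniteR) : ℝ := Real.sqrt (traceR (star a * a)).re

/-- The value of a quantifier-free formula in the hyperfinite II₁ factor. -/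
def QFFormula.eval {u : ConnectiveSystem} {n : ℕ} (x : Fin n → HyperfiniteR) : QFFormula u n → ℝ
  | traceRe t => (traceR (t.eval x)).re
  | traceIm t => (traceR (t.eval x)).im
  | dist s t => twoNorm (s.eval x - t.eval x)
  | conn m args => u.fn m fun i => (args i).eval x

/-- The value `σ^R` of a universal sentence in the hyperfinite II₁ factor.  (The supremum is over a
nonempty set, on which the continuous connectives keep the formula bounded.) -/
def UniversalSentence.value {u : ConnectiveSystem} (σ : UniversalSentence u) : ℝ :=
  ⨆ x : {x : Fin σ.n → HyperfiniteR // ∀ i, ‖x i‖ ≤ σ.radius i}, σ.body.eval x.1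

/-- The universal theory of the hyperfinite II₁ factor is computable: there is an algorithm which,
from a restricted universal sentence `σ` and a rational `δ > 0`, computes rationals `a < b` with
`b - a < δ` and `σ^R ∈ (a, b)`. -/
def UniversalTheoryComputable (u : ConnectiveSystem) : Prop :=
  ∃ alg : ℕ × RatCode →. RatCode × RatCode, Partrec alg ∧
    ∀ (σ : UniversalSentence u) (δ : RatCode), 0 < δ.val →
      ∃ a b : RatCode, (a, b) ∈ alg (σ.code, δ) ∧ b.val - a.val < δ.val ∧
        σ.value ∈ Set.Ioo (a.val : ℝ) (b.val : ℝ)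

end

/-!
The two conditions are linked by two approximation facts about the hyperfinite factor `R`, which
lives on `ℓ²` of the words `X_S Z_T`.

* Moments of contractions in `R` are limits of moments of contractive matrices
  (`exists_matrix_tendsto`).  Compress the operators to the span of the words in the first `N`
  positions.  The projections onto these subspaces converge strongly to `1`, so the vacuum state of
  a word in the compressions converges to its trace.  Elements of `R` commute with right
  multiplication by words, which permutes the basis of the subspace up to sign; hence all diagonal
  matrix coefficients agree, and the vacuum state of a word in the compressions is their normalized
  trace.  As `X(n, d)` is totally bounded, one dimension serves all tuples (`exists_isEpsDenseIn`).
* Conversely, moments of contractive `p × p` matrices are approximated by those of contractions in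
  `R` (`exists_hyperfinite_near`): place `⌊2 ^ N / p⌋` copies of the matrices on the diagonal of the
  copy of the `2 ^ N × 2 ^ N` matrices in `R`, which is spanned by the matrix units built from the
  words `X_S Z_T`.

The unit ball of `M_p(ℂ)` has computable finite nets (`matrixNet`) of tuples with Gaussian rational
entries: contractivity is tested on the Frobenius norm of a high power of `A* A`, which is rational.

From a rate of density `F` the universal theory is computed by evaluating the body of a sentence on
the net in dimension `F (n, d, k)`, and taking the maximum.  A formula depends on the traces of
finitely many words only.  Bounds for the values of subformulas and the moduli of continuity of the
connectives give, for each stage `J`, the degree and accuracy of moments that are needed and the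
resulting precision (`QFFormula.approx_spec`); this precision tends to infinity with `J`
(`exists_le_formulaPrec`), so the algorithm searches for a stage at which it is sufficient
(`universalTheoryComputable_of_rate`).

From an algorithm for the universal theory a rate is found by search.  For a net in dimension `p`
consider the sentence expressing the greatest squared distance of the moments of a tuple from those
of the net, capped at `1` (`netSentence`); minima are expressed by truncated subtraction.  If the
algorithm finds that its value is below `1 / (k + 1) ^ 2`, then `X(n, d, p)` is sufficiently dense
(`isEpsDenseIn_of_value_lt`), and by the first approximation fact this happens for some net
(`exists_value_netSentence_le`).

All computations are carried out on Gödel numbers, by functions whose computability is established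
by the `fun_prop` tactic from closure properties of `Computable`.
-/

noncomputable section

/-! ### Computable functions -/

/- With the closure properties below tagged as rules for `fun_prop`, a function written with
`List.map`, `List.foldr`, `Nat.rec`, `bif` and arithmetic is shown to be computable by unfolding
it. -/
attribute [fun_prop] Computable

namespace Computable

variable {α β γ σ : Type*} [Primcodable α] [Primcodable β] [Primcodable γ] [Primcodable σ]

attribute [fun_prop] Computable.id Computable.const

@[fun_prop]
theorem comp_fun {f : β → σ} {g : α → β} (hf : Computable f) (hg : Computable g) :
    Computable fun a => f (g a) := hf.comp hg

@[fun_prop]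
theorem fst_fun {f : α → β × γ} (hf : Computable f) : Computable fun a => (f a).1 :=
  Computable.fst.comp hf

@[fun_prop]
theorem snd_fun {f : α → β × γ} (hf : Computable f) : Computable fun a => (f a).2 :=
  Computable.snd.comp hf

@[fun_prop]
theorem prodMk_fun {f : α → β} {g : α → γ} (hf : Computable f) (hg : Computable g) :
    Computable fun a => (f a, g a) := hf.pair hg

@[fun_prop]
theorem nat_add_fun {f g : α → ℕ} (hf : Computable f) (hg : Computable g) :
    Computable fun a => f a + g a := Primrec.nat_add.to_comp.comp hf hg

@[fun_prop]
theorem nat_mul_fun {f g : α → ℕ} (hf : Computable f) (hg : Computable g) :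
    Computable fun a => f a * g a := Primrec.nat_mul.to_comp.comp hf hg

@[fun_prop]
theorem nat_sub_fun {f g : α → ℕ} (hf : Computable f) (hg : Computable g) :
    Computable fun a => f a - g a := Primrec.nat_sub.to_comp.comp hf hg

@[fun_prop]
theorem nat_div_fun {f g : α → ℕ} (hf : Computable f) (hg : Computable g) :
    Computable fun a => f a / g a := Primrec.nat_div.to_comp.comp hf hg

@[fun_prop]
theorem nat_mod_fun {f g : α → ℕ} (hf : Computable f) (hg : Computable g) :
    Computable fun a => f a % g a := Primrec.nat_mod.to_comp.comp hf hg

@[fun_prop]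
theorem nat_max_fun {f g : α → ℕ} (hf : Computable f) (hg : Computable g) :
    Computable fun a => max (f a) (g a) := Primrec.nat_max.to_comp.comp hf hg

@[fun_prop]
theorem nat_min_fun {f g : α → ℕ} (hf : Computable f) (hg : Computable g) :
    Computable fun a => min (f a) (g a) := Primrec.nat_min.to_comp.comp hf hg

@[fun_prop]
theorem nat_sqrt_fun {f : α → ℕ} (hf : Computable f) : Computable fun a => Nat.sqrt (f a) :=
  Primrec.nat_sqrt.to_comp.comp hf

@[fun_prop]
theorem nat_pair_fun {f g : α → ℕ} (hf : Computable f) (hg : Computable g) :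
    Computable fun a => Nat.pair (f a) (g a) := Primrec₂.natPair.to_comp.comp hf hg

@[fun_prop]
theorem nat_unpair_fun {f : α → ℕ} (hf : Computable f) : Computable fun a => Nat.unpair (f a) :=
  Primrec.unpair.to_comp.comp hf

@[fun_prop]
theorem nat_ble_fun {f g : α → ℕ} (hf : Computable f) (hg : Computable g) :
    Computable fun a => Nat.ble (f a) (g a) := by
  refine ((Primrec.nat_le.decide.to_comp).comp hf hg).of_eq fun a => ?_
  rw [Bool.eq_iff_iff]
  simp

@[fun_prop]
theorem nat_beq_fun {f g : α → ℕ} (hf : Computable f) (hg : Computable g) :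
    Computable fun a => Nat.beq (f a) (g a) := by
  refine ((Primrec.eq (α := ℕ)).decide.to_comp.comp hf hg).of_eq fun a => ?_
  rw [Bool.eq_iff_iff]
  simp

@[fun_prop]
theorem and_fun {f g : α → Bool} (hf : Computable f) (hg : Computable g) :
    Computable fun a => (f a && g a) := Primrec.and.to_comp.comp hf hg

@[fun_prop]
theorem cond_fun {c : α → Bool} {f g : α → σ} (hc : Computable c) (hf : Computable f)
    (hg : Computable g) : Computable fun a => bif c a then f a else g a := Computable.cond hc hf hg

@[fun_prop]
theorem encode_fun {f : α → β} (hf : Computable f) : Computable fun a => Encodable.encode (f a) :=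
  Computable.encode.comp hf

@[fun_prop]
theorem decode_getD_fun {f : α → ℕ} {g : α → β} (hf : Computable f) (hg : Computable g) :
    Computable fun a => (Encodable.decode (α := β) (f a)).getD (g a) :=
  (Computable.decode.comp hf).option_getD hg

@[fun_prop]
theorem nat_rec_fun {f : α → ℕ} {g : α → σ} {h : α → ℕ → σ → σ} (hf : Computable f)
    (hg : Computable g) (hh : Computable fun p : α × ℕ × σ => h p.1 p.2.1 p.2.2) :
    Computable fun a => Nat.rec (motive := fun _ => σ) (g a) (h a) (f a) :=
  Computable.nat_rec (h := fun a p => h a p.1 p.2) hf hg hh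

@[fun_prop]
theorem list_cons_fun {f : α → β} {g : α → List β} (hf : Computable f) (hg : Computable g) :
    Computable fun a => f a :: g a := Computable.list_cons.comp hf hg

@[fun_prop]
theorem list_append_fun {f g : α → List β} (hf : Computable f) (hg : Computable g) :
    Computable fun a => f a ++ g a := Computable.list_append.comp hf hg

@[fun_prop]
theorem list_length_fun {f : α → List β} (hf : Computable f) : Computable fun a => (f a).length :=
  Computable.list_length.comp hf

@[fun_prop]
theorem list_range_fun {f : α → ℕ} (hf : Computable f) : Computable fun a => List.range (f a) :=
  Primrec.list_range.to_comp.comp hf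

@[fun_prop]
theorem list_reverse_fun {f : α → List β} (hf : Computable f) :
    Computable fun a => (f a).reverse := Computable.list_reverse.comp hf

@[fun_prop]
theorem list_getD_fun {f : α → List β} {g : α → ℕ} {h : α → β} (hf : Computable f)
    (hg : Computable g) (hh : Computable h) : Computable fun a => (f a).getD (g a) (h a) := by
  refine ((list_getElem?.comp hf hg).option_getD hh).of_eq fun a => ?_
  simp

/-- A right fold is a recursion on the length of the list, along its reversal. -/
@[fun_prop]
theorem list_foldr_fun {f : α → List β} {g : α → σ} {h : α → β → σ → σ} (hf : Computable f)
    (hg : Computable g) (hh : Computable fun p : α × β × σ => h p.1 p.2.1 p.2.2) :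
    Computable fun a => (f a).foldr (h a) (g a) := by
  have hstep : Computable₂ fun (a : α) (p : ℕ × σ) =>
      Option.casesOn (motive := fun _ => σ) ((f a).reverse[p.1]?) p.2 (fun b => h a b p.2) := by
    refine Computable.option_casesOn (o := fun q : α × ℕ × σ => (f q.1).reverse[q.2.1]?)
      (f := fun q => q.2.2) (g := fun q b => h q.1 b q.2.2) ?_ (by fun_prop) ?_
    · exact list_getElem?.comp (f := fun l n => l[n]?) (by fun_prop) (by fun_prop)
    · exact hh.comp (g := fun q : (α × ℕ × σ) × β => (q.1.1, q.2, q.1.2.2)) (by fun_prop)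
  refine (Computable.nat_rec (list_length_fun hf) hg hstep).of_eq fun a => ?_
  have key : ∀ (l : List β) (k : ℕ), k ≤ l.length →
      Nat.rec (motive := fun _ => σ) (g a) (fun n s =>
        Option.casesOn (motive := fun _ => σ) (l[n]?) s (fun b => h a b s)) k
      = (l.take k).foldl (fun s b => h a b s) (g a) := by
    intro l k hk
    induction k with
    | zero => simp
    | succ k ih =>
      have hk' : k < l.length := hk
      simp only [ih hk'.le]
      rw [List.take_succ_eq_append_getElem hk', List.foldl_append]
      simp [hk']
  have := key (f a).reverse (f a).length (by simp)
  simp only at this ⊢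
  rw [this, ← List.length_reverse, List.take_length, List.foldl_reverse]

@[fun_prop]
theorem list_map_fun {f : α → List β} {g : α → β → γ} (hf : Computable f)
    (hg : Computable fun p : α × β => g p.1 p.2) : Computable fun a => (f a).map (g a) := by
  have h : Computable fun a => (f a).foldr (fun b l => g a b :: l) [] := by
    refine list_foldr_fun hf (by fun_prop) (list_cons_fun ?_ (by fun_prop))
    exact hg.comp (g := fun p : α × β × List γ => (p.1, p.2.1)) (by fun_prop)
  refine h.of_eq fun a => ?_
  induction f a <;> simp_all

@[fun_prop]
theorem list_flatMap_fun {f : α → List β} {g : α → β → List γ} (hf : Computable f)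
    (hg : Computable fun p : α × β => g p.1 p.2) : Computable fun a => (f a).flatMap (g a) := by
  have h : Computable fun a => (f a).foldr (fun b l => g a b ++ l) [] := by
    refine list_foldr_fun hf (by fun_prop) (list_append_fun ?_ (by fun_prop))
    exact hg.comp (g := fun p : α × β × List γ => (p.1, p.2.1)) (by fun_prop)
  refine h.of_eq fun a => ?_
  induction f a <;> simp_all

@[fun_prop]
theorem list_filter_fun {f : α → List β} {g : α → β → Bool} (hf : Computable f)
    (hg : Computable fun p : α × β => g p.1 p.2) : Computable fun a => (f a).filter (g a) := by
  have h : Computable fun a =>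
      (f a).foldr (fun b l => bif g a b then b :: l else l) [] := by
    refine list_foldr_fun hf (by fun_prop) (cond_fun ?_ (by fun_prop) (by fun_prop))
    exact hg.comp (g := fun p : α × β × List β => (p.1, p.2.1)) (by fun_prop)
  refine h.of_eq fun a => ?_
  induction f a with
  | nil => rfl
  | cons b l ih => cases hb : g a b <;> simp [ih, hb]

@[fun_prop]
theorem list_all_fun {f : α → List β} {g : α → β → Bool} (hf : Computable f)
    (hg : Computable fun p : α × β => g p.1 p.2) : Computable fun a => (f a).all (g a) := by
  have h : Computable fun a => (f a).foldr (fun b l => g a b && l) true := by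
    refine list_foldr_fun hf (by fun_prop) (and_fun ?_ (by fun_prop))
    exact hg.comp (g := fun p : α × β × Bool => (p.1, p.2.1)) (by fun_prop)
  refine h.of_eq fun a => ?_
  induction f a <;> simp_all

end Computable

/-! ### Recursion on Gödel numbers -/

/-- The list of the first `n` values of the function on `ℕ` that `step` defines by
course-of-values recursion. -/
def courseOfValues {σ : Type*} (step : List σ → σ) (n : ℕ) : List σ :=
  Nat.rec [] (fun _ l => l ++ [step l]) n

/-- The function on `ℕ` whose value at `n` is `step` of the list of its values below `n`.  The
number `n` is not passed separately: it is the length of the list. -/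
def strongRec {σ : Type*} (step : List σ → σ) (n : ℕ) : σ := step (courseOfValues step n)

theorem courseOfValues_eq {σ : Type*} (step : List σ → σ) (n : ℕ) :
    courseOfValues step n = (List.range n).map (strongRec step) := by
  induction n with
  | zero => rfl
  | succ n ih =>
    rw [List.range_succ, List.map_append, ← ih]
    rfl

@[simp]
theorem length_courseOfValues {σ : Type*} (step : List σ → σ) (n : ℕ) :
    (courseOfValues step n).length = n := by simp [courseOfValues_eq]

theorem getD_courseOfValues {σ : Type*} (step : List σ → σ) {m n : ℕ} (h : m < n) (d : σ) :
    (courseOfValues step n).getD m d = strongRec step m := by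
  simp [courseOfValues_eq, h]

@[fun_prop]
theorem computable_strongRec {α σ : Type*} [Primcodable α] [Primcodable σ]
    {step : α → List σ → σ} (h : Computable fun p : α × List σ => step p.1 p.2) {f : α → ℕ}
    (hf : Computable f) : Computable fun a => strongRec (step a) (f a) := by
  unfold strongRec courseOfValues
  refine h.comp (g := fun a => (a, _)) (Computable.prodMk_fun Computable.id ?_)
  refine Computable.nat_rec_fun hf (by fun_prop) ?_
  refine Computable.list_append_fun (by fun_prop) (Computable.list_cons_fun ?_ (by fun_prop))
  exact h.comp (g := fun p : α × ℕ × List σ => (p.1, p.2.2)) (by fun_prop)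

/-! ### Arithmetic of coded rational and Gaussian rational numbers -/

/-- The sum of two coded rationals. -/
def RatCode.add (q r : RatCode) : RatCode :=
  (q.1 * (r.2.2 + 1) + r.1 * (q.2.2 + 1), q.2.1 * (r.2.2 + 1) + r.2.1 * (q.2.2 + 1),
    q.2.2 * r.2.2 + q.2.2 + r.2.2)

/-- The product of two coded rationals. -/
def RatCode.mul (q r : RatCode) : RatCode :=
  (q.1 * r.1 + q.2.1 * r.2.1, q.1 * r.2.1 + q.2.1 * r.1, q.2.2 * r.2.2 + q.2.2 + r.2.2)

/-- The negative of a coded rational. -/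
def RatCode.neg (q : RatCode) : RatCode := (q.2.1, q.1, q.2.2)

/-- The code of a natural number as a rational. -/
def RatCode.ofNat (n : ℕ) : RatCode := (n, 0, 0)

theorem RatCode.val_add (q r : RatCode) : (q.add r).val = q.val + r.val := by
  simp only [RatCode.add, RatCode.val]
  push_cast
  have h₁ : (q.2.2 : ℚ) + 1 ≠ 0 := by positivity
  have h₂ : (r.2.2 : ℚ) + 1 ≠ 0 := by positivity
  rw [show (q.2.2 : ℚ) * r.2.2 + q.2.2 + r.2.2 + 1 = (q.2.2 + 1) * (r.2.2 + 1) by ring]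
  field_simp
  ring

theorem RatCode.val_mul (q r : RatCode) : (q.mul r).val = q.val * r.val := by
  simp only [RatCode.mul, RatCode.val]
  push_cast
  have h₁ : (q.2.2 : ℚ) + 1 ≠ 0 := by positivity
  have h₂ : (r.2.2 : ℚ) + 1 ≠ 0 := by positivity
  rw [show (q.2.2 : ℚ) * r.2.2 + q.2.2 + r.2.2 + 1 = (q.2.2 + 1) * (r.2.2 + 1) by ring]
  field_simp
  ring

theorem RatCode.val_neg (q : RatCode) : q.neg.val = -q.val := by
  simp only [RatCode.neg, RatCode.val]
  ring

theorem RatCode.val_ofNat (n : ℕ) : (RatCode.ofNat n).val = n := by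
  simp [RatCode.ofNat, RatCode.val]

/-- A coded rational is bounded by the sum of the two natural numbers in its numerator. -/
theorem RatCode.abs_val_le (q : RatCode) : |(q.val : ℝ)| ≤ ((q.1 + q.2.1 : ℕ) : ℝ) := by
  have h : (1 : ℝ) ≤ (q.2.2 : ℝ) + 1 := by simp
  simp only [RatCode.val]
  push_cast
  rw [abs_div, abs_of_pos (by linarith : (0 : ℝ) < (q.2.2 : ℝ) + 1), div_le_iff₀ (by linarith)]
  have h0 : (0 : ℝ) ≤ q.1 := by positivity
  have h1 : (0 : ℝ) ≤ q.2.1 := by positivity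
  have h2 : |(q.1 : ℝ) - q.2.1| ≤ q.1 + q.2.1 := abs_le.2 ⟨by linarith, by linarith⟩
  nlinarith

/-- Codes of Gaussian rationals: real and imaginary parts. -/
abbrev GaussCode : Type := RatCode × RatCode

/-- The Gaussian rational with a given code. -/
def GaussCode.val (z : GaussCode) : ℂ := (z.1.val : ℂ) + (z.2.val : ℂ) * Complex.I

/-- The code of a natural number as a Gaussian rational. -/
def GaussCode.ofNat (n : ℕ) : GaussCode := (RatCode.ofNat n, RatCode.ofNat 0)

/-- The sum of two coded Gaussian rationals. -/
def GaussCode.add (z w : GaussCode) : GaussCode := (RatCode.add z.1 w.1, RatCode.add z.2 w.2)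

/-- The product of two coded Gaussian rationals. -/
def GaussCode.mul (z w : GaussCode) : GaussCode :=
  (RatCode.add (RatCode.mul z.1 w.1) (RatCode.neg (RatCode.mul z.2 w.2)),
    RatCode.add (RatCode.mul z.1 w.2) (RatCode.mul z.2 w.1))

/-- The complex conjugate of a coded Gaussian rational. -/
def GaussCode.conj (z : GaussCode) : GaussCode := (z.1, RatCode.neg z.2)

/-- The sum of a list of coded Gaussian rationals. -/
def GaussCode.sum (l : List GaussCode) : GaussCode := l.foldr GaussCode.add (GaussCode.ofNat 0)

theorem GaussCode.val_ofNat (n : ℕ) : (GaussCode.ofNat n).val = n := by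
  simp [GaussCode.ofNat, GaussCode.val, RatCode.val_ofNat]

theorem GaussCode.val_add (z w : GaussCode) : (z.add w).val = z.val + w.val := by
  simp only [GaussCode.add, GaussCode.val, RatCode.val_add]
  push_cast
  ring

theorem GaussCode.val_mul (z w : GaussCode) : (z.mul w).val = z.val * w.val := by
  simp only [GaussCode.mul, GaussCode.val, RatCode.val_add, RatCode.val_mul, RatCode.val_neg]
  push_cast
  linear_combination (-(z.2.val : ℂ) * w.2.val) * Complex.I_mul_I

theorem GaussCode.val_conj (z : GaussCode) : z.conj.val = star z.val := by
  simp [GaussCode.conj, GaussCode.val, RatCode.val_neg]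

theorem GaussCode.val_sum (l : List GaussCode) :
    (GaussCode.sum l).val = (l.map GaussCode.val).sum := by
  induction l with
  | nil => simp [GaussCode.sum, GaussCode.val_ofNat]
  | cons z l ih =>
    have : GaussCode.sum (z :: l) = GaussCode.add z (GaussCode.sum l) := rfl
    rw [this, GaussCode.val_add, ih]
    simp

theorem GaussCode.re_val (z : GaussCode) : z.val.re = (z.1.val : ℝ) := by
  simp only [GaussCode.val, Complex.add_re, Complex.mul_re, Complex.I_re, Complex.I_im,
    Complex.ratCast_re, Complex.ratCast_im]
  simp

theorem GaussCode.im_val (z : GaussCode) : z.val.im = (z.2.val : ℝ) := by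
  simp only [GaussCode.val, Complex.add_im, Complex.mul_im, Complex.I_re, Complex.I_im,
    Complex.ratCast_re, Complex.ratCast_im]
  simp

section Computable

variable {α : Type*} [Primcodable α]

@[fun_prop]
theorem computable_ratAdd {f g : α → RatCode} (hf : Computable f) (hg : Computable g) :
    Computable fun a => RatCode.add (f a) (g a) := by unfold RatCode.add; fun_prop

@[fun_prop]
theorem computable_ratMul {f g : α → RatCode} (hf : Computable f) (hg : Computable g) :
    Computable fun a => RatCode.mul (f a) (g a) := by unfold RatCode.mul; fun_prop

@[fun_prop]
theorem computable_ratNeg {f : α → RatCode} (hf : Computable f) :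
    Computable fun a => RatCode.neg (f a) := by unfold RatCode.neg; fun_prop

@[fun_prop]
theorem computable_ratOfNat {f : α → ℕ} (hf : Computable f) :
    Computable fun a => RatCode.ofNat (f a) := by unfold RatCode.ofNat; fun_prop

@[fun_prop]
theorem computable_gaussOfNat {f : α → ℕ} (hf : Computable f) :
    Computable fun a => GaussCode.ofNat (f a) := by unfold GaussCode.ofNat; fun_prop

@[fun_prop]
theorem computable_gaussAdd {f g : α → GaussCode} (hf : Computable f) (hg : Computable g) :
    Computable fun a => GaussCode.add (f a) (g a) := by unfold GaussCode.add; fun_prop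

@[fun_prop]
theorem computable_gaussMul {f g : α → GaussCode} (hf : Computable f) (hg : Computable g) :
    Computable fun a => GaussCode.mul (f a) (g a) := by unfold GaussCode.mul; fun_prop

@[fun_prop]
theorem computable_gaussConj {f : α → GaussCode} (hf : Computable f) :
    Computable fun a => GaussCode.conj (f a) := by unfold GaussCode.conj; fun_prop

@[fun_prop]
theorem computable_gaussSum {f : α → List GaussCode} (hf : Computable f) :
    Computable fun a => GaussCode.sum (f a) := by unfold GaussCode.sum; fun_prop

end Computable

/-! ### Coded matrices -/

/-- The list of the values `f i j`, for `i, j < p`, in row-major order. -/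
def tabulate {σ : Type*} (p : ℕ) (f : ℕ → ℕ → σ) : List σ :=
  (List.range (p * p)).map fun t => f (t / p) (t % p)

/-- The entry at `(i, j)` of the coded `p × p` matrix that starts at position `s` of the
list `l`. -/
def codedEntry (l : List GaussCode) (s p i j : ℕ) : GaussCode :=
  l.getD (s + (i * p + j)) (GaussCode.ofNat 0)

/-- The `p × p` matrix that starts at position `s` of the list `l`. -/
def codedMatrix (l : List GaussCode) (s p : ℕ) : Matrix (Fin p) (Fin p) ℂ :=
  Matrix.of fun i j => (codedEntry l s p i j).val

theorem codedEntry_tabulate {p : ℕ} (f : ℕ → ℕ → GaussCode) {i j : ℕ} (hi : i < p) (hj : j < p) :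
    codedEntry (tabulate p f) 0 p i j = f i j := by
  have h : i * p + j < p * p := by nlinarith
  have hp : 0 < p := by omega
  simp only [codedEntry, tabulate, zero_add]
  rw [List.getD_eq_getElem _ _ (by simpa using h)]
  simp only [List.getElem_map, List.getElem_range]
  rw [Nat.mul_comm i p, Nat.mul_add_div hp, Nat.div_eq_of_lt hj, Nat.mul_add_mod,
    Nat.mod_eq_of_lt hj, Nat.add_zero]

theorem codedMatrix_tabulate (p : ℕ) (f : ℕ → ℕ → GaussCode) :
    codedMatrix (tabulate p f) 0 p = Matrix.of fun i j : Fin p => (f i j).val := by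
  ext i j
  simp [codedMatrix, codedEntry_tabulate f i.2 j.2]

/-- The product of two coded matrices. -/
def codedMul (p : ℕ) (A B : List GaussCode) : List GaussCode :=
  tabulate p fun i j => GaussCode.sum ((List.range p).map fun k =>
    GaussCode.mul (codedEntry A 0 p i k) (codedEntry B 0 p k j))

/-- The conjugate transpose of a coded matrix. -/
def codedStar (p : ℕ) (A : List GaussCode) : List GaussCode :=
  tabulate p fun i j => GaussCode.conj (codedEntry A 0 p j i)

theorem sum_map_range {M : Type*} [AddCommMonoid M] (n : ℕ) (f : ℕ → M) :
    ((List.range n).map f).sum = ∑ i : Fin n, f i := by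
  rw [← Finset.sum_range]
  rfl

theorem codedMatrix_mul (p : ℕ) (A B : List GaussCode) :
    codedMatrix (codedMul p A B) 0 p = codedMatrix A 0 p * codedMatrix B 0 p := by
  rw [codedMul, codedMatrix_tabulate]
  ext i j
  simp [GaussCode.val_sum, Matrix.mul_apply, codedMatrix, Function.comp_def, GaussCode.val_mul,
    sum_map_range]

theorem codedMatrix_star (p : ℕ) (A : List GaussCode) :
    codedMatrix (codedStar p A) 0 p = star (codedMatrix A 0 p) := by
  rw [codedStar, codedMatrix_tabulate]
  ext i j
  simp [codedMatrix, GaussCode.val_conj, Matrix.star_apply]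

/-- The normalized trace of a coded matrix. -/
def codedTrace (p : ℕ) (A : List GaussCode) : GaussCode :=
  GaussCode.mul ((1, 0, p - 1), RatCode.ofNat 0)
    (GaussCode.sum ((List.range p).map fun i => codedEntry A 0 p i i))

theorem val_codedTrace (p : ℕ) (A : List GaussCode) :
    (codedTrace p A).val = normalizedTrace (codedMatrix A 0 p) := by
  rcases Nat.eq_zero_or_pos p with rfl | hp
  · simp [codedTrace, normalizedTrace, GaussCode.val_mul, GaussCode.val_sum]
  · have h : (GaussCode.val ((1, 0, p - 1), RatCode.ofNat 0)) = (p : ℂ)⁻¹ := by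
      simp [GaussCode.val, RatCode.ofNat, RatCode.val, hp]
    rw [codedTrace, GaussCode.val_mul, h, normalizedTrace, GaussCode.val_sum, List.map_map,
      sum_map_range, div_eq_inv_mul]
    rfl

section Computable

variable {α : Type*} [Primcodable α]

@[fun_prop]
theorem computable_tabulate {σ : Type*} [Primcodable σ] {p : α → ℕ} {f : α → ℕ → ℕ → σ}
    (hp : Computable p) (hf : Computable fun q : α × ℕ × ℕ => f q.1 q.2.1 q.2.2) :
    Computable fun a => tabulate (p a) (f a) := by
  unfold tabulate
  refine Computable.list_map_fun (by fun_prop) ?_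
  exact hf.comp (g := fun q : α × ℕ => (q.1, q.2 / p q.1, q.2 % p q.1)) (by fun_prop)

@[fun_prop]
theorem computable_codedEntry {l : α → List GaussCode} {s p i j : α → ℕ} (hl : Computable l)
    (hs : Computable s) (hp : Computable p) (hi : Computable i) (hj : Computable j) :
    Computable fun a => codedEntry (l a) (s a) (p a) (i a) (j a) := by
  unfold codedEntry; fun_prop

@[fun_prop]
theorem computable_codedMul {p : α → ℕ} {A B : α → List GaussCode} (hp : Computable p)
    (hA : Computable A) (hB : Computable B) :
    Computable fun a => codedMul (p a) (A a) (B a) := by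
  unfold codedMul; fun_prop

@[fun_prop]
theorem computable_codedStar {p : α → ℕ} {A : α → List GaussCode} (hp : Computable p)
    (hA : Computable A) : Computable fun a => codedStar (p a) (A a) := by
  unfold codedStar; fun_prop

@[fun_prop]
theorem computable_codedTrace {p : α → ℕ} {A : α → List GaussCode} (hp : Computable p)
    (hA : Computable A) : Computable fun a => codedTrace (p a) (A a) := by
  unfold codedTrace; fun_prop

end Computable

/-! ### Evaluation of terms at coded matrices -/

/-- The value of a term at a tuple in an arbitrary *-algebra. -/
def VNTerm.evalIn {n : ℕ} {A : Type*} [Ring A] [StarRing A] [Algebra ℂ A] (x : Fin n → A) :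
    VNTerm n → A
  | var i => x i
  | zero => 0
  | one => 1
  | add s t => s.evalIn x + t.evalIn x
  | mul s t => s.evalIn x * t.evalIn x
  | star t => Star.star (t.evalIn x)
  | smul a b t => GaussCode.val (a, b) • t.evalIn x

theorem VNTerm.eval_eq_evalIn {n : ℕ} (x : Fin n → HyperfiniteR) (t : VNTerm n) :
    t.eval x = t.evalIn x := by
  induction t with
  | var i => rfl
  | zero => rfl
  | one => rfl
  | add s t hs ht => simp only [VNTerm.eval, VNTerm.evalIn, hs, ht]
  | mul s t hs ht => simp only [VNTerm.eval, VNTerm.evalIn, hs, ht]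
  | star t ht => simp only [VNTerm.eval, VNTerm.evalIn, ht]
  | smul a b t ht => simp only [VNTerm.eval, VNTerm.evalIn, ht, GaussCode.val]

/-- Gödel numbers of subterms and subformulas are smaller, because every compound expression has a
positive tag `a`. -/
theorem Nat.lt_pair_of_pos {a b c : ℕ} (ha : 0 < a) (hc : c ≤ b) : c < Nat.pair a b := by
  have := Nat.add_le_pair a b
  omega

/-- The recursion step of `termMatrix`: the value at `l.length`, where `l` lists the values at
smaller numbers. -/
def termMatrixStep (rad : List ℕ) (p : ℕ) (pt : List GaussCode) (l : List (List GaussCode)) :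
    List GaussCode :=
  bif Nat.beq l.length.unpair.1 0 then
    tabulate p fun i j => GaussCode.mul (GaussCode.ofNat (rad.getD l.length.unpair.2 0))
      (codedEntry pt (l.length.unpair.2 * (p * p)) p i j)
  else bif Nat.beq l.length.unpair.1 1 then
    tabulate p fun _ _ => GaussCode.ofNat 0
  else bif Nat.beq l.length.unpair.1 2 then
    tabulate p fun i j => bif Nat.beq i j then GaussCode.ofNat 1 else GaussCode.ofNat 0
  else bif Nat.beq l.length.unpair.1 3 then
    tabulate p fun i j =>
      GaussCode.add (codedEntry (l.getD l.length.unpair.2.unpair.1 []) 0 p i j)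
        (codedEntry (l.getD l.length.unpair.2.unpair.2 []) 0 p i j)
  else bif Nat.beq l.length.unpair.1 4 then
    codedMul p (l.getD l.length.unpair.2.unpair.1 []) (l.getD l.length.unpair.2.unpair.2 [])
  else bif Nat.beq l.length.unpair.1 5 then
    codedStar p (l.getD l.length.unpair.2 [])
  else
    tabulate p fun i j =>
      GaussCode.mul ((Encodable.decode l.length.unpair.2.unpair.1).getD (GaussCode.ofNat 0))
        (codedEntry (l.getD l.length.unpair.2.unpair.2 []) 0 p i j)

/-- The value of the term with a given Gödel number at the tuple of coded `p × p` matrices that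
are listed one after the other in `pt`, the `i`-th of them multiplied by the `i`-th entry of
`rad`. -/
def termMatrix (rad : List ℕ) (p : ℕ) (pt : List GaussCode) : ℕ → List GaussCode :=
  strongRec (termMatrixStep rad p pt)

@[fun_prop]
theorem computable_termMatrix {α : Type*} [Primcodable α] {rad : α → List ℕ} {p c : α → ℕ}
    {pt : α → List GaussCode} (hr : Computable rad) (hp : Computable p) (hpt : Computable pt)
    (hc : Computable c) : Computable fun a => termMatrix (rad a) (p a) (pt a) (c a) := by
  unfold termMatrix
  refine computable_strongRec (step := fun a => termMatrixStep (rad a) (p a) (pt a)) ?_ hc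
  unfold termMatrixStep
  fun_prop

/-- The tuple of `p × p` matrices listed one after the other in `pt`. -/
def codedTuple (n p : ℕ) (pt : List GaussCode) : Fin n → Matrix (Fin p) (Fin p) ℂ :=
  fun i => codedMatrix pt (i * (p * p)) p

theorem codedMatrix_termMatrix {n : ℕ} (rad : List ℕ) (p : ℕ) (pt : List GaussCode)
    (t : VNTerm n) :
    codedMatrix (termMatrix rad p pt t.code) 0 p =
      t.evalIn fun i => (rad.getD i 0 : ℂ) • codedTuple n p pt i := by
  induction t with
  | var i =>
    rw [termMatrix, strongRec, termMatrixStep]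
    simp only [length_courseOfValues, VNTerm.code, Nat.unpair_pair]
    simp only [Nat.beq, cond_true, codedMatrix_tabulate]
    ext a b
    simp [VNTerm.evalIn, codedTuple, codedMatrix, GaussCode.val_mul, GaussCode.val_ofNat]
  | zero =>
    rw [termMatrix, strongRec, termMatrixStep]
    simp only [length_courseOfValues, VNTerm.code, Nat.unpair_pair]
    simp only [Nat.beq, cond_true, cond_false, codedMatrix_tabulate]
    ext a b
    simp [VNTerm.evalIn, GaussCode.val_ofNat]
  | one =>
    rw [termMatrix, strongRec, termMatrixStep]
    simp only [length_courseOfValues, VNTerm.code, Nat.unpair_pair]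
    simp only [Nat.beq, cond_true, cond_false, codedMatrix_tabulate]
    ext a b
    by_cases hab : a = b
    · subst hab
      simp [VNTerm.evalIn, GaussCode.val_ofNat]
    · have : Nat.beq (a : ℕ) b = false :=
        Bool.eq_false_iff.2 fun h => hab (Fin.ext (Nat.eq_of_beq_eq_true h))
      simp [VNTerm.evalIn, GaussCode.val_ofNat, this, Matrix.one_apply_ne hab]
  | add s t hs ht =>
    rw [termMatrix] at hs ht ⊢
    rw [strongRec, termMatrixStep]
    simp only [length_courseOfValues, VNTerm.code, Nat.unpair_pair]
    simp only [Nat.beq, cond_true, cond_false, codedMatrix_tabulate]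
    rw [getD_courseOfValues _ (Nat.lt_pair_of_pos (by norm_num) (Nat.left_le_pair _ _)),
      getD_courseOfValues _ (Nat.lt_pair_of_pos (by norm_num) (Nat.right_le_pair _ _)),
      VNTerm.evalIn, ← hs, ← ht]
    ext a b
    simp [codedMatrix, GaussCode.val_add]
  | mul s t hs ht =>
    rw [termMatrix] at hs ht ⊢
    rw [strongRec, termMatrixStep]
    simp only [length_courseOfValues, VNTerm.code, Nat.unpair_pair]
    simp only [Nat.beq, cond_true, cond_false, codedMatrix_mul]
    rw [getD_courseOfValues _ (Nat.lt_pair_of_pos (by norm_num) (Nat.left_le_pair _ _)),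
      getD_courseOfValues _ (Nat.lt_pair_of_pos (by norm_num) (Nat.right_le_pair _ _)),
      VNTerm.evalIn, ← hs, ← ht]
  | star t ht =>
    rw [termMatrix] at ht ⊢
    rw [strongRec, termMatrixStep]
    simp only [length_courseOfValues, VNTerm.code, Nat.unpair_pair]
    simp only [Nat.beq, cond_true, cond_false, codedMatrix_star]
    rw [getD_courseOfValues _ (Nat.lt_pair_of_pos (by norm_num) le_rfl), VNTerm.evalIn, ← ht]
  | smul a b t ht =>
    rw [termMatrix] at ht ⊢
    rw [strongRec, termMatrixStep]
    simp only [length_courseOfValues, VNTerm.code, Nat.unpair_pair]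
    simp only [Nat.beq, cond_false, codedMatrix_tabulate]
    rw [getD_courseOfValues _ (Nat.lt_pair_of_pos (by norm_num) (Nat.right_le_pair _ _)),
      VNTerm.evalIn, ← ht, Encodable.encodek]
    ext i j
    simp [codedMatrix, GaussCode.val_mul]

/-! ### Words and the expansion of terms -/

/-- The value of a word at a tuple; the letter `(i, true)` stands for `star (x i)`. -/
def wordEval {n : ℕ} {A : Type*} [Monoid A] [Star A] (x : Fin n → A)
    (w : List (Fin n × Bool)) : A :=
  (w.map fun a => if a.2 then star (x a.1) else x a.1).prod

theorem StarMonomial.eval_eq_wordEval {n d : ℕ} {A : Type*} [Monoid A] [Star A]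
    (m : StarMonomial n d) (x : Fin n → A) : m.eval x = wordEval x (List.ofFn m.2) := by
  rw [StarMonomial.eval, wordEval, List.map_ofFn]
  rfl

@[simp]
theorem wordEval_nil {n : ℕ} {A : Type*} [Monoid A] [Star A] (x : Fin n → A) :
    wordEval x [] = 1 := by simp [wordEval]

theorem wordEval_cons {n : ℕ} {A : Type*} [Monoid A] [Star A] (x : Fin n → A) (a : Fin n × Bool)
    (w : List (Fin n × Bool)) :
    wordEval x (a :: w) = (if a.2 then star (x a.1) else x a.1) * wordEval x w := by
  simp [wordEval]

theorem wordEval_append {n : ℕ} {A : Type*} [Monoid A] [Star A] (x : Fin n → A)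
    (v w : List (Fin n × Bool)) : wordEval x (v ++ w) = wordEval x v * wordEval x w := by
  simp [wordEval]

/-- The word of adjoint letters in reverse order. -/
def wordStar {n : ℕ} (w : List (Fin n × Bool)) : List (Fin n × Bool) :=
  (w.map fun a => (a.1, !a.2)).reverse

theorem wordEval_wordStar {n : ℕ} {A : Type*} [Monoid A] [StarMul A] (x : Fin n → A)
    (w : List (Fin n × Bool)) : wordEval x (wordStar w) = star (wordEval x w) := by
  induction w with
  | nil => simp [wordStar]
  | cons a w ih =>
    have h : wordStar (a :: w) = wordStar w ++ [(a.1, !a.2)] := by simp [wordStar]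
    rw [h, wordEval_append, wordEval_cons, ih, wordEval_cons, star_mul]
    cases a.2 <;> simp

/-- The expansion of a term in the variables `rad i • x i` as a linear combination of words
in `x`. -/
def VNTerm.expand {n : ℕ} (rad : List ℕ) : VNTerm n → List (ℂ × List (Fin n × Bool))
  | var i => [((rad.getD i 0 : ℂ), [(i, false)])]
  | zero => []
  | one => [(1, [])]
  | add s t => s.expand rad ++ t.expand rad
  | mul s t => (s.expand rad).flatMap fun a => (t.expand rad).map fun b => (a.1 * b.1, a.2 ++ b.2)
  | star t => (t.expand rad).map fun a => (Star.star a.1, wordStar a.2)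
  | smul a b t => (t.expand rad).map fun c => (GaussCode.val (a, b) * c.1, c.2)

/-- The value of a linear combination of words at a tuple. -/
def expandEval {n : ℕ} {A : Type*} [Monoid A] [Star A] [AddCommMonoid A] [SMul ℂ A]
    (x : Fin n → A) (l : List (ℂ × List (Fin n × Bool))) : A :=
  (l.map fun a => a.1 • wordEval x a.2).sum

theorem VNTerm.evalIn_eq_expandEval {n : ℕ} {A : Type*} [Ring A] [StarRing A] [Algebra ℂ A]
    [StarModule ℂ A] (rad : List ℕ) (x : Fin n → A) (t : VNTerm n) :
    t.evalIn (fun i => (rad.getD i 0 : ℂ) • x i) = expandEval x (t.expand rad) := by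
  induction t with
  | var i => simp [VNTerm.evalIn, VNTerm.expand, expandEval, wordEval]
  | zero => simp [VNTerm.evalIn, VNTerm.expand, expandEval]
  | one => simp [VNTerm.evalIn, VNTerm.expand, expandEval]
  | add s t hs ht =>
    rw [VNTerm.evalIn, VNTerm.expand, hs, ht]
    simp [expandEval]
  | mul s t hs ht =>
    rw [VNTerm.evalIn, VNTerm.expand, hs, ht]
    induction s.expand rad with
    | nil => simp [expandEval]
    | cons a l ih =>
      have h₁ : expandEval x (a :: l) = a.1 • wordEval x a.2 + expandEval x l := by
        simp [expandEval]
      have h₂ : ∀ l₁ l₂, expandEval x (l₁ ++ l₂) = expandEval x l₁ + expandEval x l₂ := by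
        simp [expandEval]
      rw [h₁, List.flatMap_cons, h₂, add_mul, ih]
      congr 1
      simp only [expandEval, List.map_map]
      rw [← List.sum_map_mul_left]
      congr 1
      refine List.map_congr_left fun b _ => ?_
      simp [wordEval_append, mul_smul]
      rw [smul_comm]
  | star t ht =>
    rw [VNTerm.evalIn, VNTerm.expand, ht]
    induction t.expand rad with
    | nil => simp [expandEval]
    | cons a l ih =>
      simp only [expandEval, List.map_cons, List.sum_cons, star_add, star_smul] at ih ⊢
      rw [ih, wordEval_wordStar]
  | smul a b t ht =>
    rw [VNTerm.evalIn, VNTerm.expand, ht]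
    simp [expandEval, List.smul_sum, Function.comp_def, mul_smul]

/-- A bound for the absolute value of the Gaussian rational with a given Gödel number. -/
def gaussSize (c : ℕ) : ℕ :=
  let z : GaussCode := (Encodable.decode c).getD (GaussCode.ofNat 0)
  z.1.1 + z.1.2.1 + (z.2.1 + z.2.2.1)

@[fun_prop]
theorem computable_gaussSize {α : Type*} [Primcodable α] {c : α → ℕ} (hc : Computable c) :
    Computable fun a => gaussSize (c a) := by
  unfold gaussSize
  fun_prop

theorem norm_val_le_gaussSize (z : GaussCode) : ‖z.val‖ ≤ gaussSize (Encodable.encode z) := by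
  refine (Complex.norm_le_abs_re_add_abs_im _).trans ?_
  rw [GaussCode.re_val, GaussCode.im_val]
  have h₁ := z.1.abs_val_le
  have h₂ := z.2.abs_val_le
  rw [gaussSize, Encodable.encodek]
  simp only [Option.getD_some]
  push_cast at h₁ h₂ ⊢
  linarith

/-- The recursion step of `termBound`. -/
def termBoundStep (rad : List ℕ) (l : List (ℕ × ℕ)) : ℕ × ℕ :=
  bif Nat.beq l.length.unpair.1 0 then (rad.getD l.length.unpair.2 0, 1)
  else bif Nat.beq l.length.unpair.1 1 then (0, 0)
  else bif Nat.beq l.length.unpair.1 2 then (1, 0)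
  else bif Nat.beq l.length.unpair.1 3 then
    ((l.getD l.length.unpair.2.unpair.1 0).1 + (l.getD l.length.unpair.2.unpair.2 0).1,
      max (l.getD l.length.unpair.2.unpair.1 0).2 (l.getD l.length.unpair.2.unpair.2 0).2)
  else bif Nat.beq l.length.unpair.1 4 then
    ((l.getD l.length.unpair.2.unpair.1 0).1 * (l.getD l.length.unpair.2.unpair.2 0).1,
      (l.getD l.length.unpair.2.unpair.1 0).2 + (l.getD l.length.unpair.2.unpair.2 0).2)
  else bif Nat.beq l.length.unpair.1 5 then l.getD l.length.unpair.2 0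
  else
    (gaussSize l.length.unpair.2.unpair.1 * (l.getD l.length.unpair.2.unpair.2 0).1,
      (l.getD l.length.unpair.2.unpair.2 0).2)

/-- Bounds, computed from the Gödel number of a term, for the sum of the absolute values of the
coefficients in its expansion and for the lengths of the words in it. -/
def termBound (rad : List ℕ) : ℕ → ℕ × ℕ := strongRec (termBoundStep rad)

@[fun_prop]
theorem computable_termBound {α : Type*} [Primcodable α] {rad : α → List ℕ} {c : α → ℕ}
    (hr : Computable rad) (hc : Computable c) :
    Computable fun a => termBound (rad a) (c a) := by
  unfold termBound
  refine computable_strongRec (step := fun a => termBoundStep (rad a)) ?_ hc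
  unfold termBoundStep
  fun_prop

/-- The sum of the absolute values of the coefficients of a linear combination of words. -/
def coeffNorm {n : ℕ} (l : List (ℂ × List (Fin n × Bool))) : ℝ := (l.map fun a => ‖a.1‖).sum

theorem VNTerm.expand_bounds {n : ℕ} (rad : List ℕ) (t : VNTerm n) :
    coeffNorm (t.expand rad) ≤ (termBound rad t.code).1 ∧
      ∀ a ∈ t.expand rad, a.2.length ≤ (termBound rad t.code).2 := by
  induction t with
  | var i =>
    rw [termBound, strongRec, termBoundStep]
    simp only [length_courseOfValues, VNTerm.code, Nat.unpair_pair]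
    simp only [Nat.beq, cond_true, cond_false]
    simp [VNTerm.expand, coeffNorm]
  | zero =>
    simp [VNTerm.expand, coeffNorm]
  | one =>
    rw [termBound, strongRec, termBoundStep]
    simp only [length_courseOfValues, VNTerm.code, Nat.unpair_pair]
    simp only [Nat.beq, cond_true, cond_false]
    simp [VNTerm.expand, coeffNorm]
  | add s t hs ht =>
    rw [termBound] at hs ht ⊢
    rw [strongRec, termBoundStep]
    simp only [length_courseOfValues, VNTerm.code, Nat.unpair_pair]
    simp only [Nat.beq, cond_true, cond_false]
    rw [getD_courseOfValues _ (Nat.lt_pair_of_pos (by norm_num) (Nat.left_le_pair _ _)),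
      getD_courseOfValues _ (Nat.lt_pair_of_pos (by norm_num) (Nat.right_le_pair _ _))]
    constructor
    · have : coeffNorm ((s.add t).expand rad) =
          coeffNorm (s.expand rad) + coeffNorm (t.expand rad) := by
        simp [coeffNorm, VNTerm.expand]
      rw [this]
      push_cast
      exact add_le_add hs.1 ht.1
    · intro a ha
      rcases List.mem_append.1 ha with h | h
      · exact (hs.2 a h).trans (le_max_left _ _)
      · exact (ht.2 a h).trans (le_max_right _ _)
  | mul s t hs ht =>
    rw [termBound] at hs ht ⊢
    rw [strongRec, termBoundStep]
    simp only [length_courseOfValues, VNTerm.code, Nat.unpair_pair]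
    simp only [Nat.beq, cond_true, cond_false]
    rw [getD_courseOfValues _ (Nat.lt_pair_of_pos (by norm_num) (Nat.left_le_pair _ _)),
      getD_courseOfValues _ (Nat.lt_pair_of_pos (by norm_num) (Nat.right_le_pair _ _))]
    constructor
    · have : coeffNorm ((s.mul t).expand rad) =
          coeffNorm (s.expand rad) * coeffNorm (t.expand rad) := by
        rw [VNTerm.expand]
        induction s.expand rad with
        | nil => simp [coeffNorm]
        | cons a l ih =>
          simp only [coeffNorm, List.flatMap_cons, List.map_append, List.sum_append, List.map_cons,
            List.sum_cons, List.map_map] at ih ⊢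
          rw [ih, add_mul]
          simp only [Function.comp_def, norm_mul]
          rw [List.sum_map_mul_left]
      rw [this]
      push_cast
      refine mul_le_mul hs.1 ht.1 (List.sum_nonneg ?_) (Nat.cast_nonneg _)
      simp only [List.mem_map]
      rintro _ ⟨a, _, rfl⟩
      positivity
    · intro a ha
      simp only [VNTerm.expand, List.mem_flatMap, List.mem_map] at ha
      obtain ⟨b, hb, c, hc, rfl⟩ := ha
      rw [List.length_append]
      exact add_le_add (hs.2 b hb) (ht.2 c hc)
  | star t ht =>
    rw [termBound] at ht ⊢
    rw [strongRec, termBoundStep]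
    simp only [length_courseOfValues, VNTerm.code, Nat.unpair_pair]
    simp only [Nat.beq, cond_true, cond_false]
    rw [getD_courseOfValues _ (Nat.lt_pair_of_pos (by norm_num) le_rfl)]
    constructor
    · have : coeffNorm (t.star.expand rad) = coeffNorm (t.expand rad) := by
        simp [coeffNorm, VNTerm.expand, Function.comp_def]
      rw [this]
      exact ht.1
    · intro a ha
      simp only [VNTerm.expand, List.mem_map] at ha
      obtain ⟨b, hb, rfl⟩ := ha
      simpa [wordStar] using ht.2 b hb
  | smul a b t ht =>
    rw [termBound] at ht ⊢
    rw [strongRec, termBoundStep]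
    simp only [length_courseOfValues, VNTerm.code, Nat.unpair_pair]
    simp only [Nat.beq, cond_false]
    rw [getD_courseOfValues _ (Nat.lt_pair_of_pos (by norm_num) (Nat.right_le_pair _ _))]
    constructor
    · have : coeffNorm ((t.smul a b).expand rad) =
          ‖GaussCode.val (a, b)‖ * coeffNorm (t.expand rad) := by
        simp [coeffNorm, VNTerm.expand, Function.comp_def, List.sum_map_mul_left]
      rw [this, Nat.cast_mul]
      refine mul_le_mul ?_ ht.1 ?_ (Nat.cast_nonneg _)
      · exact norm_val_le_gaussSize (a, b)
      · refine List.sum_nonneg ?_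
        simp only [List.mem_map]
        rintro _ ⟨a, _, rfl⟩
        positivity
    · intro a ha
      simp only [VNTerm.expand, List.mem_map] at ha
      obtain ⟨b, hb, rfl⟩ := ha
      exact ht.2 b hb

theorem map_expandEval {n : ℕ} {A : Type*} [Ring A] [StarRing A] [Algebra ℂ A]
    (tr : A →ₗ[ℂ] ℂ) (x : Fin n → A) (l : List (ℂ × List (Fin n × Bool))) :
    tr (expandEval x l) = (l.map fun a => a.1 * tr (wordEval x a.2)).sum := by
  induction l with
  | nil => simp [expandEval]
  | cons a l ih =>
    simp only [expandEval, List.map_cons, List.sum_cons, map_add, map_smul, smul_eq_mul] at ih ⊢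
    rw [ih]

/-- Two tuples whose moments agree up to `Δ` give values of the trace of a linear combination of
words that agree up to `Δ` times the norm of the coefficients. -/
theorem norm_expandEval_sub_le {n d : ℕ} {A B : Type*} [Ring A] [StarRing A] [Algebra ℂ A]
    [Ring B] [StarRing B] [Algebra ℂ B] (trA : A →ₗ[ℂ] ℂ) (trB : B →ₗ[ℂ] ℂ) (x : Fin n → A)
    (y : Fin n → B) {Δ : ℝ}
    (h : ∀ w : List (Fin n × Bool), w.length ≤ d →
      ‖trA (wordEval x w) - trB (wordEval y w)‖ ≤ Δ) (l : List (ℂ × List (Fin n × Bool)))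
    (hl : ∀ a ∈ l, a.2.length ≤ d) :
    ‖trA (expandEval x l) - trB (expandEval y l)‖ ≤ coeffNorm l * Δ := by
  rw [map_expandEval, map_expandEval]
  induction l with
  | nil => simp [coeffNorm]
  | cons a l ih =>
    have ih' := ih fun b hb => hl b (List.mem_cons_of_mem _ hb)
    have ha := h a.2 (hl a List.mem_cons_self)
    simp only [coeffNorm, List.map_cons, List.sum_cons] at ih' ⊢
    rw [add_sub_add_comm, add_mul, ← mul_sub]
    refine (norm_add_le _ _).trans (add_le_add ?_ ih')
    rw [norm_mul]
    exact mul_le_mul_of_nonneg_left ha (norm_nonneg _)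

theorem norm_expandEval_le {n : ℕ} {A : Type*} [Ring A] [StarRing A] [Algebra ℂ A]
    (tr : A →ₗ[ℂ] ℂ) (x : Fin n → A)
    (h : ∀ w : List (Fin n × Bool), ‖tr (wordEval x w)‖ ≤ 1)
    (l : List (ℂ × List (Fin n × Bool))) : ‖tr (expandEval x l)‖ ≤ coeffNorm l := by
  rw [map_expandEval]
  refine (List.le_sum_of_subadditive norm norm_zero.le norm_add_le _).trans ?_
  rw [List.map_map, coeffNorm]
  refine List.sum_le_sum fun a _ => ?_
  simp only [Function.comp_apply, norm_mul]
  exact mul_le_of_le_one_right (norm_nonneg _) (h a.2)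

/-! ### Approximate evaluation of formulas -/

/-- A term whose trace is the square of the distance `‖s - t‖₂`. -/
def VNTerm.distSq {n : ℕ} (s t : VNTerm n) : VNTerm n :=
  mul (star (add s (smul (0, 1, 0) (0, 0, 0) t))) (add s (smul (0, 1, 0) (0, 0, 0) t))

/-- The Gödel number of `VNTerm.distSq`, in terms of the Gödel numbers of the two terms. -/
def distSqCode (c d : ℕ) : ℕ :=
  let e := Nat.pair 3 (Nat.pair c (Nat.pair 6
    (Nat.pair (Encodable.encode (((0, 1, 0), (0, 0, 0)) : GaussCode)) d)))
  Nat.pair 4 (Nat.pair (Nat.pair 5 e) e)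

theorem VNTerm.code_distSq {n : ℕ} (s t : VNTerm n) :
    (s.distSq t).code = distSqCode s.code t.code := rfl

/-- The value of a quantifier-free formula, in terms of the traces of terms. -/
def QFFormula.evalFun {u : ConnectiveSystem} {n : ℕ} (T : VNTerm n → ℂ) : QFFormula u n → ℝ
  | traceRe t => (T t).re
  | traceIm t => (T t).im
  | dist s t => Real.sqrt (T (s.distSq t)).re
  | conn m args => u.fn m fun i => (args i).evalFun T

theorem QFFormula.eval_eq_evalFun {u : ConnectiveSystem} {n : ℕ} (x : Fin n → HyperfiniteR)
    (φ : QFFormula u n) : φ.eval x = φ.evalFun fun t => traceR (t.eval x) := by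
  induction φ with
  | traceRe t => rfl
  | traceIm t => rfl
  | dist s t =>
    have h : (RatCode.val (0, 1, 0) : ℂ) + (RatCode.val (0, 0, 0) : ℂ) * Complex.I = -1 := by
      simp [RatCode.val]
    simp only [QFFormula.eval, QFFormula.evalFun, twoNorm, VNTerm.distSq, VNTerm.eval, h, neg_smul,
      one_smul, sub_eq_add_neg]
  | conn m args ih => simp only [QFFormula.eval, QFFormula.evalFun, ih]

/-- A rational approximation to the square root of a coded rational, with error less than
`1 / (2 (J + 1))`. -/
def sqrtCode (J : ℕ) (q : RatCode) : RatCode :=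
  (Nat.sqrt ((q.1 - q.2.1) * ((2 * (J + 1)) * (2 * (J + 1))) / (q.2.2 + 1)), 0, 2 * J + 1)

theorem abs_sqrt_sub_sqrtCode_lt (J : ℕ) (q : RatCode) :
    |Real.sqrt (q.val : ℝ) - ((sqrtCode J q).val : ℝ)| < 1 / (2 * ((J : ℝ) + 1)) := by
  set y := (q.1 - q.2.1) * ((2 * (J + 1)) * (2 * (J + 1))) with hy
  set k := Nat.sqrt (y / (q.2.2 + 1)) with hk
  set S : ℝ := 2 * ((J : ℝ) + 1) with hS
  have hS0 : 0 < S := by positivity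
  have hc : (0 : ℝ) < (q.2.2 : ℝ) + 1 := by positivity
  have h₁ : k * k * (q.2.2 + 1) ≤ y :=
    (Nat.le_div_iff_mul_le (Nat.succ_pos _)).1 (Nat.sqrt_le (y / (q.2.2 + 1)))
  have h₂ : y < (k + 1) * (k + 1) * (q.2.2 + 1) :=
    (Nat.div_lt_iff_lt_mul (Nat.succ_pos _)).1 (Nat.lt_succ_sqrt (y / (q.2.2 + 1)))
  -- negative rationals have square root `0` on both sides
  have hval : Real.sqrt (q.val : ℝ) * S = Real.sqrt ((y : ℝ) / ((q.2.2 : ℝ) + 1)) := by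
    have hq : Real.sqrt (q.val : ℝ) =
        Real.sqrt (((q.1 - q.2.1 : ℕ) : ℝ) / ((q.2.2 : ℝ) + 1)) := by
      rcases le_total q.2.1 q.1 with h | h
      · simp [RatCode.val, Nat.cast_sub h]
      · rw [Nat.sub_eq_zero_of_le h]
        have : (q.val : ℝ) ≤ 0 := by
          simp only [RatCode.val]
          push_cast
          refine div_nonpos_of_nonpos_of_nonneg ?_ hc.le
          have : (q.1 : ℝ) ≤ q.2.1 := by exact_mod_cast h
          linarith
        simp [Real.sqrt_eq_zero_of_nonpos this]
    rw [hq, ← Real.sqrt_sq hS0.le, ← Real.sqrt_mul (by positivity)]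
    congr 1
    rw [hy, hS]
    push_cast
    ring
  have h₃ : (k : ℝ) ≤ Real.sqrt (q.val : ℝ) * S := by
    rw [hval]
    refine Real.le_sqrt_of_sq_le ?_
    rw [le_div_iff₀ hc]
    have : ((k * k * (q.2.2 + 1) : ℕ) : ℝ) ≤ y := by exact_mod_cast h₁
    push_cast at this
    nlinarith
  have h₄ : Real.sqrt (q.val : ℝ) * S < (k : ℝ) + 1 := by
    rw [hval]
    rw [Real.sqrt_lt' (by positivity), div_lt_iff₀ hc]
    have : (y : ℝ) < (((k + 1) * (k + 1) * (q.2.2 + 1) : ℕ) : ℝ) := by exact_mod_cast h₂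
    push_cast at this
    nlinarith
  have h₅ : ((sqrtCode J q).val : ℝ) = k / S := by
    simp only [sqrtCode, RatCode.val, hS]
    push_cast
    rw [← hk]
    norm_num
    congr 1
    ring
  rw [h₅, abs_sub_lt_iff]
  constructor
  · rw [sub_lt_iff_lt_add, ← add_div, lt_div_iff₀ hS0]
    linarith
  · have : (k : ℝ) / S ≤ Real.sqrt q.val := by rwa [div_le_iff₀ hS0]
    have : 0 < 1 / S := by positivity
    linarith

theorem abs_sqrt_sub_sqrt_le (a b : ℝ) : |Real.sqrt a - Real.sqrt b| ≤ Real.sqrt |a - b| := by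
  have key : ∀ a b : ℝ, Real.sqrt a ≤ Real.sqrt b + Real.sqrt |a - b| := by
    intro a b
    refine Real.sqrt_le_iff.2 ⟨by positivity, ?_⟩
    have h₁ : b ≤ Real.sqrt b ^ 2 := by
      rcases le_total 0 b with h | h
      · rw [Real.sq_sqrt h]
      · exact h.trans (sq_nonneg _)
    have h₂ := Real.sq_sqrt (abs_nonneg (a - b))
    have h₃ := le_abs_self (a - b)
    have h₄ : 0 ≤ Real.sqrt b * Real.sqrt |a - b| := by positivity
    nlinarith
  have h₁ := key a b
  have h₂ := key b a
  rw [abs_sub_comm b a] at h₂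
  exact abs_sub_le_iff.2 ⟨by linarith, by linarith⟩

/-- The list of natural numbers with a given Gödel number. -/
def decodeList (c : ℕ) : List ℕ := (Encodable.decode c).getD []

/-- The maximum of a list. -/
def listMax (l : List ℕ) : ℕ := l.foldr max 0

/-- The minimum of a list and a number. -/
def listMin (a : ℕ) (l : List ℕ) : ℕ := l.foldr min a

theorem le_listMax {l : List ℕ} {a : ℕ} (h : a ∈ l) : a ≤ listMax l := by
  induction l with
  | nil => simp at h
  | cons b l ih =>
    rcases List.mem_cons.1 h with rfl | h
    · exact le_max_left _ _
    · exact (ih h).trans (le_max_right _ _)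

theorem listMin_le {l : List ℕ} {a b : ℕ} (h : b ∈ l) : listMin a l ≤ b := by
  induction l with
  | nil => simp at h
  | cons c l ih =>
    rcases List.mem_cons.1 h with rfl | h
    · exact min_le_left _ _
    · exact (min_le_right _ _).trans (ih h)

theorem listMin_le_left (a : ℕ) (l : List ℕ) : listMin a l ≤ a := by
  induction l with
  | nil => exact le_rfl
  | cons c l ih => exact (min_le_right _ _).trans ih

theorem le_listMin {l : List ℕ} {a c : ℕ} (ha : c ≤ a) (h : ∀ b ∈ l, c ≤ b) : c ≤ listMin a l := by
  induction l with
  | nil => exact ha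
  | cons d l ih =>
    exact le_min (h d List.mem_cons_self) (ih fun b hb => h b (List.mem_cons_of_mem _ hb))

theorem lt_encode_of_mem {l : List ℕ} {a : ℕ} (h : a ∈ l) : a < Encodable.encode l := by
  induction l with
  | nil => simp at h
  | cons b l ih =>
    rw [Encodable.encode_list_cons]
    rcases List.mem_cons.1 h with rfl | h
    · exact Nat.lt_succ_of_le (Nat.left_le_pair _ _)
    · exact (ih h).trans (Nat.lt_succ_of_le (Nat.right_le_pair _ _))

/-- In a recursion on Gödel numbers of formulas, the values at the arguments of a connective are
available. -/
theorem map_getD_courseOfValues {σ : Type*} (step : List σ → σ) (m : ℕ) (l : List ℕ) (d : σ) :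
    (l.map fun c => (courseOfValues step
      (Nat.pair 3 (Nat.pair m (Encodable.encode l)))).getD c d) = l.map (strongRec step) := by
  refine List.map_congr_left fun c hc => getD_courseOfValues step ?_ d
  exact Nat.lt_pair_of_pos (by norm_num)
    ((lt_encode_of_mem hc).le.trans (Nat.right_le_pair _ _))

section Functions

variable (approx : ℕ × List RatCode × ℕ → RatCode) (modulus : ℕ × ℕ × ℕ → ℕ)

/-- A bound for a connective on the box `[-N, N]^k`, where `l` has length `k`: its value at the
origin, plus the number of steps of the length prescribed by the modulus of continuity that lead
from there to any other point. -/
def connBound (m N : ℕ) (l : List ℕ) : ℕ :=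
  let q := approx (m, l.map fun _ => (0, 0, 0), 0)
  q.1 + q.2.1 + 1 + (N * (modulus (m, N, 0) + 1) + 1)

/-- The recursion step of `formulaNorm`. -/
def formulaNormStep (rad : List ℕ) (l : List ℕ) : ℕ :=
  bif Nat.beq l.length.unpair.1 0 then (termBound rad l.length.unpair.2).1
  else bif Nat.beq l.length.unpair.1 1 then (termBound rad l.length.unpair.2).1
  else bif Nat.beq l.length.unpair.1 2 then
    (termBound rad (distSqCode l.length.unpair.2.unpair.1 l.length.unpair.2.unpair.2)).1 + 1
  else connBound approx modulus l.length.unpair.2.unpair.1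
    (listMax ((decodeList l.length.unpair.2.unpair.2).map fun c => l.getD c 0) + 1)
    (decodeList l.length.unpair.2.unpair.2)

/-- A bound for the values of the formula with a given Gödel number. -/
def formulaNorm (rad : List ℕ) : ℕ → ℕ := strongRec (formulaNormStep approx modulus rad)

/-- The last successor of a number `j < e` for which the modulus of continuity of the `m`-th
connective at precision `1 / (j + 1)` is respected by arguments with error less than `1 / e`;
`0` if there is none. -/
def connPrec (m N e : ℕ) : ℕ :=
  Nat.rec (motive := fun _ => ℕ) 0
    (fun j r => bif Nat.ble (modulus (m, N, j) + 1) e then j + 1 else r) e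

/-- The recursion step of `formulaPrec`. -/
def formulaPrecStep (rad : List ℕ) (J : ℕ) (l : List ℕ) : ℕ :=
  bif Nat.beq l.length.unpair.1 3 then
    connPrec modulus l.length.unpair.2.unpair.1
      (listMax ((decodeList l.length.unpair.2.unpair.2).map (formulaNorm approx modulus rad)) + 1)
      (listMin (J + 1) ((decodeList l.length.unpair.2.unpair.2).map fun c => l.getD c 0)) / 2
  else J + 1

/-- A number `e` such that, at stage `J`, the value of the formula with a given Gödel number is
approximated with error less than `1 / e`; nothing is claimed if it is `0`. -/
def formulaPrec (rad : List ℕ) (J : ℕ) : ℕ → ℕ := strongRec (formulaPrecStep approx modulus rad J)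

/-- The recursion step of `formulaNeed`. -/
def formulaNeedStep (rad : List ℕ) (J : ℕ) (l : List (ℕ × ℕ)) : ℕ × ℕ :=
  bif Nat.beq l.length.unpair.1 3 then
    (listMax ((decodeList l.length.unpair.2.unpair.2).map fun c => (l.getD c 0).1),
      listMax ((decodeList l.length.unpair.2.unpair.2).map fun c => (l.getD c 0).2))
  else bif Nat.beq l.length.unpair.1 2 then
    (4 * ((J + 1) * (J + 1)) * (termBound rad
        (distSqCode l.length.unpair.2.unpair.1 l.length.unpair.2.unpair.2)).1 + 1,
      (termBound rad (distSqCode l.length.unpair.2.unpair.1 l.length.unpair.2.unpair.2)).2)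
  else ((J + 1) * (termBound rad l.length.unpair.2).1 + 1, (termBound rad l.length.unpair.2).2)

/-- Numbers `(K, D)` such that, at stage `J`, the moments of degree at most `D` have to be known
with error at most `1 / K` in order to approximate the formula with a given Gödel number. -/
def formulaNeed (rad : List ℕ) (J : ℕ) : ℕ → ℕ × ℕ := strongRec (formulaNeedStep rad J)

/-- The recursion step of `formulaVal`. -/
def formulaValStep (rad : List ℕ) (J p : ℕ) (pt : List GaussCode) (l : List RatCode) : RatCode :=
  bif Nat.beq l.length.unpair.1 0 then
    (codedTrace p (termMatrix rad p pt l.length.unpair.2)).1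
  else bif Nat.beq l.length.unpair.1 1 then
    (codedTrace p (termMatrix rad p pt l.length.unpair.2)).2
  else bif Nat.beq l.length.unpair.1 2 then
    sqrtCode J (codedTrace p (termMatrix rad p pt
      (distSqCode l.length.unpair.2.unpair.1 l.length.unpair.2.unpair.2))).1
  else
    approx (l.length.unpair.2.unpair.1,
      (decodeList l.length.unpair.2.unpair.2).map (fun c => l.getD c (0, 0, 0)), J)

/-- The approximation, at stage `J`, to the value of the formula with a given Gödel number at the
tuple of coded `p × p` matrices `pt`, multiplied by `rad`. -/
def formulaVal (rad : List ℕ) (J p : ℕ) (pt : List GaussCode) : ℕ → RatCode :=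
  strongRec (formulaValStep approx rad J p pt)

end Functions

section Computable

variable {α : Type*} [Primcodable α] {approx : ℕ × List RatCode × ℕ → RatCode}
  {modulus : ℕ × ℕ × ℕ → ℕ}

@[fun_prop]
theorem computable_distSqCode {c d : α → ℕ} (hc : Computable c) (hd : Computable d) :
    Computable fun a => distSqCode (c a) (d a) := by
  unfold distSqCode; fun_prop

@[fun_prop]
theorem computable_sqrtCode {J : α → ℕ} {q : α → RatCode} (hJ : Computable J)
    (hq : Computable q) : Computable fun a => sqrtCode (J a) (q a) := by
  unfold sqrtCode; fun_prop

@[fun_prop]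
theorem computable_decodeList {c : α → ℕ} (hc : Computable c) :
    Computable fun a => decodeList (c a) := by
  unfold decodeList; fun_prop

@[fun_prop]
theorem computable_listMax {l : α → List ℕ} (hl : Computable l) :
    Computable fun a => listMax (l a) := by
  unfold listMax; fun_prop

@[fun_prop]
theorem computable_listMin {b : α → ℕ} {l : α → List ℕ} (hb : Computable b) (hl : Computable l) :
    Computable fun a => listMin (b a) (l a) := by
  unfold listMin; fun_prop

@[fun_prop]
theorem computable_connBound (h₁ : Computable approx) (h₂ : Computable modulus) {m N : α → ℕ}
    {l : α → List ℕ} (hm : Computable m) (hN : Computable N) (hl : Computable l) :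
    Computable fun a => connBound approx modulus (m a) (N a) (l a) := by
  unfold connBound; fun_prop

@[fun_prop]
theorem computable_formulaNorm (h₁ : Computable approx) (h₂ : Computable modulus)
    {rad : α → List ℕ} {c : α → ℕ} (hr : Computable rad) (hc : Computable c) :
    Computable fun a => formulaNorm approx modulus (rad a) (c a) := by
  unfold formulaNorm
  refine computable_strongRec (step := fun a => formulaNormStep approx modulus (rad a)) ?_ hc
  unfold formulaNormStep
  fun_prop

@[fun_prop]
theorem computable_connPrec (h₂ : Computable modulus) {m N e : α → ℕ} (hm : Computable m)
    (hN : Computable N) (he : Computable e) :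
    Computable fun a => connPrec modulus (m a) (N a) (e a) := by
  unfold connPrec; fun_prop

@[fun_prop]
theorem computable_formulaPrec (h₁ : Computable approx) (h₂ : Computable modulus)
    {rad : α → List ℕ} {J c : α → ℕ} (hr : Computable rad) (hJ : Computable J)
    (hc : Computable c) :
    Computable fun a => formulaPrec approx modulus (rad a) (J a) (c a) := by
  unfold formulaPrec
  refine computable_strongRec (step := fun a => formulaPrecStep approx modulus (rad a) (J a)) ?_ hc
  unfold formulaPrecStep
  fun_prop

@[fun_prop]
theorem computable_formulaNeed {rad : α → List ℕ} {J c : α → ℕ} (hr : Computable rad)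
    (hJ : Computable J) (hc : Computable c) :
    Computable fun a => formulaNeed (rad a) (J a) (c a) := by
  unfold formulaNeed
  refine computable_strongRec (step := fun a => formulaNeedStep (rad a) (J a)) ?_ hc
  unfold formulaNeedStep
  fun_prop

@[fun_prop]
theorem computable_formulaVal (h₁ : Computable approx) {rad : α → List ℕ} {J p c : α → ℕ}
    {pt : α → List GaussCode} (hr : Computable rad) (hJ : Computable J) (hp : Computable p)
    (hpt : Computable pt) (hc : Computable c) :
    Computable fun a => formulaVal approx (rad a) (J a) (p a) (pt a) (c a) := by
  unfold formulaVal
  refine computable_strongRec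
    (step := fun a => formulaValStep approx (rad a) (J a) (p a) (pt a)) ?_ hc
  unfold formulaValStep
  fun_prop

end Computable

/-! ### Correctness of the approximate evaluation -/

section Correctness

variable {approx : ℕ × List RatCode × ℕ → RatCode} {modulus : ℕ × ℕ × ℕ → ℕ}

theorem decodeList_encode (l : List ℕ) : decodeList (Encodable.encode l) = l := by
  simp [decodeList]

theorem formulaNorm_conn (rad : List ℕ) (m : ℕ) (l : List ℕ) :
    formulaNorm approx modulus rad (Nat.pair 3 (Nat.pair m (Encodable.encode l))) =
      connBound approx modulus m (listMax (l.map (formulaNorm approx modulus rad)) + 1) l := by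
  rw [formulaNorm, strongRec, formulaNormStep]
  simp only [length_courseOfValues, Nat.unpair_pair, Nat.beq, cond_false, decodeList_encode,
    map_getD_courseOfValues]

theorem formulaPrec_conn (rad : List ℕ) (J m : ℕ) (l : List ℕ) :
    formulaPrec approx modulus rad J (Nat.pair 3 (Nat.pair m (Encodable.encode l))) =
      connPrec modulus m (listMax (l.map (formulaNorm approx modulus rad)) + 1)
        (listMin (J + 1) (l.map (formulaPrec approx modulus rad J))) / 2 := by
  rw [formulaPrec, strongRec, formulaPrecStep]
  simp only [length_courseOfValues, Nat.unpair_pair, Nat.beq, cond_true, decodeList_encode,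
    map_getD_courseOfValues]

theorem formulaNeed_conn (rad : List ℕ) (J m : ℕ) (l : List ℕ) :
    formulaNeed rad J (Nat.pair 3 (Nat.pair m (Encodable.encode l))) =
      (listMax (l.map fun c => (formulaNeed rad J c).1),
        listMax (l.map fun c => (formulaNeed rad J c).2)) := by
  rw [formulaNeed, strongRec, formulaNeedStep]
  simp only [length_courseOfValues, Nat.unpair_pair, Nat.beq, cond_true, decodeList_encode]
  have h := map_getD_courseOfValues (formulaNeedStep rad J) m l 0
  have h₁ := congrArg (List.map Prod.fst) h
  have h₂ := congrArg (List.map Prod.snd) h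
  rw [List.map_map, List.map_map] at h₁ h₂
  exact Prod.ext (congrArg listMax h₁) (congrArg listMax h₂)

theorem formulaVal_conn (rad : List ℕ) (J p : ℕ) (pt : List GaussCode) (m : ℕ) (l : List ℕ) :
    formulaVal approx rad J p pt (Nat.pair 3 (Nat.pair m (Encodable.encode l))) =
      approx (m, l.map (formulaVal approx rad J p pt), J) := by
  rw [formulaVal, strongRec, formulaValStep]
  simp only [length_courseOfValues, Nat.unpair_pair, Nat.beq, cond_false, decodeList_encode,
    map_getD_courseOfValues]

theorem connPrec_spec (m N e : ℕ) :
    connPrec modulus m N e = 0 ∨ ∃ j, connPrec modulus m N e = j + 1 ∧ j < e ∧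
      modulus (m, N, j) + 1 ≤ e := by
  have key : ∀ k, k ≤ e → Nat.rec (motive := fun _ => ℕ) 0
      (fun j r => bif Nat.ble (modulus (m, N, j) + 1) e then j + 1 else r) k = 0 ∨
      ∃ j, Nat.rec (motive := fun _ => ℕ) 0
        (fun j r => bif Nat.ble (modulus (m, N, j) + 1) e then j + 1 else r) k = j + 1 ∧ j < e ∧
          modulus (m, N, j) + 1 ≤ e := by
    intro k hk
    induction k with
    | zero => exact Or.inl rfl
    | succ k ih =>
      simp only
      cases h : Nat.ble (modulus (m, N, k) + 1) e with
      | false => exact ih (Nat.le_of_succ_le hk)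
      | true => exact Or.inr ⟨k, rfl, hk, Nat.le_of_ble_eq_true h⟩
  exact key e le_rfl

theorem lt_connPrec (m N : ℕ) {e j : ℕ} (hj : j < e) (h : modulus (m, N, j) + 1 ≤ e) :
    j < connPrec modulus m N e := by
  have key : ∀ k, j < k → j < Nat.rec (motive := fun _ => ℕ) 0
      (fun j r => bif Nat.ble (modulus (m, N, j) + 1) e then j + 1 else r) k := by
    intro k hk
    induction k with
    | zero => omega
    | succ k ih =>
      simp only
      cases h' : Nat.ble (modulus (m, N, k) + 1) e with
      | false =>
        refine ih (lt_of_le_of_ne (Nat.le_of_lt_succ hk) fun hjk => ?_)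
        rw [← hjk, Nat.ble_eq_true_of_le h] at h'
        exact Bool.noConfusion h'
      | true => exact hk
  exact key e hj

/-- The precision of the approximation to a formula increases to infinity with the stage. -/
theorem exists_le_formulaPrec {u : ConnectiveSystem} {n : ℕ} (rad : List ℕ) (φ : QFFormula u n)
    (E : ℕ) : ∃ J₀, ∀ J, J₀ ≤ J → E ≤ formulaPrec approx modulus rad J φ.code := by
  induction φ generalizing E with
  | conn m args ih =>
    set N := listMax ((List.ofFn fun i => (args i).code).map (formulaNorm approx modulus rad)) + 1
      with hN
    -- `formulaPrec` halves the precision of the connective to make room for the error of `approx`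
    have ih' := fun i => ih i (max (2 * E + 1) (modulus (m, N, 2 * E) + 1))
    choose J₁ hJ₁ using ih'
    refine ⟨max (∑ i, J₁ i) (max (2 * E + 1) (modulus (m, N, 2 * E) + 1)), fun J hJ => ?_⟩
    rw [QFFormula.code, formulaPrec_conn, ← hN, Nat.le_div_iff_mul_le two_pos]
    have he : max (2 * E + 1) (modulus (m, N, 2 * E) + 1) ≤
        listMin (J + 1) ((List.ofFn fun i => (args i).code).map
          (formulaPrec approx modulus rad J)) := by
      refine le_listMin ((le_max_right _ _).trans (hJ.trans (Nat.le_succ _))) fun b hb => ?_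
      obtain ⟨c, hc, rfl⟩ := List.mem_map.1 hb
      obtain ⟨i, rfl⟩ := (List.mem_ofFn' _ _).1 hc
      exact hJ₁ i J ((Finset.single_le_sum (fun _ _ => Nat.zero_le _) (Finset.mem_univ i)).trans
        ((le_max_left _ _).trans hJ))
    have := lt_connPrec (modulus := modulus) m N (j := 2 * E) ((le_max_left _ _).trans he)
      ((le_max_right _ _).trans he)
    omega
  | _ =>
    refine ⟨E, fun J hJ => ?_⟩
    rw [formulaPrec, strongRec, formulaPrecStep]
    simp only [length_courseOfValues, QFFormula.code, Nat.unpair_pair, Nat.beq, cond_false]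
    omega

/-- A function with a modulus of continuity at precision `1` on a box grows at most by the number
of steps that lead through the box. -/
theorem abs_sub_apply_zero_le_of_modulus {k N l : ℕ} {f : (Fin k → ℝ) → ℝ}
    (hf : ∀ x y : Fin k → ℝ, ‖x‖ ≤ N → ‖y‖ ≤ N → dist x y < 1 / ((l : ℝ) + 1) → |f x - f y| < 1)
    {x : Fin k → ℝ} (hx : ‖x‖ ≤ N) : |f x - f 0| ≤ (N * (l + 1) + 1 : ℕ) := by
  set S := N * (l + 1) + 1 with hS
  have hS0 : (0 : ℝ) < S := by positivity
  have key : ∀ j : ℕ, j ≤ S → |f (((j : ℝ) / S) • x) - f 0| ≤ j := by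
    intro j hj
    induction j with
    | zero => simp
    | succ j ih =>
      have hb : ∀ i : ℕ, i ≤ S → ‖((i : ℝ) / S) • x‖ ≤ N := by
        intro i hi
        rw [norm_smul, Real.norm_of_nonneg (by positivity)]
        have : (i : ℝ) / S ≤ 1 := (div_le_one hS0).2 (by exact_mod_cast hi)
        calc (i : ℝ) / S * ‖x‖ ≤ 1 * ‖x‖ := by gcongr
          _ ≤ N := by simpa using hx
      have hstep : |f ((((j + 1 : ℕ) : ℝ) / S) • x) - f (((j : ℝ) / S) • x)| < 1 := by
        refine hf _ _ (hb _ hj) (hb _ (Nat.le_of_succ_le hj)) ?_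
        rw [dist_eq_norm, ← sub_smul, norm_smul]
        have h₁ : ((j + 1 : ℕ) : ℝ) / S - (j : ℝ) / S = 1 / S := by
          push_cast
          ring
        rw [h₁, Real.norm_of_nonneg (by positivity), one_div_mul_eq_div, div_lt_div_iff₀ hS0
          (by positivity)]
        have h₂ : (S : ℝ) = N * ((l : ℝ) + 1) + 1 := by
          rw [hS]
          push_cast
          ring
        rw [h₂]
        have : ‖x‖ * ((l : ℝ) + 1) ≤ N * ((l : ℝ) + 1) := by gcongr
        linarith
      have := ih (Nat.le_of_succ_le hj)
      have h₂ := abs_sub_le (f ((((j + 1 : ℕ) : ℝ) / S) • x)) (f (((j : ℝ) / S) • x)) (f 0)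
      push_cast at *
      linarith
  have := key S le_rfl
  rwa [div_self hS0.ne', one_smul] at this

theorem le_listMax_map_ofFn {α : Type*} {k : ℕ} (f : α → ℕ) (g : Fin k → α) (i : Fin k) :
    f (g i) ≤ listMax ((List.ofFn g).map f) :=
  le_listMax (List.mem_map.2 ⟨_, (List.mem_ofFn' _ _).2 ⟨i, rfl⟩, rfl⟩)

theorem abs_sqrt_re_le_of_norm_le {L : ℕ} {z : ℂ} (h : ‖z‖ ≤ L) :
    |Real.sqrt z.re| ≤ (L : ℝ) + 1 := by
  have h₃ := Complex.re_le_norm z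
  rw [abs_of_nonneg (Real.sqrt_nonneg _), Real.sqrt_le_iff]
  exact ⟨by positivity, by nlinarith [Nat.cast_nonneg (α := ℝ) L]⟩

theorem abs_sqrt_re_sub_sqrtCode_lt {J K L : ℕ} {z : ℂ} {Z : GaussCode} {Δ : ℝ}
    (h : ‖z - Z.val‖ ≤ L * Δ) (hΔ : 0 < Δ) (hKΔ : K * Δ ≤ 1)
    (hK : 4 * ((J + 1) * (J + 1)) * L + 1 ≤ K) :
    |Real.sqrt z.re - ((sqrtCode J Z.1).val : ℝ)| < 1 / ((J : ℝ) + 1) := by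
  have h₃ := abs_sqrt_sub_sqrtCode_lt J Z.1
  rw [← GaussCode.re_val] at h₃
  have h₄ := abs_sqrt_sub_sqrt_le z.re Z.val.re
  have h₅ : |z.re - Z.val.re| ≤ L * Δ := by
    rw [← Complex.sub_re]
    exact (Complex.abs_re_le_norm _).trans h
  have h₆ : Real.sqrt |z.re - Z.val.re| ≤ 1 / (2 * ((J : ℝ) + 1)) := by
    refine Real.sqrt_le_iff.2 ⟨by positivity, h₅.trans ?_⟩
    have h₇ : ((4 * ((J + 1) * (J + 1)) * L + 1 : ℕ) : ℝ) ≤ K := by exact_mod_cast hK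
    push_cast at h₇
    rw [div_pow, le_div_iff₀ (by positivity)]
    nlinarith [mul_le_mul_of_nonneg_right h₇ hΔ.le]
  have h₇ := abs_sub_le (Real.sqrt z.re) (Real.sqrt Z.val.re) ((sqrtCode J Z.1).val : ℝ)
  have h₈ : 1 / ((J : ℝ) + 1) = 1 / (2 * ((J : ℝ) + 1)) + 1 / (2 * ((J : ℝ) + 1)) := by
    field_simp
    norm_num
  rw [h₈]
  linarith

variable {u : ConnectiveSystem}

/-- The approximations to formulas are correct: for every assignment `T` of traces to terms that is
close to the traces at the tuple of coded matrices, the bounds and error estimates hold. -/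
theorem QFFormula.approx_spec
    (happrox : ∀ (m : ℕ) (q : Fin (u.arity m) → RatCode) (j : ℕ),
      |u.fn m (ratPoint q) - ((approx (m, List.ofFn q, j)).val : ℝ)| < 1 / ((j : ℝ) + 1))
    (hmodulus : ∀ (m N j : ℕ) (x y : Fin (u.arity m) → ℝ), ‖x‖ ≤ N → ‖y‖ ≤ N →
      Dist.dist x y < 1 / ((modulus (m, N, j) : ℝ) + 1) → |u.fn m x - u.fn m y| < 1 / ((j : ℝ) + 1))
    {n : ℕ} (rad : List ℕ) (J p K D : ℕ) (pt : List GaussCode) (T : VNTerm n → ℂ)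
    (hT : ∀ t, ‖T t‖ ≤ (termBound rad t.code).1) {Δ : ℝ} (hΔ : 0 < Δ) (hKΔ : K * Δ ≤ 1)
    (hTS : ∀ t : VNTerm n, (termBound rad t.code).2 ≤ D →
      ‖T t - (codedTrace p (termMatrix rad p pt t.code)).val‖ ≤ (termBound rad t.code).1 * Δ)
    (φ : QFFormula u n) (hK : (formulaNeed rad J φ.code).1 ≤ K)
    (hD : (formulaNeed rad J φ.code).2 ≤ D) :
    |φ.evalFun T| ≤ formulaNorm approx modulus rad φ.code ∧
      (0 < formulaPrec approx modulus rad J φ.code →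
        |φ.evalFun T - ((formulaVal approx rad J p pt φ.code).val : ℝ)| <
          1 / (formulaPrec approx modulus rad J φ.code : ℝ)) := by
  have hJ1 : (0 : ℝ) < (J : ℝ) + 1 := by positivity
  have hneed : ∀ t : VNTerm n, (J + 1) * (termBound rad t.code).1 + 1 ≤ K →
      (termBound rad t.code).2 ≤ D →
      ‖T t - (codedTrace p (termMatrix rad p pt t.code)).val‖ < 1 / ((J : ℝ) + 1) := by
    intro t h₁ h₂
    refine (hTS t h₂).trans_lt ?_
    rw [lt_div_iff₀ hJ1]
    have h₃ : (((J + 1) * (termBound rad t.code).1 + 1 : ℕ) : ℝ) ≤ K := by exact_mod_cast h₁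
    push_cast at h₃
    nlinarith [mul_le_mul_of_nonneg_right h₃ hΔ.le]
  induction φ with
  | traceRe t =>
    rw [formulaNeed, strongRec, formulaNeedStep] at hK hD
    rw [formulaNorm, strongRec, formulaNormStep, formulaPrec, strongRec, formulaPrecStep,
      formulaVal, strongRec, formulaValStep]
    simp only [length_courseOfValues, QFFormula.code, Nat.unpair_pair, Nat.beq, cond_true,
      cond_false] at hK hD ⊢
    refine ⟨(Complex.abs_re_le_norm _).trans (hT t), fun _ => ?_⟩
    rw [← GaussCode.re_val, QFFormula.evalFun, ← Complex.sub_re]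
    push_cast
    exact (Complex.abs_re_le_norm _).trans_lt (hneed t hK hD)
  | traceIm t =>
    rw [formulaNeed, strongRec, formulaNeedStep] at hK hD
    rw [formulaNorm, strongRec, formulaNormStep, formulaPrec, strongRec, formulaPrecStep,
      formulaVal, strongRec, formulaValStep]
    simp only [length_courseOfValues, QFFormula.code, Nat.unpair_pair, Nat.beq, cond_true,
      cond_false] at hK hD ⊢
    refine ⟨(Complex.abs_im_le_norm _).trans (hT t), fun _ => ?_⟩
    rw [← GaussCode.im_val, QFFormula.evalFun, ← Complex.sub_im]
    push_cast
    exact (Complex.abs_im_le_norm _).trans_lt (hneed t hK hD)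
  | dist s t =>
    rw [formulaNeed, strongRec, formulaNeedStep] at hK hD
    rw [formulaNorm, strongRec, formulaNormStep, formulaPrec, strongRec, formulaPrecStep,
      formulaVal, strongRec, formulaValStep]
    simp only [length_courseOfValues, QFFormula.code, Nat.unpair_pair, Nat.beq, cond_true,
      cond_false, ← VNTerm.code_distSq] at hK hD ⊢
    have h₁ := hT (s.distSq t)
    have h₂ := hTS (s.distSq t) hD
    rw [QFFormula.evalFun]
    constructor
    · exact_mod_cast abs_sqrt_re_le_of_norm_le h₁
    · intro _
      push_cast
      exact abs_sqrt_re_sub_sqrtCode_lt h₂ hΔ hKΔ hK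
  | conn m args ih =>
    rw [QFFormula.code] at hK hD ⊢
    rw [formulaNeed_conn] at hK hD
    rw [formulaNorm_conn, formulaPrec_conn, formulaVal_conn]
    have ih' := fun i => ih i
      ((le_listMax_map_ofFn (fun c => (formulaNeed rad J c).1) (fun i => (args i).code) i).trans hK)
      ((le_listMax_map_ofFn (fun c => (formulaNeed rad J c).2) (fun i => (args i).code) i).trans hD)
    set N₀ := listMax ((List.ofFn fun i => (args i).code).map (formulaNorm approx modulus rad))
      with hN₀
    set e := listMin (J + 1) ((List.ofFn fun i => (args i).code).map
      (formulaPrec approx modulus rad J)) with he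
    have hle : ∀ i, formulaNorm approx modulus rad (args i).code ≤ N₀ := fun i =>
      le_listMax_map_ofFn (formulaNorm approx modulus rad) (fun i => (args i).code) i
    have hN : ∀ i, |(args i).evalFun T| ≤ N₀ := fun i =>
      (ih' i).1.trans (Nat.cast_le.2 (hle i))
    have hnorm : ‖fun i => (args i).evalFun T‖ ≤ ((N₀ + 1 : ℕ) : ℝ) := by
      refine (pi_norm_le_iff_of_nonneg (by positivity)).2 fun i => (hN i).trans ?_
      push_cast
      linarith
    rw [QFFormula.evalFun]
    constructor
    · have h₁ := abs_sub_apply_zero_le_of_modulus (f := u.fn m) (N := N₀ + 1)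
        (l := modulus (m, N₀ + 1, 0)) (fun x y hx hy hxy => by
          simpa using hmodulus m (N₀ + 1) 0 x y hx hy hxy) hnorm
      have h₂ := happrox m (fun _ => (0, 0, 0)) 0
      have h₃ : (ratPoint fun _ : Fin (u.arity m) => ((0, 0, 0) : RatCode)) = 0 := by
        ext i
        simp [ratPoint, RatCode.val]
      have h₄ : (List.ofFn fun _ : Fin (u.arity m) => ((0, 0, 0) : RatCode)) =
          (List.ofFn fun i => (args i).code).map fun _ => (0, 0, 0) := by
        rw [List.map_ofFn]
        rfl
      rw [h₃, h₄] at h₂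
      have h₅ :=
        (approx (m, (List.ofFn fun i => (args i).code).map fun _ => (0, 0, 0), 0)).abs_val_le
      rw [connBound]
      have h₆ := abs_sub_le (u.fn m fun i => (args i).evalFun T) (u.fn m 0) 0
      have h₇ := abs_sub_le (u.fn m 0) ((approx (m, (List.ofFn fun i => (args i).code).map
        fun _ => (0, 0, 0), 0)).val : ℝ) 0
      rw [sub_zero, sub_zero] at h₆ h₇
      push_cast at h₁ h₂ h₅ h₆ h₇ ⊢
      rw [zero_add, div_one] at h₂
      linarith
    · intro hpos
      rcases connPrec_spec (modulus := modulus) m (N₀ + 1) e with h | ⟨j, h, hj, hm⟩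
      · rw [h] at hpos
        omega
      rw [h] at hpos ⊢
      have he0 : 0 < e := by omega
      have heR : (0 : ℝ) < e := by exact_mod_cast he0
      set q : Fin (u.arity m) → RatCode := fun i => formulaVal approx rad J p pt (args i).code
        with hq
      have hlist : (List.ofFn fun i => (args i).code).map (formulaVal approx rad J p pt) =
          List.ofFn q := by
        rw [List.map_ofFn]
        rfl
      have hdist : ∀ i, |(args i).evalFun T - ((q i).val : ℝ)| < 1 / (e : ℝ) := by
        intro i
        have hle : e ≤ formulaPrec approx modulus rad J (args i).code :=
          listMin_le (List.mem_map.2 ⟨_, (List.mem_ofFn' _ _).2 ⟨i, rfl⟩, rfl⟩)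
        refine ((ih' i).2 (he0.trans_le hle)).trans_le ?_
        exact one_div_le_one_div_of_le heR (by exact_mod_cast hle)
      -- the approximate arguments may leave the box of the exact ones, but only by less than `1`
      have hqnorm : ‖ratPoint q‖ ≤ ((N₀ + 1 : ℕ) : ℝ) := by
        refine (pi_norm_le_iff_of_nonneg (by positivity)).2 fun i => ?_
        have h₁ := hdist i
        have h₂ : 1 / (e : ℝ) ≤ 1 := (div_le_one heR).2 (by exact_mod_cast he0)
        have h₃ := hN i
        rw [abs_sub_lt_iff] at h₁
        rw [abs_le] at h₃
        rw [ratPoint, Real.norm_eq_abs, abs_le]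
        push_cast
        exact ⟨by linarith, by linarith⟩
      have h₁ : |u.fn m (fun i => (args i).evalFun T) - u.fn m (ratPoint q)| <
          1 / ((j : ℝ) + 1) := by
        refine hmodulus m (N₀ + 1) j _ _ hnorm hqnorm ?_
        have hle : 1 / (e : ℝ) ≤ 1 / ((modulus (m, N₀ + 1, j) : ℝ) + 1) :=
          one_div_le_one_div_of_le (by positivity) (by exact_mod_cast hm)
        exact ((dist_pi_lt_iff (by positivity)).2 fun i => hdist i).trans_le hle
      have h₂ := happrox m q J
      have heJ : e ≤ J + 1 := listMin_le_left _ _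
      have h₃ : 1 / ((J : ℝ) + 1) ≤ 1 / ((j : ℝ) + 1) := by
        refine one_div_le_one_div_of_le (by positivity) ?_
        have : j ≤ J := by omega
        have : (j : ℝ) ≤ J := by exact_mod_cast this
        linarith
      have h₄ : 2 * (1 / ((j : ℝ) + 1)) ≤ 1 / (((j + 1) / 2 : ℕ) : ℝ) := by
        rw [mul_one_div, div_le_div_iff₀ (by positivity) (by exact_mod_cast hpos)]
        have : (j + 1) / 2 * 2 ≤ j + 1 := Nat.div_mul_le_self _ _
        have : (((j + 1) / 2 * 2 : ℕ) : ℝ) ≤ ((j + 1 : ℕ) : ℝ) := by exact_mod_cast this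
        push_cast at this ⊢
        linarith
      rw [hlist]
      have h₅ := abs_sub_le (u.fn m fun i => (args i).evalFun T) (u.fn m (ratPoint q))
        ((approx (m, List.ofFn q, J)).val : ℝ)
      linarith

end Correctness

section MatrixNorm

open scoped Matrix.Norms.L2Operator

/-! ### Operator norms of matrices -/

theorem sum_col_sq_eq {p : ℕ} (A : Matrix (Fin p) (Fin p) ℂ) (j : Fin p) :
    ∑ i, ‖A i j‖ ^ 2 =
      ‖Matrix.toEuclideanCLM (n := Fin p) (𝕜 := ℂ) A (EuclideanSpace.single j 1)‖ ^ 2 := by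
  rw [EuclideanSpace.norm_sq_eq]
  refine Finset.sum_congr rfl fun i _ => ?_
  rw [Matrix.ofLp_toEuclideanCLM]
  simp

theorem sum_sq_le_card_mul_norm_sq {p : ℕ} (A : Matrix (Fin p) (Fin p) ℂ) :
    ∑ j, ∑ i, ‖A i j‖ ^ 2 ≤ p * ‖A‖ ^ 2 := by
  have h : ∀ j : Fin p, ∑ i, ‖A i j‖ ^ 2 ≤ ‖A‖ ^ 2 := by
    intro j
    rw [sum_col_sq_eq]
    have := (Matrix.toEuclideanCLM (n := Fin p) (𝕜 := ℂ) A).le_opNorm (EuclideanSpace.single j 1)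
    rw [PiLp.norm_single, norm_one, mul_one, Matrix.l2_opNorm_toEuclideanCLM] at this
    gcongr
  exact (Finset.sum_le_sum fun j _ => h j).trans (by simp)

theorem norm_sq_le_sum_sq {p : ℕ} (A : Matrix (Fin p) (Fin p) ℂ) :
    ‖A‖ ^ 2 ≤ ∑ j, ∑ i, ‖A i j‖ ^ 2 := by
  rw [← Real.le_sqrt (norm_nonneg _) (Finset.sum_nonneg fun _ _ =>
      Finset.sum_nonneg fun _ _ => sq_nonneg _),
    ← Matrix.l2_opNorm_toEuclideanCLM]
  refine ContinuousLinearMap.opNorm_le_bound _ (Real.sqrt_nonneg _) fun x => ?_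
  have hx : x = ∑ j, x j • EuclideanSpace.single j (1 : ℂ) := by
    ext i
    simp [Finset.sum_apply, Pi.single_apply]
  have h₁ : ‖Matrix.toEuclideanCLM (n := Fin p) (𝕜 := ℂ) A x‖ ≤
      ∑ j, ‖Matrix.toEuclideanCLM (n := Fin p) (𝕜 := ℂ) A (EuclideanSpace.single j 1)‖ * ‖x j‖ := by
    conv_lhs => rw [hx, map_sum]
    refine (norm_sum_le _ _).trans (Finset.sum_le_sum fun j _ => ?_)
    rw [map_smul, norm_smul, mul_comm]
  refine h₁.trans ?_
  rw [EuclideanSpace.norm_eq, ← Real.sqrt_mul (Finset.sum_nonneg fun _ _ =>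
    Finset.sum_nonneg fun _ _ => sq_nonneg _)]
  refine Real.le_sqrt_of_sq_le ((Finset.sum_mul_sq_le_sq_mul_sq _ _ _).trans_eq ?_)
  simp only [sum_col_sq_eq]

theorem norm_apply_le_norm {p : ℕ} (A : Matrix (Fin p) (Fin p) ℂ) (i j : Fin p) :
    ‖A i j‖ ≤ ‖A‖ := by
  have h₁ : ‖A i j‖ ^ 2 ≤ ∑ i, ‖A i j‖ ^ 2 :=
    Finset.single_le_sum (f := fun i => ‖A i j‖ ^ 2) (fun _ _ => sq_nonneg _) (Finset.mem_univ i)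
  rw [sum_col_sq_eq] at h₁
  have := (Matrix.toEuclideanCLM (n := Fin p) (𝕜 := ℂ) A).le_opNorm (EuclideanSpace.single j 1)
  rw [PiLp.norm_single, norm_one, mul_one, Matrix.l2_opNorm_toEuclideanCLM] at this
  exact (pow_le_pow_iff_left₀ (norm_nonneg _) (norm_nonneg _) two_ne_zero).1
    (h₁.trans (by gcongr))

theorem norm_normalizedTrace_le {p : ℕ} (A : Matrix (Fin p) (Fin p) ℂ) :
    ‖normalizedTrace A‖ ≤ ‖A‖ := by
  rcases Nat.eq_zero_or_pos p with rfl | hp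
  · simp [normalizedTrace]
  · have hp' : (0 : ℝ) < p := by exact_mod_cast hp
    rw [normalizedTrace, norm_div, Complex.norm_natCast, div_le_iff₀ hp', Matrix.trace]
    refine (norm_sum_le _ _).trans
      ((Finset.sum_le_sum fun i _ => norm_apply_le_norm A i i).trans_eq ?_)
    simp [mul_comm]

/-- The operator norm is detected by the Frobenius norm of high powers of `A* A`. -/
theorem norm_le_one_of_sum_sq_pow_le {p : ℕ} (A : Matrix (Fin p) (Fin p) ℂ) (k : ℕ)
    (h : ∑ j, ∑ i, ‖((star A * A) ^ 2 ^ k) i j‖ ^ 2 ≤ 1) : ‖A‖ ≤ 1 := by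
  have h₁ := (norm_sq_le_sum_sq ((star A * A) ^ 2 ^ k)).trans h
  rw [(IsSelfAdjoint.star_mul_self A).norm_pow_two_pow, CStarRing.norm_star_mul_self, ← pow_two,
    ← pow_mul, ← pow_mul] at h₁
  exact (pow_le_one_iff_of_nonneg (norm_nonneg _) (by positivity)).1 h₁

/-- Matrices of norm slightly less than `1` pass the test of `norm_le_one_of_sum_sq_pow_le` for an
explicit power. -/
theorem sum_sq_pow_le_one {p : ℕ} (A : Matrix (Fin p) (Fin p) ℂ) {K : ℕ} (hK : 0 < K)
    (h : ‖A‖ ≤ 1 - 1 / (K : ℝ)) :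
    ∑ j, ∑ i, ‖((star A * A) ^ 2 ^ (K + p)) i j‖ ^ 2 ≤ 1 := by
  refine (sum_sq_le_card_mul_norm_sq _).trans ?_
  rw [(IsSelfAdjoint.star_mul_self A).norm_pow_two_pow, CStarRing.norm_star_mul_self, ← pow_two,
    ← pow_mul, ← pow_mul]
  have hK' : (0 : ℝ) < K := by exact_mod_cast hK
  have h₁ : ‖A‖ ^ (K * p) ≤ Real.exp (-(p : ℝ)) := by
    have h₂ : ‖A‖ ≤ Real.exp (-(1 / (K : ℝ))) := h.trans (Real.one_sub_le_exp_neg _)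
    calc ‖A‖ ^ (K * p) ≤ Real.exp (-(1 / (K : ℝ))) ^ (K * p) := by gcongr
      _ = Real.exp (-(p : ℝ)) := by
        rw [← Real.exp_nat_mul]
        congr 1
        push_cast
        field_simp
  have h₂ : ‖A‖ ^ (2 * (2 ^ (K + p) * 2)) ≤ ‖A‖ ^ (K * p) := by
    refine pow_le_pow_of_le_one (norm_nonneg _) (h.trans (by
      have : (0 : ℝ) < 1 / K := by positivity
      linarith)) ?_
    have h₃ : K * p ≤ 2 ^ K * 2 ^ p := Nat.mul_le_mul Nat.lt_two_pow_self.le Nat.lt_two_pow_self.le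
    rw [← pow_add] at h₃
    omega
  -- the factor `p` from comparing the two norms is absorbed by the decay of the power
  have h₃ : (p : ℝ) * Real.exp (-(p : ℝ)) ≤ 1 := by
    rw [Real.exp_neg, ← div_eq_mul_inv, div_le_one (Real.exp_pos _)]
    linarith [Real.add_one_le_exp (p : ℝ)]
  calc (p : ℝ) * ‖A‖ ^ (2 * (2 ^ (K + p) * 2)) ≤ p * Real.exp (-(p : ℝ)) := by
        gcongr
        exact h₂.trans h₁
    _ ≤ 1 := h₃

end MatrixNorm

/-! ### Finite nets in the unit ball of the matrices -/

/-- All lists of a given length with entries in the list `A`. -/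
def listsOver {σ : Type*} (A : List σ) (len : ℕ) : List (List σ) :=
  Nat.rec (motive := fun _ => List (List σ)) [[]]
    (fun _ W => W.flatMap fun w => A.map fun a => a :: w) len

theorem mem_listsOver {σ : Type*} {A : List σ} {len : ℕ} {w : List σ} :
    w ∈ listsOver A len ↔ w.length = len ∧ ∀ a ∈ w, a ∈ A := by
  induction len generalizing w with
  | zero =>
    have : listsOver A 0 = [[]] := rfl
    rw [this, List.mem_singleton, List.length_eq_zero_iff]
    constructor
    · rintro rfl
      simp
    · exact fun h => h.1
  | succ len ih =>
    have : listsOver A (len + 1) = (listsOver A len).flatMap fun w => A.map fun a => a :: w := rfl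
    rw [this]
    simp only [List.mem_flatMap, List.mem_map]
    constructor
    · rintro ⟨v, hv, a, ha, rfl⟩
      obtain ⟨h₁, h₂⟩ := ih.1 hv
      refine ⟨by simp [h₁], fun b hb => ?_⟩
      rcases List.mem_cons.1 hb with rfl | hb
      · exact ha
      · exact h₂ b hb
    · rintro ⟨h₁, h₂⟩
      cases w with
      | nil => simp at h₁
      | cons a v =>
        exact ⟨v, ih.2 ⟨by simpa using h₁, fun b hb => h₂ b (List.mem_cons_of_mem _ hb)⟩, a,
          h₂ a List.mem_cons_self, rfl⟩

/-- The Gaussian rationals `(s - G) / G + (t - G) / G * i` with `s, t ≤ 2 G`. -/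
def gridAlphabet (G : ℕ) : List GaussCode :=
  (List.range (2 * G + 1)).flatMap fun s =>
    (List.range (2 * G + 1)).map fun t => ((s, G, G - 1), (t, G, G - 1))

/-- The `2 ^ k`-th power of `star A * A`, for a coded matrix `A`. -/
def codedPower (p k : ℕ) (A : List GaussCode) : List GaussCode :=
  Nat.rec (motive := fun _ => List GaussCode) (codedMul p (codedStar p A) A)
    (fun _ B => codedMul p B B) k

/-- The square of the Frobenius norm of a coded matrix. -/
def codedFrobenius (p : ℕ) (A : List GaussCode) : GaussCode :=
  GaussCode.sum ((List.range p).map fun j => GaussCode.sum ((List.range p).map fun i =>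
    GaussCode.mul (GaussCode.conj (codedEntry A 0 p i j)) (codedEntry A 0 p i j)))

/-- The test whether all matrices `A` of a coded tuple satisfy `‖(A* A) ^ (2 ^ k)‖_F ≤ 1`.  It is
decidable, unlike a comparison of real numbers, and implies that the operator norms are at most
`1`. -/
def isContractive (n p k : ℕ) (pt : List GaussCode) : Bool :=
  (List.range n).all fun v =>
    Nat.ble (codedFrobenius p (codedPower p k
        (tabulate p fun i j => codedEntry pt (v * (p * p)) p i j))).1.1
      ((codedFrobenius p (codedPower p k
        (tabulate p fun i j => codedEntry pt (v * (p * p)) p i j))).1.2.1 +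
      ((codedFrobenius p (codedPower p k
        (tabulate p fun i j => codedEntry pt (v * (p * p)) p i j))).1.2.2 + 1))

/-- A finite set of `n`-tuples of contractions in `M_p(ℂ)`, with entries in a grid of width
`1 / (2 p K)`. -/
def matrixNet (n p K : ℕ) : List (List GaussCode) :=
  (listsOver (gridAlphabet (2 * p * K)) (n * (p * p))).filter (isContractive n p (K + p))

section Computable

variable {α : Type*} [Primcodable α]

@[fun_prop]
theorem computable_listsOver {σ : Type*} [Primcodable σ] {A : α → List σ} {len : α → ℕ}
    (hA : Computable A) (hl : Computable len) : Computable fun a => listsOver (A a) (len a) := by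
  unfold listsOver; fun_prop

@[fun_prop]
theorem computable_gridAlphabet {G : α → ℕ} (hG : Computable G) :
    Computable fun a => gridAlphabet (G a) := by
  unfold gridAlphabet; fun_prop

@[fun_prop]
theorem computable_codedPower {p k : α → ℕ} {A : α → List GaussCode} (hp : Computable p)
    (hk : Computable k) (hA : Computable A) :
    Computable fun a => codedPower (p a) (k a) (A a) := by
  unfold codedPower; fun_prop

@[fun_prop]
theorem computable_codedFrobenius {p : α → ℕ} {A : α → List GaussCode} (hp : Computable p)
    (hA : Computable A) : Computable fun a => codedFrobenius (p a) (A a) := by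
  unfold codedFrobenius; fun_prop

@[fun_prop]
theorem computable_isContractive {n p k : α → ℕ} {pt : α → List GaussCode} (hn : Computable n)
    (hp : Computable p) (hk : Computable k) (hpt : Computable pt) :
    Computable fun a => isContractive (n a) (p a) (k a) (pt a) := by
  unfold isContractive; fun_prop

@[fun_prop]
theorem computable_matrixNet {n p K : α → ℕ} (hn : Computable n) (hp : Computable p)
    (hK : Computable K) : Computable fun a => matrixNet (n a) (p a) (K a) := by
  unfold matrixNet; fun_prop

end Computable

theorem codedMatrix_power (p k : ℕ) (A : List GaussCode) :
    codedMatrix (codedPower p k A) 0 p =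
      (star (codedMatrix A 0 p) * codedMatrix A 0 p) ^ 2 ^ k := by
  induction k with
  | zero =>
    have : codedPower p 0 A = codedMul p (codedStar p A) A := rfl
    rw [this, codedMatrix_mul, codedMatrix_star]
    simp
  | succ k ih =>
    have : codedPower p (k + 1) A = codedMul p (codedPower p k A) (codedPower p k A) := rfl
    rw [this, codedMatrix_mul, ih, pow_succ, pow_mul, pow_two]

theorem val_codedFrobenius (p : ℕ) (A : List GaussCode) :
    ((codedFrobenius p A).1.val : ℝ) = ∑ j, ∑ i, ‖codedMatrix A 0 p i j‖ ^ 2 := by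
  have h : (codedFrobenius p A).val = ((∑ j, ∑ i, ‖codedMatrix A 0 p i j‖ ^ 2 : ℝ) : ℂ) := by
    simp only [codedFrobenius, GaussCode.val_sum, List.map_map, sum_map_range, Function.comp_def,
      GaussCode.val_mul, GaussCode.val_conj]
    push_cast
    refine Finset.sum_congr rfl fun j _ => Finset.sum_congr rfl fun i _ => ?_
    exact Complex.conj_mul' _
  rw [← GaussCode.re_val, h, Complex.ofReal_re]

theorem RatCode.val_le_one_iff (q : RatCode) : (q.val : ℝ) ≤ 1 ↔ q.1 ≤ q.2.1 + (q.2.2 + 1) := by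
  simp only [RatCode.val]
  push_cast
  rw [div_le_one (by positivity), sub_le_iff_le_add']
  exact_mod_cast Iff.rfl

theorem isContractive_iff (n p k : ℕ) (pt : List GaussCode) :
    isContractive n p k pt = true ↔ ∀ v : Fin n,
      ∑ j, ∑ i, ‖((star (codedTuple n p pt v) * codedTuple n p pt v) ^ 2 ^ k) i j‖ ^ 2 ≤ 1 := by
  rw [isContractive, List.all_eq_true]
  have key : ∀ v : ℕ, codedMatrix (tabulate p fun i j => codedEntry pt (v * (p * p)) p i j) 0 p =
      codedMatrix pt (v * (p * p)) p := fun v => codedMatrix_tabulate _ _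
  have : ∀ v : ℕ, Nat.ble (codedFrobenius p (codedPower p k
        (tabulate p fun i j => codedEntry pt (v * (p * p)) p i j))).1.1
      ((codedFrobenius p (codedPower p k
        (tabulate p fun i j => codedEntry pt (v * (p * p)) p i j))).1.2.1 +
      ((codedFrobenius p (codedPower p k
        (tabulate p fun i j => codedEntry pt (v * (p * p)) p i j))).1.2.2 + 1)) = true ↔
      ∑ j, ∑ i, ‖((star (codedMatrix pt (v * (p * p)) p) *
        codedMatrix pt (v * (p * p)) p) ^ 2 ^ k) i j‖ ^ 2 ≤ 1 := by
    intro v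
    rw [← key v, ← codedMatrix_power, ← val_codedFrobenius, RatCode.val_le_one_iff, Nat.ble_eq]
  simp only [this, List.mem_range]
  exact ⟨fun h v => h v v.2, fun h v hv => h ⟨v, hv⟩⟩

open scoped Matrix.Norms.L2Operator in
theorem norm_codedTuple_le_one {n p K : ℕ} {pt : List GaussCode} (h : pt ∈ matrixNet n p K)
    (v : Fin n) : ‖codedTuple n p pt v‖ ≤ 1 :=
  norm_le_one_of_sum_sq_pow_le _ _ ((isContractive_iff _ _ _ _).1 (List.mem_filter.1 h).2 v)

/-- The grid point below a complex number with real and imaginary parts in `[-1, 1]`. -/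
def gridRound (G : ℕ) (z : ℂ) : GaussCode :=
  ((⌊(z.re + 1) * G⌋₊, G, G - 1), (⌊(z.im + 1) * G⌋₊, G, G - 1))

theorem gridRound_mem {G : ℕ} {z : ℂ} (hz : ‖z‖ ≤ 1) : gridRound G z ∈ gridAlphabet G := by
  have key : ∀ x : ℝ, x ≤ 1 → ⌊(x + 1) * G⌋₊ < 2 * G + 1 := by
    intro x hx
    refine Nat.lt_succ_of_le (Nat.floor_le_of_le ?_)
    push_cast
    nlinarith [Nat.cast_nonneg (α := ℝ) G]
  simp only [gridRound, gridAlphabet, List.mem_flatMap, List.mem_map, List.mem_range]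
  exact ⟨_, key _ ((Complex.re_le_norm z).trans hz), _, key _ (((le_abs_self _).trans
    (Complex.abs_im_le_norm z)).trans hz), rfl⟩

theorem norm_gridRound_sub_le {G : ℕ} (hG : 0 < G) {z : ℂ} (hz : ‖z‖ ≤ 1) :
    ‖(gridRound G z).val - z‖ ≤ 2 / G := by
  have hG' : (0 : ℝ) < G := by exact_mod_cast hG
  have key : ∀ x : ℝ, |x| ≤ 1 → |(RatCode.val (⌊(x + 1) * G⌋₊, G, G - 1) : ℝ) - x| ≤ 1 / G := by
    intro x hx
    have h₀ := (abs_le.1 hx).1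
    have h₁ := Nat.floor_le (a := (x + 1) * G) (by nlinarith)
    have h₂ := Nat.lt_floor_add_one ((x + 1) * G)
    have h₃ : (RatCode.val (⌊(x + 1) * G⌋₊, G, G - 1) : ℝ) - x =
        (⌊(x + 1) * G⌋₊ - (x + 1) * G) / G := by
      have h₄ : ((G - 1 : ℕ) : ℝ) + 1 = G := by exact_mod_cast Nat.sub_add_cancel hG
      simp only [RatCode.val]
      push_cast
      rw [h₄]
      field_simp
      ring
    rw [h₃, abs_div, abs_of_pos hG', div_le_div_iff_of_pos_right hG', abs_le]
    exact ⟨by linarith, by linarith⟩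
  refine (Complex.norm_le_abs_re_add_abs_im _).trans ?_
  rw [Complex.sub_re, Complex.sub_im, GaussCode.re_val, GaussCode.im_val]
  have h₁ := key z.re ((Complex.abs_re_le_norm z).trans hz)
  have h₂ := key z.im ((Complex.abs_im_le_norm z).trans hz)
  have h₃ : (2 : ℝ) / G = 1 / G + 1 / G := by ring
  rw [h₃]
  exact add_le_add h₁ h₂

open scoped Matrix.Norms.L2Operator in
/-- Every tuple of contractions is close to a tuple in the net: shrink it a little, so that
rounding its entries to the grid leaves room for the test of contractivity. -/
theorem exists_mem_matrixNet {n p K : ℕ} (hp : 0 < p) (hK : 2 ≤ K)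
    (a : Fin n → Matrix (Fin p) (Fin p) ℂ) (ha : ∀ v, ‖a v‖ ≤ 1) :
    ∃ pt ∈ matrixNet n p K, ∀ v, ‖a v - codedTuple n p pt v‖ ≤ 3 / (K : ℝ) := by
  have hK0 : (0 : ℝ) < K := by positivity
  have hp0 : (0 : ℝ) < p := by positivity
  have hK2 : 2 / (K : ℝ) ≤ 1 := (div_le_one hK0).2 (by exact_mod_cast hK)
  set G := 2 * p * K with hG
  have hG0 : 0 < G := by positivity
  set c : ℝ := 1 - 2 / K with hc
  have hc0 : 0 ≤ c := by linarith
  have hc1 : c ≤ 1 := by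
    have : 0 < 2 / (K : ℝ) := by positivity
    linarith
  set b : Fin n → Matrix (Fin p) (Fin p) ℂ := fun v => (c : ℂ) • a v with hb
  have hbn : ∀ v, ‖b v‖ ≤ c := fun v => by
    rw [hb, norm_smul, Complex.norm_real, Real.norm_of_nonneg hc0]
    exact mul_le_of_le_one_right hc0 (ha v)
  -- the entries of the shrunken matrices, listed one matrix after the other in row-major order
  set e : ℕ → ℂ := fun t => if h : t / (p * p) < n then
    b ⟨t / (p * p), h⟩ ⟨t % (p * p) / p, Nat.div_lt_of_lt_mul (Nat.mod_lt _ (by positivity))⟩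
      ⟨t % (p * p) % p, Nat.mod_lt _ hp⟩ else 0 with he
  have he1 : ∀ t, ‖e t‖ ≤ 1 := by
    intro t
    simp only [he]
    split_ifs with h
    · exact (norm_apply_le_norm _ _ _).trans ((hbn _).trans hc1)
    · simp
  set pt : List GaussCode := (List.range (n * (p * p))).map fun t => gridRound G (e t) with hpt
  have hent : ∀ (v : Fin n) (i j : Fin p), codedTuple n p pt v i j =
      (gridRound G (b v i j)).val := by
    intro v i j
    have hij : (i : ℕ) * p + j < p * p := by nlinarith [i.2, j.2]
    have hlt : (v : ℕ) * (p * p) + (i * p + j) < n * (p * p) := by nlinarith [v.2]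
    have h₁ : ((v : ℕ) * (p * p) + (i * p + j)) / (p * p) = v := by
      rw [Nat.mul_comm (v : ℕ), Nat.mul_add_div (by positivity), Nat.div_eq_of_lt hij, Nat.add_zero]
    have h₂ : ((v : ℕ) * (p * p) + (i * p + j)) % (p * p) = i * p + j := by
      rw [Nat.mul_comm (v : ℕ), Nat.mul_add_mod, Nat.mod_eq_of_lt hij]
    have h₃ : ((i : ℕ) * p + j) / p = i := by
      rw [Nat.mul_comm (i : ℕ), Nat.mul_add_div hp, Nat.div_eq_of_lt j.2, Nat.add_zero]
    have h₄ : ((i : ℕ) * p + j) % p = j := by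
      rw [Nat.mul_comm (i : ℕ), Nat.mul_add_mod, Nat.mod_eq_of_lt j.2]
    simp only [codedTuple, codedMatrix, codedEntry, Matrix.of_apply]
    rw [hpt, List.getD_eq_getElem _ _ (by simpa using hlt)]
    simp only [List.getElem_map, List.getElem_range, he, h₁, h₂, h₃, h₄, v.2, dif_pos]
  -- rounding moves each of the `p * p` entries by at most `1 / (p * K)`
  have hdiff : ∀ v, ‖b v - codedTuple n p pt v‖ ≤ 1 / K := by
    intro v
    refine abs_le_of_sq_le_sq' ?_ (by positivity) |>.2
    refine (norm_sq_le_sum_sq _).trans ?_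
    have h₁ : ∀ i j, ‖(b v - codedTuple n p pt v) i j‖ ^ 2 ≤ (2 / (G : ℝ)) ^ 2 := by
      intro i j
      rw [Matrix.sub_apply, hent, norm_sub_rev]
      gcongr
      exact norm_gridRound_sub_le hG0 ((norm_apply_le_norm _ _ _).trans ((hbn v).trans hc1))
    refine (Finset.sum_le_sum fun j _ => Finset.sum_le_sum fun i _ => h₁ i j).trans_eq ?_
    simp only [Finset.sum_const, Finset.card_univ, Fintype.card_fin, nsmul_eq_mul, hG]
    push_cast
    field_simp
  refine ⟨pt, List.mem_filter.2 ⟨mem_listsOver.2 ⟨by simp [hpt], ?_⟩, ?_⟩, fun v => ?_⟩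
  · intro z hz
    obtain ⟨t, -, rfl⟩ := List.mem_map.1 hz
    exact gridRound_mem (he1 t)
  · refine (isContractive_iff _ _ _ _).2 fun v => sum_sq_pow_le_one _ (by omega) ?_
    have h₁ := norm_sub_norm_le (codedTuple n p pt v) (b v)
    rw [norm_sub_rev] at h₁
    have h₂ := hdiff v
    have h₃ := hbn v
    have h₄ : 2 / (K : ℝ) = 1 / K + 1 / K := by ring
    linarith
  · have h₁ : ‖a v - b v‖ ≤ 2 / K := by
      have : a v - b v = ((2 / K : ℝ) : ℂ) • a v := by
        rw [hb, hc]
        push_cast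
        rw [sub_smul, one_smul, sub_sub_cancel]
      rw [this, norm_smul, Complex.norm_real, Real.norm_of_nonneg (by positivity)]
      exact mul_le_of_le_one_right (by positivity) (ha v)
    have h₂ := hdiff v
    have h₃ := norm_sub_le_norm_sub_add_norm_sub (a v) (b v) (codedTuple n p pt v)
    have h₄ : 3 / (K : ℝ) = 2 / K + 1 / K := by ring
    linarith

/-! ### Words of Pauli operators -/

/-- The bicharacter `(-1) ^ |A ∩ B|` on finite sets. -/
def pauliChar (A B : Finset ℕ) : ℂ := (-1) ^ (A ∩ B).card

theorem neg_one_pow_card_symmDiff (X Y : Finset ℕ) :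
    (-1 : ℂ) ^ (X ∆ Y).card = (-1) ^ X.card * (-1) ^ Y.card := by
  have h₁ : (X ∆ Y).card = (X \ Y).card + (Y \ X).card := by
    rw [symmDiff_def, Finset.sup_eq_union, Finset.card_union_of_disjoint disjoint_sdiff_sdiff]
  have h₂ := Finset.card_sdiff_add_card_inter X Y
  have h₃ := Finset.card_sdiff_add_card_inter Y X
  rw [h₁, ← h₂, ← h₃, Finset.inter_comm Y X, pow_add, pow_add, pow_add]
  have h₄ : ((-1 : ℂ) ^ (X ∩ Y).card) * (-1) ^ (X ∩ Y).card = 1 := by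
    rw [← mul_pow]
    simp
  linear_combination -((-1 : ℂ) ^ (X \ Y).card * (-1) ^ (Y \ X).card) * h₄

theorem pauliChar_comm (A B : Finset ℕ) : pauliChar A B = pauliChar B A := by
  rw [pauliChar, pauliChar, Finset.inter_comm]

theorem pauliChar_symmDiff_right (A B C : Finset ℕ) :
    pauliChar A (B ∆ C) = pauliChar A B * pauliChar A C := by
  have h : A ∩ (B ∆ C) = (A ∩ B) ∆ (A ∩ C) := inf_symmDiff_distrib_left A B C
  rw [pauliChar, h, neg_one_pow_card_symmDiff]
  rfl

theorem pauliChar_symmDiff_left (A B C : Finset ℕ) :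
    pauliChar (A ∆ B) C = pauliChar A C * pauliChar B C := by
  rw [pauliChar_comm, pauliChar_symmDiff_right, pauliChar_comm C A, pauliChar_comm C B]

@[simp]
theorem pauliChar_mul_self (A B : Finset ℕ) : pauliChar A B * pauliChar A B = 1 := by
  rw [pauliChar, ← mul_pow]
  simp

@[simp]
theorem pauliChar_empty_left (A : Finset ℕ) : pauliChar ∅ A = 1 := by simp [pauliChar]

@[simp]
theorem pauliChar_empty_right (A : Finset ℕ) : pauliChar A ∅ = 1 := by simp [pauliChar]

theorem pauliOperator_apply (g : PauliIndex) (f : TraceSpace) (k : PauliIndex) :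
    pauliOperator g f k = pauliChar g.2 (g.1 ∆ k.1) * f (g.1 ∆ k.1, g.2 ∆ k.2) := rfl

theorem pauliOperator_mul (g h : PauliIndex) :
    pauliOperator g * pauliOperator h =
      pauliChar g.2 h.1 • pauliOperator (g.1 ∆ h.1, g.2 ∆ h.2) := by
  ext f k
  change pauliOperator g (pauliOperator h f) k =
    pauliChar g.2 h.1 * pauliOperator (g.1 ∆ h.1, g.2 ∆ h.2) f k
  simp only [pauliOperator_apply, pauliChar_symmDiff_right, pauliChar_symmDiff_left,
    symmDiff_assoc]
  rw [symmDiff_left_comm h.1 g.1, symmDiff_left_comm h.2 g.2]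
  linear_combination (-(pauliChar g.2 g.1 * pauliChar g.2 k.1 * pauliChar h.2 h.1 *
    pauliChar h.2 g.1 * pauliChar h.2 k.1 * f (g.1 ∆ (h.1 ∆ k.1), g.2 ∆ (h.2 ∆ k.2)))) *
      pauliChar_mul_self g.2 h.1

theorem pauliOperator_empty : pauliOperator (∅, ∅) = 1 := by
  ext f k
  change pauliOperator (∅, ∅) f k = f k
  have h : ∀ A : Finset ℕ, ∅ ∆ A = A := fun A => bot_symmDiff A
  rw [pauliOperator_apply, pauliChar_empty_left, one_mul, h, h]

theorem adjoint_pauliOperator_mul (g : PauliIndex) : star (pauliOperator g) * pauliOperator g = 1 :=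
  (ContinuousLinearMap.norm_map_iff_adjoint_comp_self (pauliOperator g)).1
    (pauliIsometry g).norm_map

theorem star_pauliOperator (g : PauliIndex) :
    star (pauliOperator g) = pauliChar g.2 g.1 • pauliOperator g := by
  have h : pauliOperator g * (pauliChar g.2 g.1 • pauliOperator g) = 1 := by
    rw [mul_smul_comm, pauliOperator_mul, smul_smul, pauliChar_mul_self, one_smul, symmDiff_self,
      symmDiff_self]
    exact pauliOperator_empty
  calc star (pauliOperator g)
      = star (pauliOperator g) * (pauliOperator g * (pauliChar g.2 g.1 • pauliOperator g)) := by
        rw [h, mul_one]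
    _ = pauliChar g.2 g.1 • pauliOperator g := by
        rw [← mul_assoc, adjoint_pauliOperator_mul, one_mul]

theorem pauliOperator_mem (g : PauliIndex) :
    pauliOperator g ∈ hyperfiniteFactor.toStarSubalgebra := by
  refine (StarSubalgebra.mem_centralizer_iff ℂ).2 fun b hb => ?_
  have hb' := (StarSubalgebra.mem_centralizer_iff ℂ).1 hb (pauliOperator g) ⟨g, rfl⟩
  refine ⟨hb'.1.symm, ?_⟩
  have := congrArg star hb'.2
  rw [star_mul, star_mul, star_star] at this
  exact this

/-! ### Right multiplication by words -/

/-- The basis vector with a given index. -/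
def pauliVector (h : PauliIndex) : TraceSpace := lp.single 2 h (1 : ℂ)

theorem pauliVector_apply (h k : PauliIndex) : pauliVector h k = if k = h then 1 else 0 := by
  rw [pauliVector, lp.coeFn_single, Pi.single_apply]

theorem inner_pauliVector_left (h : PauliIndex) (f : TraceSpace) :
    inner ℂ (pauliVector h) f = f h := by
  rw [pauliVector, lp.inner_single_left]
  simp

theorem orthonormal_pauliVector : Orthonormal ℂ pauliVector := by
  rw [orthonormal_iff_ite]
  intro h k
  rw [inner_pauliVector_left, pauliVector_apply]

theorem vacuum_eq : vacuum = pauliVector (∅, ∅) := rfl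

theorem rightPauli_memℓp (h : PauliIndex) (f : TraceSpace) :
    Memℓp (fun k : PauliIndex => pauliChar (h.2 ∆ k.2) h.1 * f (h.shift k)) 2 := by
  have hp : 0 < (2 : ℝ≥0∞).toReal := by norm_num
  have hf := (memℓp_gen_iff hp).1 (lp.memℓp f)
  refine (memℓp_gen_iff hp).2 ?_
  simpa [pauliChar, Function.comp_def] using hf.comp_injective h.shift.injective

/-- Right multiplication by the word with index `h`; the sign is that of the product of the word
with index `h.shift k` and the word with index `h`. -/
def rightPauli (h : PauliIndex) : TraceSpace →ₗᵢ[ℂ] TraceSpace where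
  toFun f := ⟨fun k => pauliChar (h.2 ∆ k.2) h.1 * f (h.shift k), rightPauli_memℓp h f⟩
  map_add' f₁ f₂ := by
    ext k
    change _ * (f₁ + f₂) _ = _ * f₁ _ + _ * f₂ _
    simp [mul_add]
  map_smul' c f := by
    ext k
    change _ * (c • f) _ = c • (_ * f _)
    simp [mul_left_comm]
  norm_map' f := by
    have hp : 0 < (2 : ℝ≥0∞).toReal := by norm_num
    rw [lp.norm_eq_tsum_rpow hp, lp.norm_eq_tsum_rpow hp]
    congr 1
    change ∑' k, ‖pauliChar (h.2 ∆ k.2) h.1 * f (h.shift k)‖ ^ (2 : ℝ≥0∞).toReal = _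
    have : ∀ A B, ‖pauliChar A B‖ = 1 := by simp [pauliChar]
    simp only [norm_mul, this, one_mul]
    exact h.shift.tsum_eq (fun k => ‖f k‖ ^ (2 : ℝ≥0∞).toReal)

theorem rightPauli_apply (h : PauliIndex) (f : TraceSpace) (k : PauliIndex) :
    rightPauli h f k = pauliChar (h.2 ∆ k.2) h.1 * f (h.1 ∆ k.1, h.2 ∆ k.2) := rfl

theorem symmDiff_eq_empty_iff (A B : Finset ℕ) : A ∆ B = ∅ ↔ B = A := by
  rw [← Finset.bot_eq_empty, symmDiff_eq_bot, eq_comm]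

theorem rightPauli_vacuum (h : PauliIndex) : rightPauli h vacuum = pauliVector h := by
  ext k
  rw [rightPauli_apply, vacuum_eq, pauliVector_apply, pauliVector_apply]
  simp only [Prod.ext_iff, symmDiff_eq_empty_iff]
  split_ifs with h₁
  · rw [h₁.2, symmDiff_self]
    simp
  · simp

/-- Left and right multiplications commute. -/
theorem pauliOperator_rightPauli (g h : PauliIndex) (f : TraceSpace) :
    pauliOperator g (rightPauli h f) = rightPauli h (pauliOperator g f) := by
  ext k
  simp only [pauliOperator_apply, rightPauli_apply, pauliChar_symmDiff_right,
    pauliChar_symmDiff_left]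
  rw [symmDiff_left_comm h.1 g.1, symmDiff_left_comm h.2 g.2]
  ring

/-- The elements of the hyperfinite factor commute with right multiplications. -/
theorem hyperfinite_rightPauli (a : HyperfiniteR) (h : PauliIndex) (f : TraceSpace) :
    (a : TraceSpace →L[ℂ] TraceSpace) (rightPauli h f) =
      rightPauli h ((a : TraceSpace →L[ℂ] TraceSpace) f) := by
  have hR : (rightPauli h).toContinuousLinearMap ∈ (StarSubalgebra.centralizer ℂ
      (Set.range pauliOperator) : Set (TraceSpace →L[ℂ] TraceSpace)) := by
    refine (StarSubalgebra.mem_centralizer_iff ℂ).2 ?_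
    rintro _ ⟨g, rfl⟩
    have h₁ : pauliOperator g * (rightPauli h).toContinuousLinearMap =
        (rightPauli h).toContinuousLinearMap * pauliOperator g :=
      ContinuousLinearMap.ext fun f => pauliOperator_rightPauli g h f
    refine ⟨h₁, ?_⟩
    rw [star_pauliOperator, smul_mul_assoc, mul_smul_comm, h₁]
  have := ((StarSubalgebra.mem_centralizer_iff ℂ).1 a.2 _ hR).1
  exact (DFunLike.congr_fun this f).symm

/-! ### Compression to finitely many words -/

section Compression

/-- The indices of the words in the first `N` positions. -/
def levelIndex (N : ℕ) : Finset PauliIndex :=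
  (Finset.range N).powerset ×ˢ (Finset.range N).powerset

theorem mem_levelIndex {N : ℕ} {h : PauliIndex} :
    h ∈ levelIndex N ↔ h.1 ⊆ Finset.range N ∧ h.2 ⊆ Finset.range N := by
  simp [levelIndex]

theorem symmDiff_subset_iff {A B C : Finset ℕ} (hA : A ⊆ C) : A ∆ B ⊆ C ↔ B ⊆ C := by
  have key : ∀ {D : Finset ℕ}, D ⊆ C → A ∆ D ⊆ C := fun hD =>
    (symmDiff_le_sup (a := A)).trans (sup_le hA hD)
  exact ⟨fun h => by simpa using key h, key⟩

theorem symmDiff_mem_levelIndex {N : ℕ} {h : PauliIndex} (hh : h ∈ levelIndex N) (k : PauliIndex) :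
    (h.1 ∆ k.1, h.2 ∆ k.2) ∈ levelIndex N ↔ k ∈ levelIndex N := by
  rw [mem_levelIndex] at hh
  rw [mem_levelIndex, mem_levelIndex, symmDiff_subset_iff hh.1, symmDiff_subset_iff hh.2]

/-- The number of words in the first `N` positions. -/
def levelDim (N : ℕ) : ℕ := (levelIndex N).card

theorem levelDim_pos (N : ℕ) : 0 < levelDim N :=
  Finset.card_pos.2 ⟨(∅, ∅), mem_levelIndex.2 (by simp)⟩

/-- An enumeration of the words in the first `N` positions. -/
def levelEnum (N : ℕ) : Fin (levelDim N) ≃ levelIndex N := (levelIndex N).equivFin.symm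

theorem orthonormal_levelEnum (N : ℕ) :
    Orthonormal ℂ fun i => pauliVector (levelEnum N i : PauliIndex) :=
  orthonormal_pauliVector.comp _ (Subtype.val_injective.comp (levelEnum N).injective)

/-- The inclusion of the span of the words in the first `N` positions. -/
def levelIncl (N : ℕ) : EuclideanSpace ℂ (Fin (levelDim N)) →L[ℂ] TraceSpace :=
  (LinearMap.isometryOfOrthonormal
    ((EuclideanSpace.basisFun (Fin (levelDim N)) ℂ).toBasis.constr ℂ
      fun i => pauliVector (levelEnum N i : PauliIndex))
    (v := (EuclideanSpace.basisFun (Fin (levelDim N)) ℂ).toBasis)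
    (by simp)
    (by
      convert orthonormal_levelEnum N using 1
      ext i : 1
      exact Module.Basis.constr_basis _ _ _ i)).toContinuousLinearMap

theorem levelIncl_single (N : ℕ) (i : Fin (levelDim N)) :
    levelIncl N (EuclideanSpace.single i 1) = pauliVector (levelEnum N i : PauliIndex) := by
  have h := Module.Basis.constr_basis (EuclideanSpace.basisFun (Fin (levelDim N)) ℂ).toBasis ℂ
      (fun i => pauliVector (levelEnum N i : PauliIndex)) i
  rw [OrthonormalBasis.coe_toBasis, EuclideanSpace.basisFun_apply] at h
  exact h

theorem norm_levelIncl_apply (N : ℕ) (x : EuclideanSpace ℂ (Fin (levelDim N))) :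
    ‖levelIncl N x‖ = ‖x‖ := LinearIsometry.norm_map _ x

theorem adjoint_levelIncl_comp (N : ℕ) :
    (ContinuousLinearMap.adjoint (levelIncl N)).comp (levelIncl N) = 1 :=
  (ContinuousLinearMap.norm_map_iff_adjoint_comp_self (levelIncl N)).1 (norm_levelIncl_apply N)

theorem norm_levelIncl_le (N : ℕ) : ‖levelIncl N‖ ≤ 1 :=
  LinearIsometry.norm_toContinuousLinearMap_le _

/-- The orthogonal projection onto the span of the words in the first `N` positions. -/
def levelProj (N : ℕ) : TraceSpace →L[ℂ] TraceSpace :=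
  (levelIncl N).comp (ContinuousLinearMap.adjoint (levelIncl N))

theorem levelProj_apply (N : ℕ) (f : TraceSpace) (k : PauliIndex) :
    levelProj N f k = if k ∈ levelIndex N then f k else 0 := by
  rw [← inner_pauliVector_left k (levelProj N f), levelProj, ContinuousLinearMap.comp_apply,
    ← ContinuousLinearMap.adjoint_inner_left]
  split_ifs with hk
  · have h₁ : ContinuousLinearMap.adjoint (levelIncl N) (pauliVector k) =
        EuclideanSpace.single ((levelEnum N).symm ⟨k, hk⟩) 1 := by
      have h₂ := levelIncl_single N ((levelEnum N).symm ⟨k, hk⟩)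
      rw [Equiv.apply_symm_apply] at h₂
      rw [← h₂]
      exact DFunLike.congr_fun (adjoint_levelIncl_comp N) _
    rw [h₁, ContinuousLinearMap.adjoint_inner_right, levelIncl_single, Equiv.apply_symm_apply,
      inner_pauliVector_left]
  · have h₁ : ContinuousLinearMap.adjoint (levelIncl N) (pauliVector k) = 0 := by
      ext i
      have h₂ : inner ℂ (EuclideanSpace.single i (1 : ℂ))
          (ContinuousLinearMap.adjoint (levelIncl N) (pauliVector k)) = 0 := by
        rw [ContinuousLinearMap.adjoint_inner_right, levelIncl_single, inner_pauliVector_left,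
          pauliVector_apply, if_neg]
        rintro rfl
        exact hk (levelEnum N i).2
      rwa [EuclideanSpace.inner_single_left, map_one, one_mul] at h₂
    rw [h₁, inner_zero_left]

theorem norm_levelProj_apply_le (N : ℕ) (f : TraceSpace) : ‖levelProj N f‖ ≤ ‖f‖ := by
  rw [levelProj, ContinuousLinearMap.comp_apply, norm_levelIncl_apply]
  refine (ContinuousLinearMap.le_opNorm _ _).trans ?_
  rw [LinearIsometryEquiv.norm_map]
  exact mul_le_of_le_one_left (norm_nonneg _) (norm_levelIncl_le N)

theorem star_levelProj (N : ℕ) : star (levelProj N) = levelProj N := by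
  rw [ContinuousLinearMap.star_eq_adjoint, levelProj, ContinuousLinearMap.adjoint_comp,
    ContinuousLinearMap.adjoint_adjoint]

theorem levelProj_rightPauli {N : ℕ} {h : PauliIndex} (hh : h ∈ levelIndex N) (f : TraceSpace) :
    levelProj N (rightPauli h f) = rightPauli h (levelProj N f) := by
  ext k
  rw [levelProj_apply, rightPauli_apply, rightPauli_apply, levelProj_apply]
  simp only [symmDiff_mem_levelIndex hh]
  split_ifs <;> simp

/-- The projections converge strongly to `1`. -/
theorem tendsto_levelProj {f : ℕ → TraceSpace} {g : TraceSpace}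
    (hf : Filter.Tendsto f Filter.atTop (nhds g)) :
    Filter.Tendsto (fun N => levelProj N (f N)) Filter.atTop (nhds g) := by
  have h₁ : Filter.Tendsto levelIndex Filter.atTop Filter.atTop := by
    refine Filter.tendsto_atTop_finset_of_monotone ?_ fun h => ?_
    · intro M N hMN k hk
      rw [mem_levelIndex] at hk ⊢
      have := Finset.range_subset_range.2 hMN
      exact ⟨hk.1.trans this, hk.2.trans this⟩
    · obtain ⟨N₁, h₁⟩ := h.1.exists_nat_subset_range
      obtain ⟨N₂, h₂⟩ := h.2.exists_nat_subset_range
      exact ⟨max N₁ N₂, mem_levelIndex.2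
        ⟨h₁.trans (Finset.range_subset_range.2 (le_max_left _ _)),
          h₂.trans (Finset.range_subset_range.2 (le_max_right _ _))⟩⟩
  have h₂ : Filter.Tendsto (fun N => levelProj N g) Filter.atTop (nhds g) := by
    have := (lp.hasSum_single ENNReal.ofNat_ne_top g).comp h₁
    refine this.congr fun N => ?_
    ext k
    rw [levelProj_apply, Function.comp_apply, lp.coeFn_sum, Finset.sum_apply]
    simp only [lp.coeFn_single, Pi.single_apply]
    rw [Finset.sum_ite_eq]
  rw [tendsto_iff_norm_sub_tendsto_zero] at hf h₂ ⊢
  refine squeeze_zero (fun _ => norm_nonneg _) (fun N => ?_) (by simpa using hf.add h₂)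
  calc ‖levelProj N (f N) - g‖ = ‖levelProj N (f N - g) + (levelProj N g - g)‖ := by
        rw [map_sub]
        congr 1
        abel
    _ ≤ ‖f N - g‖ + ‖levelProj N g - g‖ :=
        (norm_add_le _ _).trans (add_le_add (norm_levelProj_apply_le _ _) le_rfl)

/-- The compression of an operator to the span of the words in the first `N` positions. -/
def compress (N : ℕ) (a : TraceSpace →L[ℂ] TraceSpace) :
    EuclideanSpace ℂ (Fin (levelDim N)) →L[ℂ] EuclideanSpace ℂ (Fin (levelDim N)) :=
  ((ContinuousLinearMap.adjoint (levelIncl N)).comp a).comp (levelIncl N)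

theorem star_compress (N : ℕ) (a : TraceSpace →L[ℂ] TraceSpace) :
    star (compress N a) = compress N (star a) := by
  simp only [compress, ContinuousLinearMap.star_eq_adjoint, ContinuousLinearMap.adjoint_comp,
    ContinuousLinearMap.adjoint_adjoint, ContinuousLinearMap.comp_assoc]

theorem norm_compress_le (N : ℕ) (a : TraceSpace →L[ℂ] TraceSpace) : ‖compress N a‖ ≤ ‖a‖ := by
  have h₁ : ‖ContinuousLinearMap.adjoint (levelIncl N)‖ ≤ 1 := by
    rw [LinearIsometryEquiv.norm_map]
    exact norm_levelIncl_le N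
  refine (ContinuousLinearMap.opNorm_comp_le _ _).trans ?_
  refine (mul_le_of_le_one_right (norm_nonneg _) (norm_levelIncl_le N)).trans ?_
  exact (ContinuousLinearMap.opNorm_comp_le _ _).trans (mul_le_of_le_one_left (norm_nonneg _) h₁)

/-- Words in the compressions are words in the operators `P a P`, for the projection `P`. -/
theorem wordEval_compress {n : ℕ} (N : ℕ) (x : Fin n → TraceSpace →L[ℂ] TraceSpace)
    (w : List (Fin n × Bool)) (v : EuclideanSpace ℂ (Fin (levelDim N))) :
    levelIncl N (wordEval (fun i => compress N (x i)) w v) =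
      wordEval (fun i => levelProj N * x i * levelProj N) w (levelIncl N v) := by
  induction w with
  | nil => simp
  | cons a w ih =>
    have hP : ∀ b : TraceSpace →L[ℂ] TraceSpace, ∀ y,
        levelIncl N (compress N b y) = (levelProj N * b * levelProj N) (levelIncl N y) := by
      intro b y
      have h := DFunLike.congr_fun (adjoint_levelIncl_comp N) y
      simp only [ContinuousLinearMap.comp_apply, one_apply_eq_self] at h
      simp only [compress, levelProj, mul_apply_eq_comp, ContinuousLinearMap.comp_apply,
        h]
    rw [wordEval_cons, wordEval_cons, mul_apply_eq_comp, mul_apply_eq_comp,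
      ← ih]
    cases a.2
    · exact hP _ _
    · simp only [if_true, star_compress, star_mul, star_levelProj, mul_assoc, hP]

theorem wordEval_rightPauli {n : ℕ} {N : ℕ} {h : PauliIndex} (hh : h ∈ levelIndex N)
    (x : Fin n → HyperfiniteR) (w : List (Fin n × Bool)) (f : TraceSpace) :
    wordEval (fun i => levelProj N * (x i : TraceSpace →L[ℂ] TraceSpace) * levelProj N) w
        (rightPauli h f) =
      rightPauli h (wordEval
        (fun i => levelProj N * (x i : TraceSpace →L[ℂ] TraceSpace) * levelProj N) w f) := by
  induction w generalizing f with
  | nil => simp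
  | cons a w ih =>
    rw [wordEval_cons, mul_apply_eq_comp, mul_apply_eq_comp, ih]
    have hP : ∀ (b : HyperfiniteR) (f : TraceSpace),
        (levelProj N * (b : TraceSpace →L[ℂ] TraceSpace) * levelProj N) (rightPauli h f) =
          rightPauli h ((levelProj N * (b : TraceSpace →L[ℂ] TraceSpace) * levelProj N) f) := by
      intro b f
      simp only [mul_apply_eq_comp, levelProj_rightPauli hh, hyperfinite_rightPauli]
    cases a.2
    · exact hP _ _
    · simpa only [if_true, star_mul, star_levelProj, mul_assoc, StarMemClass.coe_star] using
        hP (star (x a.1)) _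

theorem tendsto_wordEval {n : ℕ} (x : Fin n → TraceSpace →L[ℂ] TraceSpace)
    (w : List (Fin n × Bool)) (f : TraceSpace) :
    Filter.Tendsto (fun N => wordEval (fun i => levelProj N * x i * levelProj N) w f)
      Filter.atTop (nhds (wordEval x w f)) := by
  induction w with
  | nil => simp
  | cons a w ih =>
    simp only [wordEval_cons, mul_apply_eq_comp]
    have hP : ∀ b : TraceSpace →L[ℂ] TraceSpace, Filter.Tendsto
        (fun N => (levelProj N * b * levelProj N)
          (wordEval (fun i => levelProj N * x i * levelProj N) w f))
        Filter.atTop (nhds (b (wordEval x w f))) := fun b =>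
      tendsto_levelProj ((b.continuous.tendsto _).comp (tendsto_levelProj ih))
    cases a.2
    · exact hP _
    · simpa only [if_true, star_mul, star_levelProj, mul_assoc] using hP (star (x a.1))

/-- Unital *-homomorphisms commute with the evaluation of words. -/
theorem map_wordEval {n : ℕ} {A B : Type*} [Monoid A] [Star A] [Monoid B] [Star B] (φ : A → B)
    (h₁ : φ 1 = 1) (hmul : ∀ a b, φ (a * b) = φ a * φ b) (hstar : ∀ a, φ (star a) = star (φ a))
    (x : Fin n → A) (w : List (Fin n × Bool)) :
    φ (wordEval x w) = wordEval (fun i => φ (x i)) w := by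
  induction w with
  | nil => simpa using h₁
  | cons a w ih =>
    rw [wordEval_cons, wordEval_cons, hmul, ih]
    cases a.2 <;> simp [hstar]

theorem coe_wordEval {n : ℕ} (x : Fin n → HyperfiniteR) (w : List (Fin n × Bool)) :
    ((wordEval x w : HyperfiniteR) : TraceSpace →L[ℂ] TraceSpace) =
      wordEval (fun i => (x i : TraceSpace →L[ℂ] TraceSpace)) w :=
  map_wordEval (fun a : HyperfiniteR => (a : TraceSpace →L[ℂ] TraceSpace)) rfl (fun _ _ => rfl)
    (fun _ => rfl) x w

theorem normalizedTrace_symm {p : ℕ} (T : EuclideanSpace ℂ (Fin p) →L[ℂ] EuclideanSpace ℂ (Fin p)) :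
    normalizedTrace ((Matrix.toEuclideanCLM (n := Fin p) (𝕜 := ℂ)).symm T) =
      (∑ i, inner ℂ (EuclideanSpace.single i (1 : ℂ)) (T (EuclideanSpace.single i 1))) / p := by
  obtain ⟨A, rfl⟩ : ∃ A, Matrix.toEuclideanCLM (n := Fin p) (𝕜 := ℂ) A = T :=
    ⟨_, StarAlgEquiv.apply_symm_apply _ T⟩
  rw [StarAlgEquiv.symm_apply_apply, normalizedTrace, Matrix.trace]
  congr 1
  refine Finset.sum_congr rfl fun i _ => ?_
  rw [EuclideanSpace.inner_single_left, Matrix.ofLp_toEuclideanCLM]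
  simp

/-- Every tuple of contractions in the hyperfinite factor is the limit in moments of tuples of
contractive matrices: its compressions to the words in finitely many positions.  The normalized
trace of a word in the compressions is a vector state at the vacuum because right multiplications
permute the basis. -/
theorem exists_matrix_tendsto {n : ℕ} (x : Fin n → HyperfiniteR) (hx : ∀ i, ‖x i‖ ≤ 1) :
    ∃ a : (N : ℕ) → Fin n → Matrix (Fin (levelDim N)) (Fin (levelDim N)) ℂ,
      (∀ N i, ‖Matrix.toEuclideanCLM (n := Fin (levelDim N)) (𝕜 := ℂ) (a N i)‖ ≤ 1) ∧
      ∀ w, Filter.Tendsto (fun N => normalizedTrace (wordEval (a N) w)) Filter.atTop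
        (nhds (traceR (wordEval x w))) := by
  refine ⟨fun N i => (Matrix.toEuclideanCLM (n := Fin (levelDim N)) (𝕜 := ℂ)).symm
    (compress N (x i : TraceSpace →L[ℂ] TraceSpace)), fun N i => ?_, fun w => ?_⟩
  · rw [StarAlgEquiv.apply_symm_apply]
    exact (norm_compress_le N _).trans (hx i)
  · have key : ∀ N, normalizedTrace (wordEval (fun i =>
        (Matrix.toEuclideanCLM (n := Fin (levelDim N)) (𝕜 := ℂ)).symm
          (compress N (x i : TraceSpace →L[ℂ] TraceSpace))) w) =
        inner ℂ vacuum (wordEval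
          (fun i => levelProj N * (x i : TraceSpace →L[ℂ] TraceSpace) * levelProj N) w vacuum) := by
      intro N
      have h₀ : (levelDim N : ℂ) ≠ 0 := by exact_mod_cast (levelDim_pos N).ne'
      rw [← map_wordEval (Matrix.toEuclideanCLM (n := Fin (levelDim N)) (𝕜 := ℂ)).symm
        (map_one _) (map_mul _) (StarRingEquivClass.map_star _), normalizedTrace_symm,
        div_eq_iff h₀]
      -- all diagonal entries agree: right multiplications move the vacuum to any basis vector
      have h₁ : ∀ i : Fin (levelDim N), inner ℂ (EuclideanSpace.single i (1 : ℂ))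
          (wordEval (fun i => compress N (x i : TraceSpace →L[ℂ] TraceSpace)) w
            (EuclideanSpace.single i 1)) =
          inner ℂ vacuum (wordEval (fun i =>
            levelProj N * (x i : TraceSpace →L[ℂ] TraceSpace) * levelProj N) w vacuum) := by
        intro i
        have h₂ : ∀ y z, inner ℂ (levelIncl N y) (levelIncl N z) = inner ℂ y z :=
          fun y z => LinearIsometry.inner_map_map _ y z
        rw [← h₂, wordEval_compress, levelIncl_single, ← rightPauli_vacuum,
          wordEval_rightPauli (levelEnum N i).2, LinearIsometry.inner_map_map]
      simp only [h₁, Finset.sum_const, Finset.card_univ, Fintype.card_fin, nsmul_eq_mul]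
      ring
    simp only [key]
    rw [traceR, coe_wordEval]
    exact Filter.Tendsto.inner tendsto_const_nhds (tendsto_wordEval _ _ _)

end Compression

/-! ### Matrix units in the hyperfinite factor -/

/-- The operator `X_S`. -/
def pauliX (S : Finset ℕ) : TraceSpace →L[ℂ] TraceSpace := pauliOperator (S, ∅)

/-- The projection `2⁻ᴺ ∑_T (-1) ^ |T ∩ C| Z_T`, over the sets `T` of positions below `N`, onto the
joint eigenspace of the operators `Z_T` with eigenvalues `(-1) ^ |T ∩ C|`. -/
def pauliProj (N : ℕ) (C : Finset ℕ) : TraceSpace →L[ℂ] TraceSpace :=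
  ((2 : ℂ) ^ N)⁻¹ • ∑ T ∈ (Finset.range N).powerset, pauliChar T C • pauliOperator (∅, T)

theorem pauliX_mul (S T : Finset ℕ) : pauliX S * pauliX T = pauliX (S ∆ T) := by
  rw [pauliX, pauliX, pauliOperator_mul, pauliChar_empty_left, one_smul, symmDiff_self]
  rfl

theorem star_pauliX (S : Finset ℕ) : star (pauliX S) = pauliX S := by
  rw [pauliX, star_pauliOperator, pauliChar_empty_left, one_smul]

theorem star_pauliProj (N : ℕ) (C : Finset ℕ) : star (pauliProj N C) = pauliProj N C := by
  rw [pauliProj, star_smul, star_sum]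
  congr 1
  · simp
  · refine Finset.sum_congr rfl fun T _ => ?_
    rw [star_smul, star_pauliOperator, pauliChar_empty_right, one_smul]
    congr 1
    simp [pauliChar]

theorem pauliProj_mul_pauliX (N : ℕ) (C S : Finset ℕ) :
    pauliProj N C * pauliX S = pauliX S * pauliProj N (C ∆ S) := by
  rw [pauliProj, pauliProj, smul_mul_assoc, mul_smul_comm, Finset.sum_mul, Finset.mul_sum]
  congr 1
  refine Finset.sum_congr rfl fun T _ => ?_
  have h : ∀ A : Finset ℕ, ∅ ∆ A = A := fun A => bot_symmDiff A
  have h' : ∀ A : Finset ℕ, A ∆ ∅ = A := fun A => symmDiff_bot A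
  rw [smul_mul_assoc, mul_smul_comm, pauliX, pauliOperator_mul, pauliOperator_mul, smul_smul,
    smul_smul, pauliChar_symmDiff_right]
  simp only [h, h', pauliChar_empty_left, mul_one]

theorem pauliZ_mul_pauliProj {N : ℕ} {T : Finset ℕ} (hT : T ⊆ Finset.range N) (C : Finset ℕ) :
    pauliOperator (∅, T) * pauliProj N C = pauliChar T C • pauliProj N C := by
  rw [pauliProj, mul_smul_comm, smul_comm, Finset.mul_sum]
  congr 1
  rw [Finset.smul_sum]
  refine Finset.sum_bij (fun A _ => T ∆ A) (fun A hA => ?_) (fun A _ B _ h => ?_)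
    (fun B hB => ?_) (fun A _ => ?_)
  · rw [Finset.mem_powerset] at hA ⊢
    exact (symmDiff_subset_iff hT).2 hA
  · exact symmDiff_right_injective T h
  · rw [Finset.mem_powerset] at hB
    exact ⟨T ∆ B, Finset.mem_powerset.2 ((symmDiff_subset_iff hT).2 hB), by simp⟩
  · rw [mul_smul_comm, pauliOperator_mul, pauliChar_empty_right, one_smul, smul_smul,
      pauliChar_symmDiff_left, ← mul_assoc, pauliChar_mul_self, one_mul, symmDiff_self]
    rfl

/-- The characters `T ↦ (-1) ^ |T ∩ U|` are orthogonal. -/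
theorem sum_pauliChar {N : ℕ} {U : Finset ℕ} (hU : U ⊆ Finset.range N) :
    ∑ T ∈ (Finset.range N).powerset, pauliChar T U = if U = ∅ then (2 : ℂ) ^ N else 0 := by
  split_ifs with h
  · subst h
    simp
  · obtain ⟨a, ha⟩ := Finset.nonempty_iff_ne_empty.2 h
    have hs : ({a} : Finset ℕ) ⊆ Finset.range N := Finset.singleton_subset_iff.2 (hU ha)
    refine Finset.sum_involution (fun T _ => {a} ∆ T) (fun T _ => ?_) (fun T _ h₁ h₂ => ?_)
      (fun T hT => ?_) (fun T _ => ?_)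
    · have : pauliChar {a} U = -1 := by simp [pauliChar, ha]
      rw [pauliChar_symmDiff_left, this]
      ring
    · have h₃ : ({a} : Finset ℕ) = ⊥ := symmDiff_eq_right.1 h₂
      exact Finset.singleton_ne_empty a h₃
    · rw [Finset.mem_powerset] at hT ⊢
      exact (symmDiff_subset_iff hs).2 hT
    · simp

theorem pauliProj_mul_pauliProj {N : ℕ} {C D : Finset ℕ} (hC : C ⊆ Finset.range N)
    (hD : D ⊆ Finset.range N) :
    pauliProj N C * pauliProj N D = if C = D then pauliProj N D else 0 := by
  have h₁ : pauliProj N C * pauliProj N D = ((2 : ℂ) ^ N)⁻¹ •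
      (∑ T ∈ (Finset.range N).powerset, pauliChar T (C ∆ D)) • pauliProj N D := by
    rw [pauliProj, smul_mul_assoc, Finset.sum_mul, Finset.sum_smul]
    congr 1
    refine Finset.sum_congr rfl fun T hT => ?_
    rw [smul_mul_assoc, pauliZ_mul_pauliProj (Finset.mem_powerset.1 hT), smul_smul,
      pauliChar_symmDiff_right]
  rw [h₁, sum_pauliChar ((symmDiff_subset_iff hC).2 hD)]
  simp only [symmDiff_eq_empty_iff, eq_comm (a := D)]
  split_ifs with h
  · rw [smul_smul, inv_mul_cancel₀ (pow_ne_zero _ two_ne_zero), one_smul]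
  · simp

/-- The matrix unit with index `(B, C)` of the tensor product of the first `N` copies of
`M₂(ℂ)`. -/
def matrixUnit (N : ℕ) (B C : Finset ℕ) : TraceSpace →L[ℂ] TraceSpace :=
  pauliX (B ∆ C) * pauliProj N C

theorem matrixUnit_mul {N : ℕ} {B C D F : Finset ℕ} (hC : C ⊆ Finset.range N)
    (hD : D ⊆ Finset.range N) (hF : F ⊆ Finset.range N) :
    matrixUnit N B C * matrixUnit N D F = if C = D then matrixUnit N B F else 0 := by
  have h₁ : matrixUnit N B C * matrixUnit N D F =
      pauliX (B ∆ C) * (pauliProj N C * pauliX (D ∆ F)) * pauliProj N F := by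
    simp only [matrixUnit, mul_assoc]
  have h₂ : C ∆ (D ∆ F) = F ↔ C = D := by
    rw [← symmDiff_assoc, symmDiff_eq_right, symmDiff_eq_bot]
  rw [h₁, pauliProj_mul_pauliX, mul_assoc, mul_assoc, pauliProj_mul_pauliProj
    ((symmDiff_subset_iff hC).2 ((symmDiff_subset_iff hD).2 hF)) hF, ← mul_assoc, pauliX_mul]
  simp only [h₂]
  split_ifs with h
  · subst h
    rw [symmDiff_assoc, symmDiff_symmDiff_cancel_left]
    rfl
  · simp

theorem star_matrixUnit (N : ℕ) (B C : Finset ℕ) :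
    star (matrixUnit N B C) = matrixUnit N C B := by
  rw [matrixUnit, star_mul, star_pauliX, star_pauliProj, pauliProj_mul_pauliX, matrixUnit,
    symmDiff_comm B C, symmDiff_symmDiff_cancel_left]

theorem matrixUnit_mem (N : ℕ) (B C : Finset ℕ) :
    matrixUnit N B C ∈ hyperfiniteFactor.toStarSubalgebra := by
  refine mul_mem (pauliOperator_mem _) ?_
  refine SMulMemClass.smul_mem _ (sum_mem fun T _ => ?_)
  exact SMulMemClass.smul_mem _ (pauliOperator_mem _)

theorem pauliOperator_vacuum (g : PauliIndex) : pauliOperator g vacuum = pauliVector g := by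
  ext k
  rw [pauliOperator_apply, vacuum_eq, pauliVector_apply, pauliVector_apply]
  simp only [Prod.ext_iff, symmDiff_eq_empty_iff]
  split_ifs with h₁
  · rw [h₁.1, symmDiff_self]
    simp
  · simp

theorem inner_vacuum_matrixUnit (N : ℕ) (B C : Finset ℕ) :
    inner ℂ vacuum (matrixUnit N B C vacuum) = if B = C then ((2 : ℂ) ^ N)⁻¹ else 0 := by
  have h' : ∀ A : Finset ℕ, A ∆ ∅ = A := fun A => symmDiff_bot A
  have h'' : ∀ A : Finset ℕ, ∅ ∆ A = A := fun A => bot_symmDiff A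
  have h₁ : matrixUnit N B C = ((2 : ℂ) ^ N)⁻¹ •
      ∑ T ∈ (Finset.range N).powerset, pauliChar T C • pauliOperator (B ∆ C, T) := by
    rw [matrixUnit, pauliProj, mul_smul_comm, Finset.mul_sum]
    congr 1
    refine Finset.sum_congr rfl fun T _ => ?_
    rw [mul_smul_comm, pauliX, pauliOperator_mul, pauliChar_empty_left, one_smul]
    simp only [h', h'']
  rw [h₁, vacuum_eq, inner_pauliVector_left, ← vacuum_eq, smul_apply,
    sum_apply, lp.coeFn_smul, Pi.smul_apply, lp.coeFn_sum, Finset.sum_apply]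
  simp only [smul_apply, pauliOperator_vacuum, lp.coeFn_smul, Pi.smul_apply,
    pauliVector_apply, Prod.mk.injEq, smul_eq_mul]
  have h₂ : (∅ = B ∆ C) ↔ B = C := by
    rw [eq_comm, symmDiff_eq_empty_iff, eq_comm]
  simp only [h₂]
  split_ifs with h
  · simp [h]
  · simp [h]

theorem sum_matrixUnit_mul_sum_matrixUnit {ι : Type*} [Fintype ι] [DecidableEq ι] {N : ℕ}
    {f : ι → Finset ℕ} (hf : Function.Injective f) (hfN : ∀ i, f i ⊆ Finset.range N)
    (A B : Matrix ι ι ℂ) :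
    (∑ i, ∑ j, A i j • matrixUnit N (f i) (f j)) * ∑ i, ∑ j, B i j • matrixUnit N (f i) (f j) =
      ∑ i, ∑ j, (A * B) i j • matrixUnit N (f i) (f j) := by
  rw [Finset.sum_mul]
  refine Finset.sum_congr rfl fun i _ => ?_
  have h : ∀ j, A i j • matrixUnit N (f i) (f j) * ∑ k, ∑ l, B k l • matrixUnit N (f k) (f l) =
      ∑ l, (A i j * B j l) • matrixUnit N (f i) (f l) := by
    intro j
    rw [Finset.mul_sum, Finset.sum_eq_single j, Finset.mul_sum]
    · refine Finset.sum_congr rfl fun l _ => ?_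
      rw [smul_mul_smul_comm, matrixUnit_mul (hfN _) (hfN _) (hfN _), if_pos rfl]
    · intro k _ hk
      rw [Finset.mul_sum]
      refine Finset.sum_eq_zero fun l _ => ?_
      rw [smul_mul_smul_comm, matrixUnit_mul (hfN _) (hfN _) (hfN _),
        if_neg fun h => hk (hf h).symm, smul_zero]
    · simp
  rw [Finset.sum_mul, Finset.sum_congr rfl fun j _ => h j, Finset.sum_comm]
  simp only [Matrix.mul_apply, Finset.sum_smul]

open scoped Matrix.Norms.L2Operator in
/-- The representation of `M_p(ℂ)` on `q` blocks of matrix units, as a non-unital *-homomorphism;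
the blocks and their rows are labelled by `f`. -/
def blockHom {N q p : ℕ} (f : Fin p × Fin q → Finset ℕ) (hf : Function.Injective f)
    (hfN : ∀ i, f i ⊆ Finset.range N) :
    Matrix (Fin p) (Fin p) ℂ →⋆ₙₐ[ℂ] (TraceSpace →L[ℂ] TraceSpace) where
  toFun M := ∑ i, ∑ j, Matrix.blockDiagonal (fun _ : Fin q => M) i j • matrixUnit N (f i) (f j)
  map_smul' c M := by
    have : Matrix.blockDiagonal (fun _ : Fin q => c • M) =
        c • Matrix.blockDiagonal (fun _ : Fin q => M) := Matrix.blockDiagonal_smul c fun _ => M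
    simp only [this, Matrix.smul_apply, smul_assoc, Finset.smul_sum, MonoidHom.id_apply]
  map_zero' := by
    have : Matrix.blockDiagonal (fun _ : Fin q => (0 : Matrix (Fin p) (Fin p) ℂ)) = 0 :=
      Matrix.blockDiagonal_zero
    simp [this]
  map_add' M M' := by
    have : Matrix.blockDiagonal (fun _ : Fin q => M + M') =
        Matrix.blockDiagonal (fun _ : Fin q => M) + Matrix.blockDiagonal (fun _ : Fin q => M') :=
      Matrix.blockDiagonal_add (fun _ => M) fun _ => M'
    simp only [this, Matrix.add_apply, add_smul, Finset.sum_add_distrib]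
  map_mul' M M' := by
    have : Matrix.blockDiagonal (fun _ : Fin q => M * M') =
        Matrix.blockDiagonal (fun _ : Fin q => M) * Matrix.blockDiagonal (fun _ : Fin q => M') :=
      Matrix.blockDiagonal_mul (fun _ => M) fun _ => M'
    rw [this]
    exact (sum_matrixUnit_mul_sum_matrixUnit hf hfN _ _).symm
  map_star' M := by
    have : Matrix.blockDiagonal (fun _ : Fin q => star M) =
        star (Matrix.blockDiagonal (fun _ : Fin q => M)) :=
      (Matrix.blockDiagonal_conjTranspose fun _ => M).symm
    simp only [this, Matrix.star_apply, star_sum, star_smul, star_matrixUnit]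
    exact Finset.sum_comm

theorem blockHom_mem {N q p : ℕ} (f : Fin p × Fin q → Finset ℕ) (hf : Function.Injective f)
    (hfN : ∀ i, f i ⊆ Finset.range N) (M : Matrix (Fin p) (Fin p) ℂ) :
    blockHom f hf hfN M ∈ hyperfiniteFactor.toStarSubalgebra :=
  sum_mem fun _ _ => sum_mem fun _ _ => SMulMemClass.smul_mem _ (matrixUnit_mem _ _ _)

theorem inner_vacuum_blockHom {N q p : ℕ} (f : Fin p × Fin q → Finset ℕ)
    (hf : Function.Injective f) (hfN : ∀ i, f i ⊆ Finset.range N)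
    (M : Matrix (Fin p) (Fin p) ℂ) :
    inner ℂ vacuum (blockHom f hf hfN M vacuum) =
      ((q * p : ℕ) / 2 ^ N : ℂ) * normalizedTrace M := by
  have h₁ : blockHom f hf hfN M = ∑ i, ∑ j,
    Matrix.blockDiagonal (fun _ : Fin q => M) i j • matrixUnit N (f i) (f j) := rfl
  rw [h₁]
  simp only [sum_apply, inner_sum, smul_apply,
    inner_smul_right, inner_vacuum_matrixUnit, hf.eq_iff]
  simp only [mul_ite, mul_zero, Finset.sum_ite_eq, Finset.mem_univ, if_true]
  rw [← Finset.sum_mul]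
  have h₂ : ∑ i, Matrix.blockDiagonal (fun _ : Fin q => M) i i = q * M.trace := by
    have := Matrix.trace_blockDiagonal fun _ : Fin q => M
    rw [Matrix.trace] at this
    simpa using this
  rw [h₂, normalizedTrace]
  rcases Nat.eq_zero_or_pos p with rfl | hp
  · simp [Matrix.trace]
  · have : (p : ℂ) ≠ 0 := by exact_mod_cast hp.ne'
    push_cast
    field_simp

theorem norm_wordEval_le_one {n : ℕ} {A : Type*} [NormedRing A] [StarRing A] [NormedStarGroup A]
    (h₁ : ‖(1 : A)‖ ≤ 1) {x : Fin n → A} (hx : ∀ i, ‖x i‖ ≤ 1) (w : List (Fin n × Bool)) :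
    ‖wordEval x w‖ ≤ 1 := by
  induction w with
  | nil => simpa using h₁
  | cons a w ih =>
    rw [wordEval_cons]
    refine (norm_mul_le _ _).trans (mul_le_one₀ ?_ (norm_nonneg _) ih)
    cases a.2 <;> simp [hx]

open scoped Matrix.Norms.L2Operator in
theorem norm_one_matrix_le (p : ℕ) : ‖(1 : Matrix (Fin p) (Fin p) ℂ)‖ ≤ 1 := by
  rcases subsingleton_or_nontrivial (Matrix (Fin p) (Fin p) ℂ) with h | h
  · rw [Subsingleton.elim (1 : Matrix (Fin p) (Fin p) ℂ) 0, norm_zero]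
    exact zero_le_one
  · exact CStarRing.norm_one.le

open scoped Matrix.Norms.L2Operator in
theorem norm_normalizedTrace_wordEval_le_one {n p : ℕ} {a : Fin n → Matrix (Fin p) (Fin p) ℂ}
    (ha : ∀ i, ‖Matrix.toEuclideanCLM (n := Fin p) (𝕜 := ℂ) (a i)‖ ≤ 1)
    (w : List (Fin n × Bool)) : ‖normalizedTrace (wordEval a w)‖ ≤ 1 :=
  (norm_normalizedTrace_le _).trans (norm_wordEval_le_one (norm_one_matrix_le p) ha w)

theorem wordEval_blockHom {n N q p : ℕ} (f : Fin p × Fin q → Finset ℕ)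
    (hf : Function.Injective f) (hfN : ∀ i, f i ⊆ Finset.range N)
    (a : Fin n → Matrix (Fin p) (Fin p) ℂ) (b : Fin n × Bool) (w : List (Fin n × Bool)) :
    wordEval (fun i => blockHom f hf hfN (a i)) (b :: w) =
      blockHom f hf hfN (wordEval a (b :: w)) := by
  induction w generalizing b with
  | nil =>
    simp only [wordEval_cons, wordEval_nil, mul_one]
    cases b.2 <;> simp [map_star]
  | cons c w ih =>
    rw [wordEval_cons, ih, wordEval_cons a b, map_mul]
    cases b.2 <;> simp [map_star]

/-- The largest multiple of `p` below a large power of two fills most of it. -/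
theorem norm_div_mul_div_sub_one_le {p N : ℕ} (hp : 0 < p) {ε : ℝ} (hε : 0 < ε)
    (hN : (p : ℝ) / ε < 2 ^ N) : ‖(((2 ^ N / p * p : ℕ) : ℂ) / 2 ^ N) - 1‖ ≤ ε := by
  set r := 2 ^ N / p * p with hr
  have h₁ : r ≤ 2 ^ N := Nat.div_mul_le_self _ _
  have h₂ : 2 ^ N < r + p := Nat.lt_div_mul_add hp
  have h₃ : ((r : ℂ) / 2 ^ N) - 1 = ((((r : ℝ) / 2 ^ N) - 1 : ℝ) : ℂ) := by
    push_cast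
    rfl
  rw [h₃, Complex.norm_real, Real.norm_eq_abs, abs_le]
  have h₄ : (r : ℝ) ≤ 2 ^ N := by exact_mod_cast h₁
  have h₅ : (2 : ℝ) ^ N < (r : ℝ) + p := by exact_mod_cast h₂
  have h₆ : (0 : ℝ) < 2 ^ N := by positivity
  rw [div_lt_iff₀ hε] at hN
  constructor
  · rw [le_sub_iff_add_le, le_div_iff₀ h₆]
    linarith
  · have := (div_le_one h₆).2 h₄
    linarith

theorem inner_vacuum_self : inner ℂ vacuum vacuum = (1 : ℂ) := by
  rw [vacuum_eq, inner_pauliVector_left, pauliVector_apply, if_pos rfl]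

theorem normalizedTrace_one {p : ℕ} (hp : 0 < p) :
    normalizedTrace (1 : Matrix (Fin p) (Fin p) ℂ) = 1 := by
  have hp' : (p : ℂ) ≠ 0 := by exact_mod_cast hp.ne'
  rw [normalizedTrace, Matrix.trace_one, Fintype.card_fin, div_self hp']

/-- Tuples of contractive matrices are approximated in moments by tuples of contractions in the
hyperfinite factor: put as many copies as possible on the diagonal of a matrix algebra of large
dimension `2 ^ N`. -/
theorem exists_hyperfinite_near {n p : ℕ} (hp : 0 < p) (a : Fin n → Matrix (Fin p) (Fin p) ℂ)
    (ha : ∀ i, ‖Matrix.toEuclideanCLM (n := Fin p) (𝕜 := ℂ) (a i)‖ ≤ 1) {ε : ℝ} (hε : 0 < ε) :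
    ∃ x : Fin n → HyperfiniteR, (∀ i, ‖x i‖ ≤ 1) ∧
      ∀ w, ‖traceR (wordEval x w) - normalizedTrace (wordEval a w)‖ ≤ ε := by
  obtain ⟨N, hN⟩ := pow_unbounded_of_one_lt ((p : ℝ) / ε) (one_lt_two (α := ℝ))
  obtain ⟨f, hf⟩ : ∃ f : Fin p × Fin (2 ^ N / p) → Finset ℕ,
      Function.Injective f ∧ ∀ i, f i ⊆ Finset.range N := by
    have hcard : Fintype.card (Fin p × Fin (2 ^ N / p)) ≤
        Fintype.card (Finset.range N).powerset := by
      simp only [Fintype.card_prod, Fintype.card_fin, Fintype.card_coe, Finset.card_powerset,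
        Finset.card_range]
      exact Nat.mul_div_le _ _
    obtain ⟨g⟩ := Function.Embedding.nonempty_of_card_le hcard
    exact ⟨fun i => (g i : Finset ℕ), Subtype.val_injective.comp g.injective,
      fun i => Finset.mem_powerset.1 (g i).2⟩
  refine ⟨fun i => ⟨blockHom f hf.1 hf.2 (a i), blockHom_mem f hf.1 hf.2 (a i)⟩, fun i => ?_,
    fun w => ?_⟩
  · open scoped Matrix.Norms.L2Operator in
    exact (NonUnitalStarAlgHom.norm_apply_le (blockHom f hf.1 hf.2) (a i)).trans (ha i)
  · rw [traceR, coe_wordEval]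
    cases w with
    | nil =>
      rw [wordEval_nil, wordEval_nil, one_apply_eq_self, inner_vacuum_self,
        normalizedTrace_one hp, sub_self, norm_zero]
      exact hε.le
    | cons b w =>
      rw [wordEval_blockHom, inner_vacuum_blockHom, ← sub_one_mul, norm_mul]
      refine (mul_le_mul (norm_div_mul_div_sub_one_le hp hε hN)
        (norm_normalizedTrace_wordEval_le_one ha (b :: w)) (norm_nonneg _) hε.le).trans ?_
      rw [mul_one]

/-! ### Approximation of moments -/

theorem norm_wordEval_sub_le {n : ℕ} {A : Type*} [NormedRing A] [StarRing A] [NormedStarGroup A]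
    (h₁ : ‖(1 : A)‖ ≤ 1) {x y : Fin n → A} (hx : ∀ i, ‖x i‖ ≤ 1) (hy : ∀ i, ‖y i‖ ≤ 1) {η : ℝ}
    (h : ∀ i, ‖x i - y i‖ ≤ η) (w : List (Fin n × Bool)) :
    ‖wordEval x w - wordEval y w‖ ≤ w.length * η := by
  induction w with
  | nil => simp
  | cons a w ih =>
    set b := if a.2 then star (x a.1) else x a.1 with hb
    set c := if a.2 then star (y a.1) else y a.1 with hc
    have hb₁ : ‖b‖ ≤ 1 := by rw [hb]; cases a.2 <;> simp [hx]
    have hbc : ‖b - c‖ ≤ η := by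
      rw [hb, hc]
      cases a.2
      · simpa using h a.1
      · simpa [← star_sub] using h a.1
    have h₂ : wordEval x (a :: w) - wordEval y (a :: w) =
        b * (wordEval x w - wordEval y w) + (b - c) * wordEval y w := by
      rw [wordEval_cons, wordEval_cons, ← hb, ← hc]
      noncomm_ring
    have h₃ : ‖b * (wordEval x w - wordEval y w)‖ ≤ w.length * η :=
      (norm_mul_le _ _).trans ((mul_le_of_le_one_left (norm_nonneg _) hb₁).trans ih)
    have h₄ : ‖(b - c) * wordEval y w‖ ≤ η :=
      (norm_mul_le _ _).trans ((mul_le_of_le_one_right (norm_nonneg _)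
        (norm_wordEval_le_one h₁ hy w)).trans hbc)
    rw [h₂, List.length_cons]
    push_cast
    linarith [norm_add_le (b * (wordEval x w - wordEval y w)) ((b - c) * wordEval y w)]

/-- The normalized trace, as a linear functional. -/
def normalizedTraceLinear (p : ℕ) : Matrix (Fin p) (Fin p) ℂ →ₗ[ℂ] ℂ where
  toFun := normalizedTrace
  map_add' a b := by simp [normalizedTrace, add_div]
  map_smul' c a := by simp [normalizedTrace, mul_div_assoc]

/-- The trace of the hyperfinite factor, as a linear functional. -/
def traceRLinear : HyperfiniteR →ₗ[ℂ] ℂ where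
  toFun := traceR
  map_add' a b := by
    change inner ℂ vacuum (((a : TraceSpace →L[ℂ] TraceSpace) + b) vacuum) = _
    rw [add_apply, inner_add_right]
    rfl
  map_smul' c a := by
    change inner ℂ vacuum ((c • (a : TraceSpace →L[ℂ] TraceSpace)) vacuum) = _
    rw [smul_apply, inner_smul_right]
    rfl

theorem traceR_one : traceR 1 = 1 := inner_vacuum_self

theorem norm_vacuum : ‖vacuum‖ = 1 := by
  rw [vacuum_eq]
  exact orthonormal_pauliVector.1 _

theorem norm_traceR_wordEval_le_one {n : ℕ} {x : Fin n → HyperfiniteR} (hx : ∀ i, ‖x i‖ ≤ 1)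
    (w : List (Fin n × Bool)) : ‖traceR (wordEval x w)‖ ≤ 1 := by
  have h : ‖(wordEval (fun i => (x i : TraceSpace →L[ℂ] TraceSpace)) w)‖ ≤ 1 :=
    norm_wordEval_le_one (x := fun i => (x i : TraceSpace →L[ℂ] TraceSpace))
      ContinuousLinearMap.norm_id_le hx w
  rw [traceR, coe_wordEval]
  refine (norm_inner_le_norm _ _).trans ?_
  rw [norm_vacuum, one_mul]
  refine (ContinuousLinearMap.le_opNorm _ _).trans ?_
  rwa [norm_vacuum, mul_one]

open scoped Matrix.Norms.L2Operator in
theorem norm_normalizedTrace_wordEval_sub_le {n p : ℕ} {a b : Fin n → Matrix (Fin p) (Fin p) ℂ}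
    (ha : ∀ i, ‖a i‖ ≤ 1) (hb : ∀ i, ‖b i‖ ≤ 1) {η : ℝ} (h : ∀ i, ‖a i - b i‖ ≤ η)
    (w : List (Fin n × Bool)) :
    ‖normalizedTrace (wordEval a w) - normalizedTrace (wordEval b w)‖ ≤ w.length * η := by
  have h₁ : normalizedTrace (wordEval a w) - normalizedTrace (wordEval b w) =
      normalizedTrace (wordEval a w - wordEval b w) :=
    (map_sub (normalizedTraceLinear p) _ _).symm
  rw [h₁]
  exact (norm_normalizedTrace_le _).trans (norm_wordEval_sub_le (norm_one_matrix_le p) ha hb h w)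

/-- The *-monomial of a word of length at most `d`. -/
def wordMonomial {n d : ℕ} (w : List (Fin n × Bool)) (hw : w.length ≤ d) : StarMonomial n d :=
  ⟨⟨w.length, Nat.lt_succ_of_le hw⟩, w.get⟩

theorem eval_wordMonomial {n d : ℕ} {A : Type*} [Monoid A] [Star A] (w : List (Fin n × Bool))
    (hw : w.length ≤ d) (x : Fin n → A) : (wordMonomial w hw).eval x = wordEval x w := by
  rw [StarMonomial.eval_eq_wordEval, wordMonomial, List.ofFn_get]

theorem IsEpsDenseIn.exists_near {n d p : ℕ} {ε : ℝ}
    (h : IsEpsDenseIn ε (matrixMomentSet n d p) (momentSet n d)) {x : Fin n → HyperfiniteR}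
    (hx : ∀ i, ‖x i‖ ≤ 1) : ∃ a : Fin n → Matrix (Fin p) (Fin p) ℂ,
      (∀ i, ‖Matrix.toEuclideanCLM (n := Fin p) (𝕜 := ℂ) (a i)‖ ≤ 1) ∧
      ∀ w : List (Fin n × Bool), w.length ≤ d →
        ‖traceR (wordEval x w) - normalizedTrace (wordEval a w)‖ ≤ ε := by
  obtain ⟨_, ⟨a, ha, rfl⟩, hd⟩ := h _ ⟨x, hx, rfl⟩
  refine ⟨a, ha, fun w hw => ?_⟩
  have := PiLp.norm_apply_le (momentVector d traceR x - momentVector d normalizedTrace a)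
    (wordMonomial w hw)
  rw [← dist_eq_norm] at this
  refine le_trans (le_of_eq ?_) (this.trans hd.le)
  simp only [momentVector, PiLp.sub_apply, eval_wordMonomial]

/-- If the moments of `p × p` matrices are `ε`-dense, then so are those of a net, up to the error
made by moving to the net. -/
theorem IsEpsDenseIn.exists_mem_matrixNet_near {n d p M : ℕ} {ε : ℝ}
    (h : IsEpsDenseIn ε (matrixMomentSet n d p) (momentSet n d)) (hp : 0 < p) (hM : 2 ≤ M)
    {x : Fin n → HyperfiniteR} (hx : ∀ i, ‖x i‖ ≤ 1) :
    ∃ pt ∈ matrixNet n p M, ∀ w : List (Fin n × Bool), w.length ≤ d →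
      ‖traceR (wordEval x w) - normalizedTrace (wordEval (codedTuple n p pt) w)‖ ≤
        ε + d * (3 / M) := by
  obtain ⟨a, ha, hxa⟩ := h.exists_near hx
  obtain ⟨pt, hpt, hapt⟩ := exists_mem_matrixNet hp hM a ha
  refine ⟨pt, hpt, fun w hw => ?_⟩
  have h₁ := norm_normalizedTrace_wordEval_sub_le ha (norm_codedTuple_le_one hpt) hapt w
  have h₂ : (w.length : ℝ) * (3 / (M : ℝ)) ≤ d * (3 / M) :=
    mul_le_mul_of_nonneg_right (by exact_mod_cast hw) (by positivity)
  exact (norm_sub_le_norm_sub_add_norm_sub _ _ _).trans (add_le_add (hxa w hw) (h₁.trans h₂))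

theorem norm_le_of_mem_momentSet {n d : ℕ} {s : EuclideanSpace ℂ (StarMonomial n d)}
    (hs : s ∈ momentSet n d) : ‖s‖ ≤ Real.sqrt (Fintype.card (StarMonomial n d)) := by
  obtain ⟨x, hx, rfl⟩ := hs
  rw [EuclideanSpace.norm_eq]
  refine Real.sqrt_le_sqrt ?_
  refine (Finset.sum_le_card_nsmul _ _ 1 fun m _ => ?_).trans_eq (by simp)
  refine pow_le_one₀ (norm_nonneg _) ?_
  simp only [momentVector, StarMonomial.eval_eq_wordEval]
  exact norm_traceR_wordEval_le_one hx _

/-- In a suitable dimension the moments of contractive matrices are `ε`-dense in those of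
contractions in the hyperfinite factor: the latter form a totally bounded set. -/
theorem exists_isEpsDenseIn (n d : ℕ) {ε : ℝ} (hε : 0 < ε) :
    ∃ p, 0 < p ∧ IsEpsDenseIn ε (matrixMomentSet n d p) (momentSet n d) := by
  have hb : Bornology.IsBounded (momentSet n d) :=
    isBounded_iff_forall_norm_le.2 ⟨_, fun s hs => norm_le_of_mem_momentSet hs⟩
  obtain ⟨t, hts, htf, hcov⟩ :=
    Metric.finite_approx_of_totallyBounded
      ((Metric.isCompact_of_isClosed_isBounded isClosed_closure hb.closure).totallyBounded.subset
        subset_closure) (ε / 2) (half_pos hε)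
  have hev : ∀ s ∈ t, ∀ᶠ N in Filter.atTop,
      ∃ r ∈ matrixMomentSet n d (levelDim N), dist s r < ε / 2 := by
    intro s hs
    obtain ⟨x, hx, rfl⟩ := hts hs
    obtain ⟨a, ha, hlim⟩ := exists_matrix_tendsto x hx
    have h₁ : Filter.Tendsto (fun N => momentVector d normalizedTrace (a N)) Filter.atTop
        (nhds (momentVector d traceR x)) := by
      refine ((PiLp.continuous_toLp 2 _).tendsto _).comp (tendsto_pi_nhds.2 fun m => ?_)
      simp only [StarMonomial.eval_eq_wordEval]
      exact hlim _
    filter_upwards [Metric.tendsto_nhds.1 h₁ (ε / 2) (half_pos hε)] with N hN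
    exact ⟨_, ⟨a N, ha N, rfl⟩, by rwa [dist_comm]⟩
  obtain ⟨N, hN⟩ := ((Filter.eventually_all_finite htf).2 hev).exists
  refine ⟨levelDim N, levelDim_pos N, fun s hs => ?_⟩
  obtain ⟨y, hy, hsy⟩ := Set.mem_iUnion₂.1 (hcov hs)
  obtain ⟨r, hr, hyr⟩ := hN y hy
  refine ⟨r, hr, (dist_triangle s y r).trans_lt ?_⟩
  rw [Metric.mem_ball] at hsy
  linarith

/-! ### Evaluation of universal sentences -/

theorem codedTrace_termMatrix_val {n : ℕ} (rad : List ℕ) (p : ℕ) (pt : List GaussCode)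
    (t : VNTerm n) : (codedTrace p (termMatrix rad p pt t.code)).val =
      normalizedTrace (expandEval (codedTuple n p pt) (t.expand rad)) := by
  rw [val_codedTrace, codedMatrix_termMatrix, VNTerm.evalIn_eq_expandEval]

theorem traceR_eval_eq {n : ℕ} (rad : List ℕ) (x : Fin n → HyperfiniteR) (t : VNTerm n) :
    traceR (t.eval fun i => (rad.getD i 0 : ℂ) • x i) = traceR (expandEval x (t.expand rad)) := by
  rw [VNTerm.eval_eq_evalIn, VNTerm.evalIn_eq_expandEval]

section Sentence

variable {u : ConnectiveSystem} {approx : ℕ × List RatCode × ℕ → RatCode}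
  {modulus : ℕ × ℕ × ℕ → ℕ}

/-- The value of a formula at a tuple in the hyperfinite factor is close to the computed value at a
tuple of matrices with approximately the same moments. -/
theorem QFFormula.eval_near
    (happrox : ∀ (m : ℕ) (q : Fin (u.arity m) → RatCode) (j : ℕ),
      |u.fn m (ratPoint q) - ((approx (m, List.ofFn q, j)).val : ℝ)| < 1 / ((j : ℝ) + 1))
    (hmodulus : ∀ (m N j : ℕ) (x y : Fin (u.arity m) → ℝ), ‖x‖ ≤ N → ‖y‖ ≤ N →
      Dist.dist x y < 1 / ((modulus (m, N, j) : ℝ) + 1) → |u.fn m x - u.fn m y| < 1 / ((j : ℝ) + 1))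
    {n : ℕ} (rad : List ℕ) {J p K D : ℕ} {pt : List GaussCode} (φ : QFFormula u n)
    (hK : (formulaNeed rad J φ.code).1 ≤ K) (hK₀ : 0 < K) (hD : (formulaNeed rad J φ.code).2 ≤ D)
    {x : Fin n → HyperfiniteR} (hx : ∀ i, ‖x i‖ ≤ 1)
    (h : ∀ w : List (Fin n × Bool), w.length ≤ D →
      ‖traceR (wordEval x w) - normalizedTrace (wordEval (codedTuple n p pt) w)‖ ≤ 1 / K) :
    |φ.eval fun i => (rad.getD i 0 : ℂ) • x i| ≤ formulaNorm approx modulus rad φ.code ∧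
      (0 < formulaPrec approx modulus rad J φ.code →
        |(φ.eval fun i => (rad.getD i 0 : ℂ) • x i) -
            ((formulaVal approx rad J p pt φ.code).val : ℝ)| <
          1 / (formulaPrec approx modulus rad J φ.code : ℝ)) := by
  have hK' : (0 : ℝ) < K := by exact_mod_cast hK₀
  rw [QFFormula.eval_eq_evalFun]
  refine QFFormula.approx_spec happrox hmodulus rad J p K D pt _ (fun t => ?_)
    (one_div_pos.2 hK') (mul_one_div_cancel hK'.ne').le (fun t ht => ?_) φ hK hD
  · rw [traceR_eval_eq]
    exact (norm_expandEval_le traceRLinear x (norm_traceR_wordEval_le_one hx) _).trans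
      (t.expand_bounds rad).1
  · rw [traceR_eval_eq, codedTrace_termMatrix_val]
    refine (norm_expandEval_sub_le traceRLinear (normalizedTraceLinear p) x _ h _
      fun a ha => ((t.expand_bounds rad).2 a ha).trans ht).trans ?_
    exact mul_le_mul_of_nonneg_right (t.expand_bounds rad).1 (one_div_pos.2 hK').le

/-- Operators of norm at most `r` are multiples of contractions. -/
theorem exists_contraction_smul (r : ℕ) {x : HyperfiniteR} (hx : ‖x‖ ≤ r) :
    ∃ y : HyperfiniteR, ‖y‖ ≤ 1 ∧ (r : ℂ) • y = x := by
  rcases Nat.eq_zero_or_pos r with rfl | hr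
  · refine ⟨0, by simp, ?_⟩
    have : x = 0 := norm_le_zero_iff.1 (by simpa using hx)
    simp [this]
  · have hr' : (r : ℂ) ≠ 0 := by exact_mod_cast hr.ne'
    have hr₀ : (0 : ℝ) < r := by exact_mod_cast hr
    refine ⟨(r : ℂ)⁻¹ • x, ?_, smul_inv_smul₀ hr' x⟩
    rw [norm_smul, norm_inv, Complex.norm_natCast]
    exact inv_mul_le_one_of_le₀ hx hr₀.le

/-- The supremum of a formula over the hyperfinite factor is close to its maximum over a net in the
matrices whose moments are sufficiently dense. -/
theorem UniversalSentence.abs_value_sub_le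
    (happrox : ∀ (m : ℕ) (q : Fin (u.arity m) → RatCode) (j : ℕ),
      |u.fn m (ratPoint q) - ((approx (m, List.ofFn q, j)).val : ℝ)| < 1 / ((j : ℝ) + 1))
    (hmodulus : ∀ (m N j : ℕ) (x y : Fin (u.arity m) → ℝ), ‖x‖ ≤ N → ‖y‖ ≤ N →
      Dist.dist x y < 1 / ((modulus (m, N, j) : ℝ) + 1) → |u.fn m x - u.fn m y| < 1 / ((j : ℝ) + 1))
    (σ : UniversalSentence u) {rad : List ℕ} (hrad : ∀ i : Fin σ.n, rad.getD i 0 = σ.radius i)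
    {J p M K D : ℕ} (hp : 0 < p)
    (hK : (formulaNeed rad J σ.body.code).1 ≤ K) (hK₀ : 0 < K)
    (hD : (formulaNeed rad J σ.body.code).2 ≤ D)
    (hnet : ∀ x : Fin σ.n → HyperfiniteR, (∀ i, ‖x i‖ ≤ 1) → ∃ pt ∈ matrixNet σ.n p M,
      ∀ w : List (Fin σ.n × Bool), w.length ≤ D →
        ‖traceR (wordEval x w) - normalizedTrace (wordEval (codedTuple σ.n p pt) w)‖ ≤ 1 / K)
    (he : 0 < formulaPrec approx modulus rad J σ.body.code) {S : ℝ}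
    (hS : ∀ pt ∈ matrixNet σ.n p M, ((formulaVal approx rad J p pt σ.body.code).val : ℝ) ≤ S)
    (hS' : ∃ pt ∈ matrixNet σ.n p M, ((formulaVal approx rad J p pt σ.body.code).val : ℝ) = S) :
    |σ.value - S| ≤ 1 / (formulaPrec approx modulus rad J σ.body.code : ℝ) := by
  have hK' : (0 : ℝ) < K := by exact_mod_cast hK₀
  have hscale : ∀ x : {x : Fin σ.n → HyperfiniteR // ∀ i, ‖x i‖ ≤ σ.radius i},
      ∃ y : Fin σ.n → HyperfiniteR, (∀ i, ‖y i‖ ≤ 1) ∧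
        x.1 = fun i : Fin σ.n => (rad.getD i 0 : ℂ) • y i := by
    intro x
    choose y hy hxy using fun i => exists_contraction_smul (σ.radius i) (x.2 i)
    refine ⟨y, hy, funext fun i => ?_⟩
    rw [hrad, hxy]
  have hbound : ∀ x : {x : Fin σ.n → HyperfiniteR // ∀ i, ‖x i‖ ≤ σ.radius i},
      σ.body.eval x.1 ≤ formulaNorm approx modulus rad σ.body.code ∧
        σ.body.eval x.1 ≤ S + 1 / (formulaPrec approx modulus rad J σ.body.code : ℝ) := by
    intro x
    obtain ⟨y, hy, hxy⟩ := hscale x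
    obtain ⟨pt, hpt, hw⟩ := hnet y hy
    obtain ⟨h₁, h₂⟩ := QFFormula.eval_near happrox hmodulus rad σ.body hK hK₀ hD hy hw
    rw [hxy]
    refine ⟨(le_abs_self _).trans h₁, ?_⟩
    have h₃ := (abs_lt.1 (h₂ he)).2
    linarith [hS pt hpt]
  have : Nonempty {x : Fin σ.n → HyperfiniteR // ∀ i, ‖x i‖ ≤ σ.radius i} :=
    ⟨⟨fun _ => 0, fun i => by simp⟩⟩
  rw [abs_sub_le_iff]
  constructor
  · rw [sub_le_iff_le_add']
    exact ciSup_le fun x => (hbound x).2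
  · obtain ⟨pt, hpt, hS'⟩ := hS'
    obtain ⟨y, hy, hw⟩ := exists_hyperfinite_near hp (codedTuple σ.n p pt)
      (norm_codedTuple_le_one hpt) (one_div_pos.2 hK')
    obtain ⟨-, h₂⟩ := QFFormula.eval_near happrox hmodulus rad σ.body hK hK₀ hD hy
      fun w _ => hw w
    have h₃ : ∀ i : Fin σ.n, ‖(rad.getD i 0 : ℂ) • y i‖ ≤ σ.radius i := by
      intro i
      rw [norm_smul, Complex.norm_natCast, hrad]
      exact mul_le_of_le_one_right (Nat.cast_nonneg _) (hy i)
    have h₄ : (σ.body.eval fun i : Fin σ.n => (rad.getD i 0 : ℂ) • y i) ≤ σ.value :=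
      le_ciSup (f := fun x : {x : Fin σ.n → HyperfiniteR // ∀ i, ‖x i‖ ≤ σ.radius i} =>
        σ.body.eval x.1) ⟨_, Set.forall_mem_range.2 fun x => (hbound x).1⟩ ⟨_, h₃⟩
    have h₅ := (abs_lt.1 (h₂ he)).1
    linarith

end Sentence

/-! ### Unbounded search -/

/-- Search for the first `J` that passes a computable test, followed by a computable function. -/
theorem partrec_search {α σ : Type*} [Primcodable α] [Primcodable σ] {test : α → ℕ → Bool}
    {out : α → ℕ → σ} (ht : Computable fun x : α × ℕ => test x.1 x.2)
    (ho : Computable fun x : α × ℕ => out x.1 x.2) :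
    Partrec fun a => (Nat.rfind fun J => Part.some (test a J)).map (out a) := by
  have h₁ : Partrec₂ fun (a : α) (J : ℕ) => Part.some (test a J) := ht.partrec
  exact (Partrec.rfind h₁).map ho.to₂

theorem exists_mem_search {α σ : Type*} {test : α → ℕ → Bool} {out : α → ℕ → σ} {a : α}
    (h : ∃ J, test a J = true) :
    ∃ J, test a J = true ∧ out a J ∈ (Nat.rfind fun J => Part.some (test a J)).map (out a) := by
  have hd : (Nat.rfind fun J => Part.some (test a J)).Dom :=
    Nat.rfind_dom.2 ⟨_, Part.mem_some_iff.2 (Nat.find_spec h).symm, fun _ => trivial⟩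
  refine ⟨_, ?_, Part.mem_map _ (Part.get_mem hd)⟩
  exact (Part.mem_some_iff.1 (Nat.rfind_spec (Part.get_mem hd))).symm

/-! ### The universal theory from rates of density -/

/-- Comparison of coded rationals. -/
def RatCode.ble (q r : RatCode) : Bool :=
  Nat.ble (q.1 * (r.2.2 + 1) + r.2.1 * (q.2.2 + 1)) (r.1 * (q.2.2 + 1) + q.2.1 * (r.2.2 + 1))

theorem RatCode.ble_iff (q r : RatCode) : q.ble r = true ↔ (q.val : ℝ) ≤ r.val := by
  have hq : (0 : ℝ) < (q.2.2 : ℝ) + 1 := by positivity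
  have hr : (0 : ℝ) < (r.2.2 : ℝ) + 1 := by positivity
  rw [RatCode.ble, Nat.ble_eq, ← Nat.cast_le (α := ℝ)]
  simp only [RatCode.val]
  push_cast
  rw [div_le_div_iff₀ hq hr]
  constructor <;> intro h <;> linarith

/-- A code of the maximum of a list of coded rationals and `b`. -/
def ratMax (b : RatCode) (l : List RatCode) : RatCode :=
  l.foldr (fun q r => bif q.ble r then r else q) b

theorem ratMax_mem (b : RatCode) (l : List RatCode) : ratMax b l = b ∨ ratMax b l ∈ l := by
  induction l with
  | nil => exact Or.inl rfl
  | cons q l ih =>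
    have h : ratMax b (q :: l) = bif q.ble (ratMax b l) then ratMax b l else q := rfl
    rw [h]
    cases q.ble (ratMax b l)
    · exact Or.inr List.mem_cons_self
    · exact ih.imp id (List.mem_cons_of_mem _)

theorem le_ratMax (b : RatCode) {l : List RatCode} {q : RatCode} (hq : q ∈ l) :
    (q.val : ℝ) ≤ (ratMax b l).val := by
  induction l with
  | nil => simp at hq
  | cons r l ih =>
    have h : ratMax b (r :: l) = bif r.ble (ratMax b l) then ratMax b l else r := rfl
    rw [h]
    rcases hr : r.ble (ratMax b l) with _ | _
    · have hr' : ((ratMax b l).val : ℝ) < r.val :=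
        not_le.1 fun h' => by simp [(RatCode.ble_iff _ _).2 h'] at hr
      rcases List.mem_cons.1 hq with rfl | hq
      · exact le_rfl
      · exact (ih hq).trans hr'.le
    · rcases List.mem_cons.1 hq with rfl | hq
      · exact (RatCode.ble_iff _ _).1 hr
      · exact ih hq

section Algorithm

variable (approx : ℕ × List RatCode × ℕ → RatCode) (modulus : ℕ × ℕ × ℕ → ℕ)
  (F : ℕ × ℕ × ℕ → ℕ)

/-- The precision guaranteed at stage `J` for the body of the sentence with Gödel number `c`. -/
def sentencePrec (c J : ℕ) : ℕ :=
  formulaPrec approx modulus (decodeList c.unpair.1) J c.unpair.2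

/-- The inverse of the accuracy of moments needed at stage `J`. -/
def sentenceNeed (c J : ℕ) : ℕ := (formulaNeed (decodeList c.unpair.1) J c.unpair.2).1 + 1

/-- The degree of the moments needed at stage `J`. -/
def sentenceDegree (c J : ℕ) : ℕ := (formulaNeed (decodeList c.unpair.1) J c.unpair.2).2

/-- The dimension of the matrices used at stage `J`.  Sentences without variables are treated
separately, since the rate `F` is meaningful only for positive numbers of variables. -/
def sentenceDim (c J : ℕ) : ℕ :=
  bif Nat.beq (decodeList c.unpair.1).length 0 then 1
  else F ((decodeList c.unpair.1).length, sentenceDegree c J + 1, 2 * sentenceNeed c J)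

/-- The net of tuples of matrices used at stage `J`. -/
def sentenceNet (c J : ℕ) : List (List GaussCode) :=
  matrixNet (decodeList c.unpair.1).length (sentenceDim F c J)
    (6 * (sentenceNeed c J * (sentenceDegree c J + 1)))

/-- The values over the net at stage `J`. -/
def sentenceVals (c J : ℕ) : List RatCode :=
  (sentenceNet F c J).map fun pt =>
    formulaVal approx (decodeList c.unpair.1) J (sentenceDim F c J) pt c.unpair.2

/-- The approximation at stage `J` to the value of the sentence with Gödel number `c`. -/
def sentenceMax (c J : ℕ) : RatCode :=
  ratMax ((sentenceVals approx F c J).getD 0 (0, 0, 0)) (sentenceVals approx F c J)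

/-- The test whether the precision at stage `J` is sufficient for `δ`. -/
def sentenceTest (x : ℕ × RatCode) (J : ℕ) : Bool :=
  Nat.ble (x.2.2.1 * sentencePrec approx modulus x.1 J + 4 * (x.2.2.2 + 1) + 1)
    (x.2.1 * sentencePrec approx modulus x.1 J)

/-- The interval around the value of a sentence found at stage `J`. -/
def sentenceOut (x : ℕ × RatCode) (J : ℕ) : RatCode × RatCode :=
  (RatCode.add (sentenceMax approx F x.1 J) (0, 2, sentencePrec approx modulus x.1 J - 1),
    RatCode.add (sentenceMax approx F x.1 J) (2, 0, sentencePrec approx modulus x.1 J - 1))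

end Algorithm

section Computable

variable {α : Type*} [Primcodable α] {approx : ℕ × List RatCode × ℕ → RatCode}
  {modulus : ℕ × ℕ × ℕ → ℕ} {F : ℕ × ℕ × ℕ → ℕ}

@[fun_prop]
theorem computable_ratBle {q r : α → RatCode} (hq : Computable q) (hr : Computable r) :
    Computable fun a => RatCode.ble (q a) (r a) := by
  unfold RatCode.ble; fun_prop

@[fun_prop]
theorem computable_ratMax {b : α → RatCode} {l : α → List RatCode} (hb : Computable b)
    (hl : Computable l) : Computable fun a => ratMax (b a) (l a) := by
  unfold ratMax; fun_prop

@[fun_prop]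
theorem computable_sentencePrec (h₁ : Computable approx) (h₂ : Computable modulus) {c J : α → ℕ}
    (hc : Computable c) (hJ : Computable J) :
    Computable fun a => sentencePrec approx modulus (c a) (J a) := by
  unfold sentencePrec; fun_prop

@[fun_prop]
theorem computable_sentenceNeed {c J : α → ℕ} (hc : Computable c) (hJ : Computable J) :
    Computable fun a => sentenceNeed (c a) (J a) := by
  unfold sentenceNeed; fun_prop

@[fun_prop]
theorem computable_sentenceDegree {c J : α → ℕ} (hc : Computable c) (hJ : Computable J) :
    Computable fun a => sentenceDegree (c a) (J a) := by
  unfold sentenceDegree; fun_prop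

@[fun_prop]
theorem computable_sentenceDim (hF : Computable F) {c J : α → ℕ} (hc : Computable c)
    (hJ : Computable J) : Computable fun a => sentenceDim F (c a) (J a) := by
  unfold sentenceDim; fun_prop

@[fun_prop]
theorem computable_sentenceNet (hF : Computable F) {c J : α → ℕ} (hc : Computable c)
    (hJ : Computable J) : Computable fun a => sentenceNet F (c a) (J a) := by
  unfold sentenceNet; fun_prop

@[fun_prop]
theorem computable_sentenceVals (h₁ : Computable approx) (hF : Computable F) {c J : α → ℕ}
    (hc : Computable c) (hJ : Computable J) :
    Computable fun a => sentenceVals approx F (c a) (J a) := by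
  unfold sentenceVals; fun_prop

@[fun_prop]
theorem computable_sentenceMax (h₁ : Computable approx) (hF : Computable F) {c J : α → ℕ}
    (hc : Computable c) (hJ : Computable J) :
    Computable fun a => sentenceMax approx F (c a) (J a) := by
  unfold sentenceMax; fun_prop

theorem computable_sentenceTest (h₁ : Computable approx) (h₂ : Computable modulus) :
    Computable fun a : (ℕ × RatCode) × ℕ => sentenceTest approx modulus a.1 a.2 := by
  unfold sentenceTest; fun_prop

theorem computable_sentenceOut (h₁ : Computable approx) (h₂ : Computable modulus)
    (hF : Computable F) :
    Computable fun a : (ℕ × RatCode) × ℕ => sentenceOut approx modulus F a.1 a.2 := by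
  unfold sentenceOut; fun_prop

end Computable

/-- The test asks that the interval of length `4 / e` produced by `sentenceOut` is shorter
than `δ`. -/
theorem sentenceTest_iff (approx : ℕ × List RatCode × ℕ → RatCode) (modulus : ℕ × ℕ × ℕ → ℕ)
    (c : ℕ) (δ : RatCode) (J : ℕ) : sentenceTest approx modulus (c, δ) J = true ↔
      4 < (δ.val : ℝ) * sentencePrec approx modulus c J := by
  have hδ : (0 : ℝ) < (δ.2.2 : ℝ) + 1 := by positivity
  rw [sentenceTest, Nat.ble_eq, Nat.succ_le_iff, ← Nat.cast_lt (α := ℝ)]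
  simp only [RatCode.val]
  push_cast
  rw [div_mul_eq_mul_div, lt_div_iff₀ hδ]
  constructor <;> intro h <;> linarith

theorem exists_sentenceTest {u : ConnectiveSystem} (approx : ℕ × List RatCode × ℕ → RatCode)
    (modulus : ℕ × ℕ × ℕ → ℕ) (σ : UniversalSentence u) {δ : RatCode} (hδ : 0 < δ.val) :
    ∃ J, sentenceTest approx modulus (σ.code, δ) J = true := by
  have hδ' : (0 : ℝ) < δ.val := by exact_mod_cast hδ
  obtain ⟨E, hE⟩ := exists_nat_gt (4 / (δ.val : ℝ))
  obtain ⟨J, hJ⟩ := exists_le_formulaPrec (approx := approx) (modulus := modulus)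
    (List.ofFn σ.radius) σ.body E
  refine ⟨J, (sentenceTest_iff _ _ _ _ _).2 ?_⟩
  have h₁ : E ≤ sentencePrec approx modulus σ.code J := by
    simpa [sentencePrec, UniversalSentence.code, decodeList_encode] using hJ J le_rfl
  have h₂ : (E : ℝ) ≤ sentencePrec approx modulus σ.code J := by exact_mod_cast h₁
  rw [div_lt_iff₀ hδ'] at hE
  nlinarith

/-- In no variables there is only the empty word. -/
theorem isEpsDenseIn_zero (d : ℕ) {ε : ℝ} (hε : 0 < ε) :
    IsEpsDenseIn ε (matrixMomentSet 0 d 1) (momentSet 0 d) := by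
  rintro _ ⟨x, -, rfl⟩
  refine ⟨_, ⟨fun i => i.elim0, fun i => i.elim0, rfl⟩, ?_⟩
  have h : momentVector d traceR x =
      momentVector d normalizedTrace (fun i : Fin 0 => (i.elim0 : Matrix (Fin 1) (Fin 1) ℂ)) := by
    refine congrArg (WithLp.toLp 2) (funext fun m => ?_)
    rw [StarMonomial.eval_eq_wordEval, StarMonomial.eval_eq_wordEval]
    rcases List.ofFn m.2 with _ | ⟨a, w⟩
    · rw [wordEval_nil, wordEval_nil, traceR_one, normalizedTrace_one one_pos]
    · exact a.1.elim0
  rw [h, dist_self]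
  exact hε

/-- The accuracy of moments over the net of `sentenceNet`: half of `1 / K` is lost by passing to
matrices, the other half by passing to the net. -/
theorem accuracy_eq {K D : ℕ} (hK : 0 < K) :
    1 / ((2 * K : ℕ) : ℝ) + ((D + 1 : ℕ) : ℝ) * (3 / ((6 * (K * (D + 1)) : ℕ) : ℝ)) = 1 / K := by
  have hK' : (0 : ℝ) < K := by exact_mod_cast hK
  have hD : (0 : ℝ) < (D : ℝ) + 1 := by positivity
  push_cast
  field_simp
  norm_num

section Correctness

variable {u : ConnectiveSystem} {F : ℕ × ℕ × ℕ → ℕ}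

theorem UniversalSentence.decodeList_code (σ : UniversalSentence u) :
    decodeList σ.code.unpair.1 = List.ofFn σ.radius := by
  rw [UniversalSentence.code, Nat.unpair_pair, decodeList_encode]

theorem UniversalSentence.body_code (σ : UniversalSentence u) :
    σ.code.unpair.2 = σ.body.code := by
  rw [UniversalSentence.code, Nat.unpair_pair]

theorem sentenceDim_spec (hdense : ∀ n d k : ℕ, 0 < n → 0 < d → 0 < k → 0 < F (n, d, k) ∧
      IsEpsDenseIn (1 / (k : ℝ)) (matrixMomentSet n d (F (n, d, k))) (momentSet n d))
    (σ : UniversalSentence u) (J : ℕ) : 0 < sentenceDim F σ.code J ∧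
      IsEpsDenseIn (1 / ((2 * sentenceNeed σ.code J : ℕ) : ℝ))
        (matrixMomentSet σ.n (sentenceDegree σ.code J + 1) (sentenceDim F σ.code J))
        (momentSet σ.n (sentenceDegree σ.code J + 1)) := by
  have hK : 0 < 2 * sentenceNeed σ.code J := Nat.mul_pos two_pos (Nat.succ_pos _)
  rw [sentenceDim, σ.decodeList_code, List.length_ofFn]
  rcases Nat.eq_zero_or_pos σ.n with hn | hn
  · rw [hn]
    exact ⟨one_pos, isEpsDenseIn_zero _ (one_div_pos.2 (by exact_mod_cast hK))⟩
  · have : Nat.beq σ.n 0 = false := by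
      rw [← Bool.not_eq_true, Nat.beq_eq]
      exact hn.ne'
    rw [this]
    exact hdense _ _ _ hn (Nat.succ_pos _) hK

theorem exists_mem_sentenceNet (hdense : ∀ n d k : ℕ, 0 < n → 0 < d → 0 < k →
      0 < F (n, d, k) ∧
      IsEpsDenseIn (1 / (k : ℝ)) (matrixMomentSet n d (F (n, d, k))) (momentSet n d))
    (σ : UniversalSentence u) (J : ℕ) {x : Fin σ.n → HyperfiniteR} (hx : ∀ i, ‖x i‖ ≤ 1) :
    ∃ pt ∈ sentenceNet F σ.code J, ∀ w : List (Fin σ.n × Bool),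
      w.length ≤ sentenceDegree σ.code J + 1 →
        ‖traceR (wordEval x w) -
          normalizedTrace (wordEval (codedTuple σ.n (sentenceDim F σ.code J) pt) w)‖ ≤
            1 / sentenceNeed σ.code J := by
  have hK : 0 < sentenceNeed σ.code J := Nat.succ_pos _
  have hM : 2 ≤ 6 * (sentenceNeed σ.code J * (sentenceDegree σ.code J + 1)) := by
    have : 0 < sentenceNeed σ.code J * (sentenceDegree σ.code J + 1) :=
      Nat.mul_pos hK (Nat.succ_pos _)
    omega
  obtain ⟨hp, hd⟩ := sentenceDim_spec hdense σ J
  obtain ⟨pt, hpt, hw⟩ := hd.exists_mem_matrixNet_near hp hM hx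
  refine ⟨pt, ?_, fun w hwd => (hw w hwd).trans_eq (accuracy_eq hK)⟩
  rwa [sentenceNet, σ.decodeList_code, List.length_ofFn]

/-- At every stage with positive precision the value of the sentence is found to that precision. -/
theorem abs_value_sub_sentenceMax_le {approx : ℕ × List RatCode × ℕ → RatCode}
    {modulus : ℕ × ℕ × ℕ → ℕ}
    (happrox : ∀ (m : ℕ) (q : Fin (u.arity m) → RatCode) (j : ℕ),
      |u.fn m (ratPoint q) - ((approx (m, List.ofFn q, j)).val : ℝ)| < 1 / ((j : ℝ) + 1))
    (hmodulus : ∀ (m N j : ℕ) (x y : Fin (u.arity m) → ℝ), ‖x‖ ≤ N → ‖y‖ ≤ N →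
      Dist.dist x y < 1 / ((modulus (m, N, j) : ℝ) + 1) → |u.fn m x - u.fn m y| < 1 / ((j : ℝ) + 1))
    (hdense : ∀ n d k : ℕ, 0 < n → 0 < d → 0 < k → 0 < F (n, d, k) ∧
      IsEpsDenseIn (1 / (k : ℝ)) (matrixMomentSet n d (F (n, d, k))) (momentSet n d))
    (σ : UniversalSentence u) {J : ℕ} (he : 0 < sentencePrec approx modulus σ.code J) :
    |σ.value - ((sentenceMax approx F σ.code J).val : ℝ)| ≤
      1 / (sentencePrec approx modulus σ.code J : ℝ) := by
  have hnear := fun x hx => exists_mem_sentenceNet hdense σ J (x := x) hx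
  obtain ⟨pt₀, hpt₀, -⟩ := hnear (fun _ => 0) fun i => by simp
  have hmem : sentenceMax approx F σ.code J ∈ sentenceVals approx F σ.code J := by
    refine (ratMax_mem _ _).elim (fun h => ?_) id
    have hlt : 0 < (sentenceVals approx F σ.code J).length :=
      List.length_pos_of_mem (List.mem_map_of_mem hpt₀)
    rw [sentenceMax, h, List.getD_eq_getElem _ _ hlt]
    exact List.getElem_mem hlt
  obtain ⟨pt₁, hpt₁, h₁⟩ := List.mem_map.1 hmem
  have hmax : ∀ pt ∈ sentenceNet F σ.code J,
      ((formulaVal approx (decodeList σ.code.unpair.1) J (sentenceDim F σ.code J) pt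
        σ.code.unpair.2).val : ℝ) ≤ (sentenceMax approx F σ.code J).val :=
    fun pt hpt => le_ratMax _ (List.mem_map_of_mem hpt)
  have hK : (formulaNeed (List.ofFn σ.radius) J σ.body.code).1 ≤ sentenceNeed σ.code J := by
    rw [sentenceNeed, σ.decodeList_code, σ.body_code]
    exact Nat.le_succ _
  have hD : (formulaNeed (List.ofFn σ.radius) J σ.body.code).2 ≤
      sentenceDegree σ.code J + 1 := by
    rw [sentenceDegree, σ.decodeList_code, σ.body_code]
    exact Nat.le_succ _
  have hprec : sentencePrec approx modulus σ.code J =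
      formulaPrec approx modulus (List.ofFn σ.radius) J σ.body.code := by
    rw [sentencePrec, σ.decodeList_code, σ.body_code]
  rw [hprec] at he ⊢
  rw [σ.decodeList_code, σ.body_code] at h₁ hmax
  rw [sentenceNet, σ.decodeList_code, List.length_ofFn] at hnear hmax hpt₁
  exact UniversalSentence.abs_value_sub_le happrox hmodulus σ (rad := List.ofFn σ.radius)
    (fun i => by simp) (sentenceDim_spec hdense σ J).1 hK (Nat.succ_pos _) hD hnear he hmax
    ⟨pt₁, hpt₁, by rw [h₁]⟩

/-- A computable rate of density of the moments of matrices makes the universal theory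
computable. -/
theorem universalTheoryComputable_of_rate (hF : Computable F)
    (hdense : ∀ n d k : ℕ, 0 < n → 0 < d → 0 < k → 0 < F (n, d, k) ∧
      IsEpsDenseIn (1 / (k : ℝ)) (matrixMomentSet n d (F (n, d, k))) (momentSet n d)) :
    UniversalTheoryComputable u := by
  obtain ⟨approx, h₁, happrox⟩ := u.computable_fn
  obtain ⟨modulus, h₂, hmodulus⟩ := u.computable_modulus
  refine ⟨_, partrec_search (computable_sentenceTest h₁ h₂) (computable_sentenceOut h₁ h₂ hF),
    fun σ δ hδ => ?_⟩
  obtain ⟨J, hJ, hout⟩ := exists_mem_search (out := sentenceOut approx modulus F)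
    (exists_sentenceTest approx modulus σ hδ)
  refine ⟨_, _, hout, ?_⟩
  rw [sentenceTest_iff] at hJ
  have hkey := abs_value_sub_sentenceMax_le (J := J) happrox hmodulus hdense σ
  simp only [RatCode.val_add]
  generalize sentencePrec approx modulus σ.code J = e at *
  generalize sentenceMax approx F σ.code J = S at *
  have he₀ : 0 < e := by
    refine Nat.pos_of_ne_zero fun h => ?_
    rw [h] at hJ
    norm_num at hJ
  have he₁ : (0 : ℝ) < e := by exact_mod_cast he₀
  have he₂ : ((e - 1 : ℕ) : ℝ) + 1 = e := by
    rw [Nat.cast_sub he₀]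
    simp
  have hlow : ((RatCode.val (0, 2, e - 1) : ℚ) : ℝ) = -(2 / e) := by
    simp only [RatCode.val]
    push_cast
    rw [he₂]
    ring
  have hupp : ((RatCode.val (2, 0, e - 1) : ℚ) : ℝ) = 2 / e := by
    simp only [RatCode.val]
    push_cast
    rw [he₂]
    ring
  have hkey := abs_le.1 (hkey he₀)
  have h₃ : 2 / (e : ℝ) = 1 / e + 1 / e := by ring
  have h₄ : 0 < 1 / (e : ℝ) := one_div_pos.2 he₁
  have h₅ : 4 / (e : ℝ) < δ.val := by rwa [div_lt_iff₀ he₁]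
  have h₆ : 4 / (e : ℝ) = 2 / e + 2 / e := by ring
  refine ⟨?_, ?_, ?_⟩
  · rw [← Rat.cast_lt (K := ℝ)]
    push_cast
    rw [hlow, hupp]
    linarith
  · push_cast
    rw [hlow]
    linarith [hkey.1]
  · push_cast
    rw [hupp]
    linarith [hkey.2]

end Correctness

/-! ### Lists of words -/

/-- The letters in `n` variables. -/
def letterList (n : ℕ) : List (Fin n × Bool) :=
  (List.finRange n).flatMap fun i => [(i, false), (i, true)]

/-- The words of length at most `d` in `n` variables. -/
def wordList (n d : ℕ) : List (List (Fin n × Bool)) :=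
  (List.range (d + 1)).flatMap fun l => listsOver (letterList n) l

/-- The words of length at most `d` in `n` variables, as data that do not depend on `n`. -/
def rawWordList (n d : ℕ) : List (List (ℕ × Bool)) :=
  (List.range (d + 1)).flatMap fun l =>
    listsOver ((List.range n).flatMap fun i => [(i, false), (i, true)]) l

/-- Forget the bound on the variables of a word. -/
def rawWord {n : ℕ} (w : List (Fin n × Bool)) : List (ℕ × Bool) :=
  w.map fun a => ((a.1 : ℕ), a.2)

theorem mem_wordList {n d : ℕ} {w : List (Fin n × Bool)} : w ∈ wordList n d ↔ w.length ≤ d := by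
  have h : ∀ a : Fin n × Bool, a ∈ letterList n := by
    rintro ⟨i, b⟩
    refine List.mem_flatMap.2 ⟨i, List.mem_finRange i, ?_⟩
    cases b <;> simp
  simp only [wordList, List.mem_flatMap, List.mem_range, mem_listsOver]
  constructor
  · rintro ⟨l, hl, rfl, -⟩
    exact Nat.lt_succ_iff.1 hl
  · exact fun hw => ⟨_, Nat.lt_succ_of_le hw, rfl, fun a _ => h a⟩

theorem listsOver_map {σ τ : Type*} (f : σ → τ) (A : List σ) (len : ℕ) :
    listsOver (A.map f) len = (listsOver A len).map (List.map f) := by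
  induction len with
  | zero => rfl
  | succ len ih =>
    have h₁ : listsOver (A.map f) (len + 1) =
      (listsOver (A.map f) len).flatMap fun w => (A.map f).map fun a => a :: w := rfl
    have h₂ : listsOver A (len + 1) = (listsOver A len).flatMap fun w => A.map fun a => a :: w :=
      rfl
    rw [h₁, h₂, ih, List.flatMap_map, List.map_flatMap]
    simp only [List.map_map]
    rfl

theorem rawWordList_eq (n d : ℕ) : rawWordList n d = (wordList n d).map rawWord := by
  have h : (List.range n).flatMap (fun i => [(i, false), (i, true)]) =
      (letterList n).map fun a => ((a.1 : ℕ), a.2) := by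
    rw [letterList, List.map_flatMap, ← List.map_coe_finRange_eq_range, List.flatMap_map]
    rfl
  rw [rawWordList, wordList, h, List.map_flatMap]
  simp only [listsOver_map]
  rfl

/-- Every *-monomial of degree at most `d` occurs in the list of words. -/
theorem sum_le_sum_wordList {n d : ℕ} (f : List (Fin n × Bool) → ℝ) (hf : ∀ w, 0 ≤ f w) :
    ∑ m : StarMonomial n d, f (List.ofFn m.2) ≤ ((wordList n d).map f).sum := by
  have hinj : Function.Injective fun m : StarMonomial n d => List.ofFn m.2 := by
    rintro ⟨⟨l, hl⟩, g⟩ ⟨⟨l', hl'⟩, g'⟩ h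
    have h' := List.ofFn_inj'.1 h
    obtain ⟨rfl, h''⟩ := Sigma.mk.inj_iff.1 h'
    obtain rfl := eq_of_heq h''
    rfl
  classical
  rw [← Finset.sum_image (f := f) (g := fun m : StarMonomial n d => List.ofFn m.2)
    fun a _ b _ h => hinj h, Finset.sum_list_map_count]
  refine (Finset.sum_le_sum_of_subset_of_nonneg (fun w hw => ?_) fun w _ _ => hf w).trans
    (Finset.sum_le_sum fun w hw => ?_)
  · obtain ⟨m, -, rfl⟩ := Finset.mem_image.1 hw
    rw [List.mem_toFinset, mem_wordList, List.length_ofFn]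
    exact Nat.lt_succ_iff.1 m.1.2
  · rw [List.mem_toFinset] at hw
    rw [nsmul_eq_mul]
    refine le_mul_of_one_le_left (hf w) ?_
    exact Nat.one_le_cast.2 ((@List.count_pos_iff _ instBEqOfDecidableEq _ _ _).2 hw)

/-! ### A sentence for the distance to a net of moments -/

/-- The term of a word. -/
def wordTerm {n : ℕ} (w : List (Fin n × Bool)) : VNTerm n :=
  w.foldr (fun a t => .mul (bif a.2 then .star (.var a.1) else .var a.1) t) .one

/-- The Gödel number of the term of a word. -/
def wordCode (w : List (ℕ × Bool)) : ℕ :=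
  w.foldr (fun a c => Nat.pair 4 (Nat.pair
    (bif a.2 then Nat.pair 5 (Nat.pair 0 a.1) else Nat.pair 0 a.1) c)) (Nat.pair 2 0)

theorem code_wordTerm {n : ℕ} (w : List (Fin n × Bool)) :
    (wordTerm w).code = wordCode (rawWord w) := by
  induction w with
  | nil => rfl
  | cons a w ih =>
    have h₁ : wordTerm (a :: w) =
      .mul (bif a.2 then .star (.var a.1) else .var a.1) (wordTerm w) := rfl
    have h₂ : wordCode (rawWord (a :: w)) = Nat.pair 4 (Nat.pair
      (bif a.2 then Nat.pair 5 (Nat.pair 0 a.1) else Nat.pair 0 a.1) (wordCode (rawWord w))) := rfl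
    rw [h₁, h₂, ← ih]
    cases a.2 <;> rfl

theorem evalIn_wordTerm {n : ℕ} {A : Type*} [Ring A] [StarRing A] [Algebra ℂ A] (x : Fin n → A)
    (w : List (Fin n × Bool)) : (wordTerm w).evalIn x = wordEval x w := by
  induction w with
  | nil => rfl
  | cons a w ih =>
    have h₁ : wordTerm (a :: w) =
      .mul (bif a.2 then .star (.var a.1) else .var a.1) (wordTerm w) := rfl
    rw [h₁, wordEval_cons, ← ih]
    cases a.2 <;> rfl

/-- The moment of the word `w` at the coded tuple `pt`. -/
def targetCode (n p : ℕ) (pt : List GaussCode) (w : List (ℕ × Bool)) : GaussCode :=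
  codedTrace p (termMatrix ((List.range n).map fun _ => 1) p pt (wordCode w))

theorem val_targetCode {n : ℕ} (p : ℕ) (pt : List GaussCode) (w : List (Fin n × Bool)) :
    (targetCode n p pt (rawWord w)).val = normalizedTrace (wordEval (codedTuple n p pt) w) := by
  have h : (fun i : Fin n => ((((List.range n).map fun _ => 1).getD i 0 : ℕ) : ℂ) •
      codedTuple n p pt i) = codedTuple n p pt := by
    funext i
    simp
  rw [targetCode, ← code_wordTerm, val_codedTrace, codedMatrix_termMatrix, h, evalIn_wordTerm]

namespace ConnectiveSystem

variable (u : ConnectiveSystem)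

/-- The index of addition. -/
def addIndex : ℕ := u.exists_add.choose

/-- The index of multiplication. -/
def mulIndex : ℕ := u.exists_mul.choose

/-- The index of truncated subtraction. -/
def tsubIndex : ℕ := u.exists_tsub.choose

theorem arity_addIndex : u.arity u.addIndex = 2 := u.exists_add.choose_spec.choose

theorem arity_mulIndex : u.arity u.mulIndex = 2 := u.exists_mul.choose_spec.choose

theorem arity_tsubIndex : u.arity u.tsubIndex = 2 := u.exists_tsub.choose_spec.choose

end ConnectiveSystem

/-- The Gödel number of a formula with a binary connective. -/
def binaryCode (m c d : ℕ) : ℕ := Nat.pair 3 (Nat.pair m (Encodable.encode [c, d]))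

/-- The Gödel number of `QFFormula.deviation`. -/
def deviationCode (u : ConnectiveSystem) (z : GaussCode) (t : ℕ) : ℕ :=
  let s := Nat.pair 3 (Nat.pair t (Nat.pair 6 (Nat.pair
    (Encodable.encode (RatCode.neg z.1, RatCode.neg z.2)) (Nat.pair 2 0))))
  binaryCode u.addIndex (binaryCode u.mulIndex (Nat.pair 0 s) (Nat.pair 0 s))
    (binaryCode u.mulIndex (Nat.pair 1 s) (Nat.pair 1 s))

/-- The Gödel number of `QFFormula.momentDistSq`. -/
def momentDistSqCode (u : ConnectiveSystem) (n d p : ℕ) (pt : List GaussCode) : ℕ :=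
  (rawWordList n d).foldr (fun w c => binaryCode u.addIndex
    (deviationCode u (targetCode n p pt w) (wordCode w)) c) (Nat.pair 0 (Nat.pair 1 0))

/-- The Gödel number of `QFFormula.netDistSq`. -/
def netDistSqCode (u : ConnectiveSystem) (n d p : ℕ) (l : List (List GaussCode)) : ℕ :=
  l.foldr (fun pt c => binaryCode u.tsubIndex (momentDistSqCode u n d p pt)
    (binaryCode u.tsubIndex (momentDistSqCode u n d p pt) c)) (Nat.pair 0 (Nat.pair 2 0))

/-- The Gödel number of `netSentence`. -/
def netSentenceCode (u : ConnectiveSystem) (n d p M : ℕ) : ℕ :=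
  Nat.pair (Encodable.encode ((List.range n).map fun _ => 1))
    (netDistSqCode u n d p (matrixNet n p M))

namespace QFFormula

variable {u : ConnectiveSystem} {n : ℕ}

/-- The formula with a binary connective. -/
def binary (m : ℕ) (h : u.arity m = 2) (φ ψ : QFFormula u n) : QFFormula u n :=
  .conn m fun i => ![φ, ψ] (Fin.cast h i)

theorem code_binary (m : ℕ) (h : u.arity m = 2) (φ ψ : QFFormula u n) :
    (binary m h φ ψ).code = binaryCode m φ.code ψ.code := by
  rw [binary, QFFormula.code, binaryCode, List.ofFn_congr h]
  rfl

/-- The sum of two formulas. -/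
def add (φ ψ : QFFormula u n) : QFFormula u n :=
  binary u.addIndex u.arity_addIndex φ ψ

/-- The product of two formulas. -/
def mul (φ ψ : QFFormula u n) : QFFormula u n :=
  binary u.mulIndex u.arity_mulIndex φ ψ

/-- The truncated difference of two formulas. -/
def tsub (φ ψ : QFFormula u n) : QFFormula u n :=
  binary u.tsubIndex u.arity_tsubIndex φ ψ

theorem code_add (φ ψ : QFFormula u n) :
    (φ.add ψ).code = binaryCode u.addIndex φ.code ψ.code := code_binary _ _ _ _

theorem code_mul (φ ψ : QFFormula u n) :
    (φ.mul ψ).code = binaryCode u.mulIndex φ.code ψ.code := code_binary _ _ _ _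

theorem code_tsub (φ ψ : QFFormula u n) :
    (φ.tsub ψ).code = binaryCode u.tsubIndex φ.code ψ.code := code_binary _ _ _ _

theorem eval_add (x : Fin n → HyperfiniteR) (φ ψ : QFFormula u n) :
    (φ.add ψ).eval x = φ.eval x + ψ.eval x :=
  u.exists_add.choose_spec.choose_spec _

theorem eval_mul (x : Fin n → HyperfiniteR) (φ ψ : QFFormula u n) :
    (φ.mul ψ).eval x = φ.eval x * ψ.eval x :=
  u.exists_mul.choose_spec.choose_spec _

theorem eval_tsub (x : Fin n → HyperfiniteR) (φ ψ : QFFormula u n) :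
    (φ.tsub ψ).eval x = max (φ.eval x - ψ.eval x) 0 :=
  u.exists_tsub.choose_spec.choose_spec _

/-- The square of the distance of the trace of a term from a given Gaussian rational. -/
def deviation (z : GaussCode) (t : VNTerm n) : QFFormula u n :=
  let s := t.add (.smul (RatCode.neg z.1) (RatCode.neg z.2) .one)
  add (mul (.traceRe s) (.traceRe s)) (mul (.traceIm s) (.traceIm s))

theorem code_deviation (z : GaussCode) (t : VNTerm n) :
    (deviation z t : QFFormula u n).code = deviationCode u z t.code := by
  simp only [deviation, code_add, code_mul]
  rfl

theorem eval_deviation (x : Fin n → HyperfiniteR) (z : GaussCode) (t : VNTerm n) :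
    (deviation z t : QFFormula u n).eval x = ‖traceR (t.eval x) - z.val‖ ^ 2 := by
  have h : traceR ((t.add (.smul (RatCode.neg z.1) (RatCode.neg z.2) .one)).eval x) =
      traceR (t.eval x) - z.val := by
    have h₁ := map_add traceRLinear (t.eval x)
      (((RatCode.neg z.1).val + (RatCode.neg z.2).val * Complex.I : ℂ) • (1 : HyperfiniteR))
    rw [map_smul] at h₁
    refine h₁.trans ?_
    change traceR (t.eval x) + _ • traceR 1 = _
    rw [traceR_one, GaussCode.val, RatCode.val_neg, RatCode.val_neg]
    push_cast
    simp only [smul_eq_mul]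
    ring
  rw [Complex.sq_norm, Complex.normSq_apply, ← h, deviation, eval_add, eval_mul, eval_mul]
  rfl

/-- The square of the distance of the moments of degree at most `d` from those of a coded tuple. -/
def momentDistSq (d p : ℕ) (pt : List GaussCode) : QFFormula u n :=
  (wordList n d).foldr
    (fun w φ => add (deviation (targetCode n p pt (rawWord w)) (wordTerm w)) φ) (.traceRe .zero)

theorem code_momentDistSq (d p : ℕ) (pt : List GaussCode) :
    (momentDistSq d p pt : QFFormula u n).code = momentDistSqCode u n d p pt := by
  rw [momentDistSq, momentDistSqCode, rawWordList_eq]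
  induction wordList n d with
  | nil => rfl
  | cons w l ih =>
    rw [List.foldr_cons, List.map_cons, List.foldr_cons, ← ih, code_add, code_deviation,
      code_wordTerm]

theorem eval_momentDistSq (x : Fin n → HyperfiniteR) (d p : ℕ) (pt : List GaussCode) :
    (momentDistSq d p pt : QFFormula u n).eval x = ((wordList n d).map fun w =>
      ‖traceR (wordEval x w) - normalizedTrace (wordEval (codedTuple n p pt) w)‖ ^ 2).sum := by
  rw [momentDistSq]
  induction wordList n d with
  | nil => exact congrArg Complex.re (map_zero traceRLinear)
  | cons w l ih =>
    rw [List.foldr_cons, List.map_cons, List.sum_cons, eval_add, ih, eval_deviation,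
      val_targetCode, VNTerm.eval_eq_evalIn, evalIn_wordTerm]

/-- The minimum of `1` and the squares of the distances of the moments of degree at most `d` from
those of the coded tuples in a list.  The minimum of nonnegative numbers `a` and `b` is the
truncated difference of `a` and the truncated difference of `a` and `b`. -/
def netDistSq (d p : ℕ) (l : List (List GaussCode)) : QFFormula u n :=
  l.foldr (fun pt φ => tsub (momentDistSq d p pt) (tsub (momentDistSq d p pt) φ)) (.traceRe .one)

theorem code_netDistSq (d p : ℕ) (l : List (List GaussCode)) :
    (netDistSq d p l : QFFormula u n).code = netDistSqCode u n d p l := by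
  rw [netDistSq, netDistSqCode]
  induction l with
  | nil => rfl
  | cons pt l ih =>
    rw [List.foldr_cons, List.foldr_cons, ← ih, code_tsub, code_tsub, code_momentDistSq]

theorem eval_momentDistSq_nonneg (x : Fin n → HyperfiniteR) (d p : ℕ) (pt : List GaussCode) :
    0 ≤ (momentDistSq d p pt : QFFormula u n).eval x := by
  rw [eval_momentDistSq]
  refine List.sum_nonneg fun a ha => ?_
  obtain ⟨w, -, rfl⟩ := List.mem_map.1 ha
  positivity

theorem eval_netDistSq_nil (x : Fin n → HyperfiniteR) (d p : ℕ) :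
    (netDistSq d p [] : QFFormula u n).eval x = 1 := by
  change (traceR 1).re = 1
  rw [traceR_one, Complex.one_re]

theorem eval_netDistSq_cons (x : Fin n → HyperfiniteR) (d p : ℕ) (pt : List GaussCode)
    (l : List (List GaussCode)) (h : 0 ≤ (netDistSq d p l : QFFormula u n).eval x) :
    (netDistSq d p (pt :: l) : QFFormula u n).eval x =
      min ((momentDistSq d p pt : QFFormula u n).eval x)
        ((netDistSq d p l : QFFormula u n).eval x) := by
  have h₁ : (netDistSq d p (pt :: l) : QFFormula u n) =
    tsub (momentDistSq d p pt) (tsub (momentDistSq d p pt) (netDistSq d p l)) := rfl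
  have h₂ := eval_momentDistSq_nonneg (u := u) x d p pt
  rw [h₁, eval_tsub, eval_tsub]
  generalize (momentDistSq d p pt : QFFormula u n).eval x = a at *
  generalize (netDistSq d p l : QFFormula u n).eval x = b at *
  rcases le_total a b with hab | hab
  · rw [min_eq_left hab, max_eq_right (sub_nonpos.2 hab), sub_zero, max_eq_left h₂]
  · rw [min_eq_right hab, max_eq_left (sub_nonneg.2 hab), sub_sub_cancel, max_eq_left h]

theorem eval_netDistSq_nonneg (x : Fin n → HyperfiniteR) (d p : ℕ) (l : List (List GaussCode)) :
    0 ≤ (netDistSq d p l : QFFormula u n).eval x := by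
  induction l with
  | nil =>
    rw [eval_netDistSq_nil]
    exact zero_le_one
  | cons pt l ih =>
    rw [eval_netDistSq_cons x d p pt l ih]
    exact le_min (eval_momentDistSq_nonneg x d p pt) ih

theorem eval_netDistSq_le_one (x : Fin n → HyperfiniteR) (d p : ℕ) (l : List (List GaussCode)) :
    (netDistSq d p l : QFFormula u n).eval x ≤ 1 := by
  induction l with
  | nil => rw [eval_netDistSq_nil]
  | cons pt l ih =>
    rw [eval_netDistSq_cons x d p pt l (eval_netDistSq_nonneg x d p l)]
    exact (min_le_right _ _).trans ih

theorem eval_netDistSq_le (x : Fin n → HyperfiniteR) (d p : ℕ) {pt : List GaussCode}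
    {l : List (List GaussCode)} (hpt : pt ∈ l) : (netDistSq d p l : QFFormula u n).eval x ≤
      (momentDistSq d p pt : QFFormula u n).eval x := by
  induction l with
  | nil => simp at hpt
  | cons qt l ih =>
    rw [eval_netDistSq_cons x d p qt l (eval_netDistSq_nonneg x d p l)]
    rcases List.mem_cons.1 hpt with rfl | hpt
    · exact min_le_left _ _
    · exact (min_le_right _ _).trans (ih hpt)

theorem exists_momentDistSq_lt (x : Fin n → HyperfiniteR) (d p : ℕ) {l : List (List GaussCode)}
    {c : ℝ} (hc : c ≤ 1) (h : (netDistSq d p l : QFFormula u n).eval x < c) :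
    ∃ pt ∈ l, (momentDistSq d p pt : QFFormula u n).eval x < c := by
  induction l with
  | nil =>
    rw [eval_netDistSq_nil] at h
    exact absurd h hc.not_gt
  | cons qt l ih =>
    rw [eval_netDistSq_cons x d p qt l (eval_netDistSq_nonneg x d p l), min_lt_iff] at h
    rcases h with h | h
    · exact ⟨qt, List.mem_cons_self, h⟩
    · obtain ⟨pt, hpt, h⟩ := ih h
      exact ⟨pt, List.mem_cons_of_mem _ hpt, h⟩

end QFFormula

/-- The sentence whose value is the supremum over tuples of contractions of `QFFormula.netDistSq`
for the net `matrixNet n p M`.  It dominates the squared distances, capped at `1`, of the points of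
`X(n, d)` from the moments of the net. -/
def netSentence (u : ConnectiveSystem) (n d p M : ℕ) : UniversalSentence u :=
  ⟨n, fun _ => 1, QFFormula.netDistSq d p (matrixNet n p M)⟩

/-- The Gödel number of `netSentence` is computable from its parameters, through
`netSentenceCode`. -/
theorem code_netSentence (u : ConnectiveSystem) (n d p M : ℕ) :
    (netSentence u n d p M).code = netSentenceCode u n d p M := by
  have h : List.ofFn (fun _ : Fin n => 1) = (List.range n).map fun _ => 1 := by
    rw [List.ofFn_const, List.map_const', List.length_range]
  rw [UniversalSentence.code, netSentenceCode, netSentence, QFFormula.code_netDistSq, ← h]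

theorem dist_momentVector_sq_le {n : ℕ} {u : ConnectiveSystem} (x : Fin n → HyperfiniteR)
    (d p : ℕ) (pt : List GaussCode) :
    dist (momentVector d traceR x) (momentVector d normalizedTrace (codedTuple n p pt)) ^ 2 ≤
      (QFFormula.momentDistSq d p pt : QFFormula u n).eval x := by
  rw [EuclideanSpace.dist_sq_eq, QFFormula.eval_momentDistSq]
  refine (le_of_eq ?_).trans (sum_le_sum_wordList (fun w => ‖traceR (wordEval x w) -
    normalizedTrace (wordEval (codedTuple n p pt) w)‖ ^ 2) fun w => by positivity)
  refine Finset.sum_congr rfl fun m _ => ?_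
  simp only [momentVector, StarMonomial.eval_eq_wordEval, dist_eq_norm]

/-- A small value of `netSentence` certifies that the moments of matrices are dense: the points of
the net are moments of contractions. -/
theorem isEpsDenseIn_of_value_lt {u : ConnectiveSystem} {n d p M : ℕ} {ε : ℝ} (hε : 0 < ε)
    (hε₁ : ε ≤ 1) (h : (netSentence u n d p M).value < ε ^ 2) :
    IsEpsDenseIn ε (matrixMomentSet n d p) (momentSet n d) := by
  rintro _ ⟨x, hx, rfl⟩
  have h₁ : (QFFormula.netDistSq d p (matrixNet n p M) : QFFormula u n).eval x ≤
      (netSentence u n d p M).value :=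
    le_ciSup (f := fun x : {x : Fin n → HyperfiniteR // ∀ i, ‖x i‖ ≤ ((1 : ℕ) : ℝ)} =>
      (QFFormula.netDistSq d p (matrixNet n p M) : QFFormula u n).eval x.1)
      ⟨1, Set.forall_mem_range.2 fun x => QFFormula.eval_netDistSq_le_one _ _ _ _⟩
      ⟨x, by simpa using hx⟩
  obtain ⟨pt, hpt, h₂⟩ := QFFormula.exists_momentDistSq_lt x d p (pow_le_one₀ hε.le hε₁)
    (h₁.trans_lt h)
  exact ⟨_, ⟨codedTuple n p pt, norm_codedTuple_le_one hpt, rfl⟩,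
    lt_of_pow_lt_pow_left₀ 2 hε.le ((dist_momentVector_sq_le x d p pt).trans_lt h₂)⟩

theorem value_netSentence_le {u : ConnectiveSystem} {n d p M : ℕ} {η : ℝ}
    (h : ∀ x : Fin n → HyperfiniteR, (∀ i, ‖x i‖ ≤ 1) → ∃ pt ∈ matrixNet n p M,
      ∀ w : List (Fin n × Bool), w.length ≤ d →
        ‖traceR (wordEval x w) - normalizedTrace (wordEval (codedTuple n p pt) w)‖ ≤ η) :
    (netSentence u n d p M).value ≤ (wordList n d).length * η ^ 2 := by
  have : Nonempty {x : Fin (netSentence u n d p M).n → HyperfiniteR //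
      ∀ i, ‖x i‖ ≤ (netSentence u n d p M).radius i} := ⟨⟨fun _ => 0, fun i => by simp⟩⟩
  refine ciSup_le fun x => ?_
  obtain ⟨pt, hpt, hw⟩ := h x.1 fun i => by simpa [netSentence] using x.2 i
  refine (QFFormula.eval_netDistSq_le x.1 d p hpt).trans ?_
  rw [QFFormula.eval_momentDistSq]
  refine (List.sum_le_card_nsmul _ (η ^ 2) fun a ha => ?_).trans_eq
    (by rw [nsmul_eq_mul, List.length_map]; rfl)
  obtain ⟨w, hwd, rfl⟩ := List.mem_map.1 ha
  exact pow_le_pow_left₀ (norm_nonneg _) (hw w (mem_wordList.1 hwd)) 2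

/-- In a suitable dimension and for a fine net the value of `netSentence` is small. -/
theorem exists_value_netSentence_le (u : ConnectiveSystem) (n d : ℕ) {ε : ℝ} (hε : 0 < ε) :
    ∃ p M, (netSentence u n d (p + 1) (M + 2)).value ≤ ε ^ 2 / 2 := by
  set L : ℝ := ((wordList n d).length : ℝ) with hL
  have hL₀ : 0 ≤ L := Nat.cast_nonneg _
  set η := ε / (2 * (L + 1)) with hη
  have hη₀ : 0 < η := by positivity
  obtain ⟨p, hp, hd⟩ := exists_isEpsDenseIn n d (half_pos hη₀)
  obtain ⟨M, hM⟩ := exists_nat_gt ((d : ℝ) * 3 / (η / 2))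
  obtain ⟨p, rfl⟩ := Nat.exists_eq_succ_of_ne_zero hp.ne'
  refine ⟨p, M, (value_netSentence_le (η := η) fun x hx => ?_).trans ?_⟩
  · obtain ⟨pt, hpt, hw⟩ := hd.exists_mem_matrixNet_near hp (Nat.le_add_left 2 M) hx
    refine ⟨pt, hpt, fun w hwd => (hw w hwd).trans ?_⟩
    have h₁ : (d : ℝ) * (3 / ((M + 2 : ℕ) : ℝ)) ≤ η / 2 := by
      have h₂ : (0 : ℝ) < ((M + 2 : ℕ) : ℝ) := by positivity
      rw [← mul_div_assoc, div_le_iff₀ h₂]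
      rw [div_lt_iff₀ (half_pos hη₀)] at hM
      push_cast
      nlinarith
    linarith
  · have h₁ : η * (2 * (L + 1)) = ε := div_mul_cancel₀ _ (by positivity)
    rw [← hL, ← h₁]
    have h₂ : 0 ≤ η ^ 2 := sq_nonneg η
    nlinarith [mul_nonneg h₂ hL₀, mul_nonneg (mul_nonneg h₂ hL₀) hL₀]

section Computable

variable {α : Type*} [Primcodable α] {u : ConnectiveSystem}

@[fun_prop]
theorem computable_rawWordList {n d : α → ℕ} (hn : Computable n) (hd : Computable d) :
    Computable fun a => rawWordList (n a) (d a) := by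
  unfold rawWordList; fun_prop

@[fun_prop]
theorem computable_wordCode {w : α → List (ℕ × Bool)} (hw : Computable w) :
    Computable fun a => wordCode (w a) := by
  unfold wordCode; fun_prop

@[fun_prop]
theorem computable_targetCode {n p : α → ℕ} {pt : α → List GaussCode} {w : α → List (ℕ × Bool)}
    (hn : Computable n) (hp : Computable p) (hpt : Computable pt) (hw : Computable w) :
    Computable fun a => targetCode (n a) (p a) (pt a) (w a) := by
  unfold targetCode; fun_prop

@[fun_prop]
theorem computable_binaryCode {m c d : α → ℕ} (hm : Computable m) (hc : Computable c)
    (hd : Computable d) : Computable fun a => binaryCode (m a) (c a) (d a) := by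
  unfold binaryCode; fun_prop

@[fun_prop]
theorem computable_deviationCode {z : α → GaussCode} {t : α → ℕ} (hz : Computable z)
    (ht : Computable t) : Computable fun a => deviationCode u (z a) (t a) := by
  unfold deviationCode; fun_prop

@[fun_prop]
theorem computable_momentDistSqCode {n d p : α → ℕ} {pt : α → List GaussCode}
    (hn : Computable n) (hd : Computable d) (hp : Computable p) (hpt : Computable pt) :
    Computable fun a => momentDistSqCode u (n a) (d a) (p a) (pt a) := by
  unfold momentDistSqCode; fun_prop

@[fun_prop]
theorem computable_netDistSqCode {n d p : α → ℕ} {l : α → List (List GaussCode)}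
    (hn : Computable n) (hd : Computable d) (hp : Computable p) (hl : Computable l) :
    Computable fun a => netDistSqCode u (n a) (d a) (p a) (l a) := by
  unfold netDistSqCode; fun_prop

@[fun_prop]
theorem computable_netSentenceCode {n d p M : α → ℕ} (hn : Computable n) (hd : Computable d)
    (hp : Computable p) (hM : Computable M) :
    Computable fun a => netSentenceCode u (n a) (d a) (p a) (M a) := by
  unfold netSentenceCode; fun_prop

end Computable

/-! ### Rates of density from the universal theory -/

/-- The input to the algorithm for the universal theory, at stage `i` of the search for a dimension
for `(n, d, k)`: a sentence `netSentence` and a code of `1 / (2 (k + 1) ^ 2 + 1)`. -/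
def rateQuery (u : ConnectiveSystem) (a : ℕ × ℕ × ℕ) (i : ℕ) : ℕ × RatCode :=
  (netSentenceCode u a.1 a.2.1 (i.unpair.1 + 1) (i.unpair.2 + 2),
    (1, 0, 2 * ((a.2.2 + 1) * (a.2.2 + 1))))

/-- A code of `1 / (k + 1) ^ 2`. -/
def rateThreshold (a : ℕ × ℕ × ℕ) : RatCode := (1, 0, (a.2.2 + 1) * (a.2.2 + 1) - 1)

theorem val_rateThreshold (a : ℕ × ℕ × ℕ) :
    ((rateThreshold a).val : ℝ) = (1 / ((a.2.2 : ℝ) + 1)) ^ 2 := by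
  have h : (((a.2.2 + 1) * (a.2.2 + 1) - 1 : ℕ) : ℝ) + 1 =
      ((a.2.2 : ℝ) + 1) * ((a.2.2 : ℝ) + 1) := by
    rw [Nat.cast_sub (Nat.mul_pos (Nat.succ_pos _) (Nat.succ_pos _))]
    push_cast
    ring
  simp only [rateThreshold, RatCode.val]
  push_cast
  rw [h, sub_zero, div_pow, one_pow, sq]

/-- If the universal theory is computable, then a dimension in which the moments of matrices are
sufficiently dense can be found by unbounded search. -/
theorem exists_rate_of_universalTheoryComputable {u : ConnectiveSystem}
    (h : UniversalTheoryComputable u) : ∃ F : ℕ × ℕ × ℕ → ℕ, Computable F ∧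
      ∀ n d k : ℕ, 0 < F (n, d, k) ∧
        IsEpsDenseIn (1 / ((k : ℝ) + 1)) (matrixMomentSet n d (F (n, d, k))) (momentSet n d) := by
  obtain ⟨alg, halg, hspec⟩ := h
  have hspec' : ∀ (a : ℕ × ℕ × ℕ) (i : ℕ), ∃ r s : RatCode, (r, s) ∈ alg (rateQuery u a i) ∧
      (s.val : ℝ) - r.val < 1 / (2 * ((a.2.2 : ℝ) + 1) ^ 2) ∧
      (netSentence u a.1 a.2.1 (i.unpair.1 + 1) (i.unpair.2 + 2)).value ∈
        Set.Ioo (r.val : ℝ) (s.val : ℝ) := by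
    intro a i
    have hδ : RatCode.val (1, 0, 2 * ((a.2.2 + 1) * (a.2.2 + 1))) =
        1 / (2 * ((a.2.2 : ℚ) + 1) ^ 2 + 1) := by
      simp only [RatCode.val]
      push_cast
      ring
    obtain ⟨r, s, h₁, h₂, h₃⟩ := hspec
      (netSentence u a.1 a.2.1 (i.unpair.1 + 1) (i.unpair.2 + 2))
      (1, 0, 2 * ((a.2.2 + 1) * (a.2.2 + 1))) (by rw [hδ]; positivity)
    rw [code_netSentence] at h₁
    refine ⟨r, s, h₁, ?_, h₃⟩
    rw [hδ, ← Rat.cast_lt (K := ℝ)] at h₂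
    push_cast at h₂
    refine h₂.trans_le (one_div_le_one_div_of_le (by positivity) ?_)
    linarith
  set test : ℕ × ℕ × ℕ → ℕ →. Bool := fun a i =>
    (alg (rateQuery u a i)).map fun r => r.2.ble (rateThreshold a) with htest
  have hquery : Computable fun x : (ℕ × ℕ × ℕ) × ℕ => rateQuery u x.1 x.2 := by
    unfold rateQuery; fun_prop
  have hble : Computable fun x : ((ℕ × ℕ × ℕ) × ℕ) × (RatCode × RatCode) =>
      x.2.2.ble (rateThreshold x.1.1) := by
    unfold rateThreshold; fun_prop
  have htest₁ : Partrec₂ test := (halg.comp hquery).map hble.to₂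
  have hdim : Computable fun x : (ℕ × ℕ × ℕ) × ℕ => x.2.unpair.1 + 1 := by fun_prop
  have hsearch : Partrec fun a => (Nat.rfind (test a)).map fun i => i.unpair.1 + 1 :=
    (Partrec.rfind htest₁).map hdim.to₂
  -- the search succeeds, since the value is at most half of the threshold at some stage
  have hdom : ∀ a, (Nat.rfind (test a)).Dom := by
    intro a
    obtain ⟨p, M, hpM⟩ := exists_value_netSentence_le u a.1 a.2.1
      (ε := 1 / ((a.2.2 : ℝ) + 1)) (by positivity)
    refine Nat.rfind_dom.2 ⟨Nat.pair p M, ?_, fun {m} _ => ?_⟩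
    · obtain ⟨r, s, h₁, h₂, h₃⟩ := hspec' a (Nat.pair p M)
      refine (Part.mem_map_iff _).2 ⟨_, h₁, ?_⟩
      rw [RatCode.ble_iff, val_rateThreshold]
      rw [Nat.unpair_pair] at h₃
      have h₄ : 1 / (2 * ((a.2.2 : ℝ) + 1) ^ 2) = (1 / ((a.2.2 : ℝ) + 1)) ^ 2 / 2 := by
        field_simp
      rw [h₄] at h₂
      linarith [h₃.1]
    · obtain ⟨r, s, h₁, -⟩ := hspec' a m
      exact Part.dom_iff_mem.2 ⟨_, Part.mem_map _ h₁⟩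
  refine ⟨fun a => ((Nat.rfind (test a)).get (hdom a)).unpair.1 + 1,
    hsearch.of_eq fun a => Part.eq_some_iff.2 (Part.mem_map _ (Part.get_mem (hdom a))),
    fun n d k => ⟨Nat.succ_pos _, ?_⟩⟩
  set i := (Nat.rfind (test (n, d, k))).get (hdom (n, d, k)) with hi
  have hmem : true ∈ test (n, d, k) i := Nat.rfind_spec (Part.get_mem (hdom (n, d, k)))
  obtain ⟨r, s, h₁, -, h₃⟩ := hspec' (n, d, k) i
  obtain ⟨t, ht, hts⟩ := (Part.mem_map_iff _).1 hmem
  rw [Part.mem_unique ht h₁, RatCode.ble_iff, val_rateThreshold] at hts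
  refine isEpsDenseIn_of_value_lt (by positivity) ?_ (h₃.2.trans_le hts)
  rw [div_le_one (by positivity)]
  linarith [Nat.cast_nonneg (α := ℝ) k]

end

theorem mainTheorem3 (u : ConnectiveSystem) :
    UniversalTheoryComputable u ↔
      ∃ F : ℕ × ℕ × ℕ → ℕ, Computable F ∧
        ∀ n d k : ℕ, 0 < n → 0 < d → 0 < k →
          0 < F (n, d, k) ∧
            IsEpsDenseIn (1 / (k : ℝ)) (matrixMomentSet n d (F (n, d, k))) (momentSet n d) := by
  constructor
  · intro h
    obtain ⟨F, hF, hdense⟩ := exists_rate_of_universalTheoryComputable h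
    refine ⟨F, hF, fun n d k _ _ hk => ⟨(hdense n d k).1, fun t ht => ?_⟩⟩
    obtain ⟨s, hs, hts⟩ := (hdense n d k).2 t ht
    have hk' : (0 : ℝ) < k := by exact_mod_cast hk
    exact ⟨s, hs, hts.trans (one_div_lt_one_div_of_lt hk' (lt_add_one _))⟩
  · rintro ⟨F, hF, hdense⟩
    exact universalTheoryComputable_of_rate hF hdense
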